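/- **Theorem (Characterization of $k$-fold Gaussian ensembles).** Let $k\ge 0$, let $V=\mathbb K^d$ and $N=d^k$, and index the rows and columns of $N\times N$ matrices by the standard basis of $V^{\otimes k}$. Consider one of the following symmetry types, each consisting of a compact matrix group $G$, a real vector space $\mathcal H$ of $N\times N$ matrices over $\mathbb K$ and an action of operators $A$ on $V^{\otimes k}$ on matrices. * *Unitary:* $\mathbb K=\mathbb C$, $G=U(d)$, $\mathcal H$ = Hermitian matrices, $A\cdot H=AHA^\dagger$. * *Orthogonal:* $\mathbb K=\mathbb R$, $G=O(d)$, $\mathcal H$ = real symmetric matrices, $A\cdot H=AHA^\dagger$. * *Symplectic:* $\mathbb K=\mathbb C$, $d=2m$, $Sp(d)=\{g\in U(d): gJg^T=J\}$ with $J$ the standard symplectic form, and any of: (a) $G=Sp(d)$, $\mathcal H$ = complex skew-symmetric matrices, $A\cdot H=AHA^T$; (b) $G=Sp(d)$, $\mathcal H$ = Hermitian matrices $H$ with $HJ^{\otimes k}$ skew-symmetric, $A\cdot H=AHA^\dagger$ (for $k=1$ these are the matrices of the Gaussian symplectic ensemble); (c) $G$ = the real matrices in $Sp(d)$, $\mathcal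 H$ = real skew-symmetric matrices, $A\cdot H=AHA^\dagger$. Let $dH$ be Lebesgue measure on $\mathcal H$ and $\vec H\in\mathbb K^{N^2}$ the vectorization of $H$. A *$k$-fold Gaussian ensemble* is a probability measure $P$ on $\mathcal H$ such that (I) $P$ is invariant under $H\mapsto g^{\otimes k}\cdot H$ for all $g\in G$; (II) $P\propto\exp(-\frac12\vec H^\dagger\Delta\vec H)\,dH$ for some positive definite Hermitian (for $\mathbb K=\mathbb R$: symmetric) $N^2\times N^2$ matrix $\Delta$ over $\mathbb K$; (III) $P$ is invariant under $H\mapsto S_\sigma\cdot H$ for all $\sigma\in S_k$, where $S_\sigma$ permutes the tensor factors of $V^{\otimes k}$. The group $G\times S_k\times\mathbb Z_2$ acts on $\mathbb K^{N^2}$ (all $N\times N$ matrices over $\mathbb K$): $(g,\sigma)$ acts by $H\mapsto (g^{\otimes k}S_\sigma)\cdot H$, and the generator of $\mathbb Z_2$ acts by the exchange of the two tensor factors, which is: $H\mapsto H^T$ in the orthogonal case and in (a), (c); $X\mapsto (XJ^{\otimes k})^T(J^{\otimes k})^{-1}$ in (b); and in the unitary case the complex-linear extension of $H\mapsto H^\dagger$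 on $\mathcal H$, i.e. the identity. On $\mathcal H$ it is the scalar $s_0$, with $s_0=+$ in the unitary and orthogonal cases and $s_0=-$ in the symplectic cases. For continuous irreducible representations (up to equivalence, over $\mathbb K$, chosen unitary, resp. orthogonal) $\mu$ of $G$ and $\mu'$ of $S_k$, of dimensions $d_\mu$ and $d'_{\mu'}$, and $s\in\{\pm\}$, let $C_{\mu\mu's}=\dim_{\mathbb K}\mathrm{Hom}_{G\times S_k\times\mathbb Z_2}(\mu\otimes\mu'\otimes s,\ \mathbb K^{N^2})$. Then only finitely many $C_{\mu\mu's}$ are nonzero, and there is a fixed unitary (orthogonal if $\mathbb K=\mathbb R$) $N^2\times N^2$ matrix $U$, with $U^\dagger(\cdot)U$ carrying the above representation to $\bigoplus_{\mu,\mu',s}\mathbb 1_{C_{\mu\mu's}}\otimes\mu\otimes\mu'\otimes s$, such that, writing $$\Delta_M=U\Big[\bigoplus_{\mu,\mu'}\bigoplus_{s\in\pm}M_{\mu\mu's}\otimes\mathbb 1_{d_\mu}\otimes\mathbb 1_{d'_{\mu'}}\Big]U^\dagger$$ for families $M$ of matrices $M_{\mu\mu's}$ over $\mathbb K$ of size $C_{\mu\mu's}\times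 C_{\mu\mu's}$: 1. For every $k$-fold Gaussian ensemble $P$ there are positive definite Hermitian (symmetric if $\mathbb K=\mathbb R$) $M_{\mu\mu's}$ such that $\Delta_M$ maps $\{\vec H:H\in\mathcal H\}$ into itself and $P\propto\exp(-\frac12\vec H^\dagger\Delta_M\vec H)\,dH$. The blocks $M_{\mu\mu's_0}$ are uniquely determined by $P$ under these conditions (the blocks with $s\ne s_0$ do not enter the density). 2. Conversely, for every family of positive definite $M_{\mu\mu's}$ there is a $k$-fold Gaussian ensemble $P\propto\exp(-\frac12\vec H^\dagger\Delta_M\vec H)\,dH$. -/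

import Mathlib

open scoped Matrix Kronecker ComplexOrder
open MeasureTheory

namespace KFold

/-- Measurable structure on matrices: the product one (entrywise). -/
instance matrixMeasurableSpace {m n 𝕜 : Type} [MeasurableSpace 𝕜] :
    MeasurableSpace (Matrix m n 𝕜) := inferInstanceAs (MeasurableSpace (m → n → 𝕜))

/-! ### Tensor powers, tensor permutations, superoperators -/

section Tensor

variable {𝕜 : Type} [RCLike 𝕜] {n : Type} [Fintype n] [DecidableEq n]

/-- The index set of the standard basis `|i₁ … i_k⟩` of `V^{⊗k}`, where `V = 𝕜^n`. -/
abbrev MIdx (n : Type) (k : ℕ) : Type := Fin k → n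

/-- The `k`-fold tensor power `A ⊗ ⋯ ⊗ A`. -/
def tensorPow (k : ℕ) (A : Matrix n n 𝕜) : Matrix (MIdx n k) (MIdx n k) 𝕜 :=
  Matrix.of fun i j => ∏ a, A (i a) (j a)

/-- The operator permuting the `k` tensor factors: `|j⟩ ↦ |j ∘ σ⁻¹⟩`.
With the inverse, `σ ↦ permOp σ` is a homomorphism. -/
def permOp {k : ℕ} (σ : Equiv.Perm (Fin k)) : Matrix (MIdx n k) (MIdx n k) 𝕜 :=
  Matrix.of fun i j => if i = j ∘ σ.symm then 1 else 0

/-- The matrix, in the coordinates `Matrix.vec`, of a linear map on matrices. -/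
def superMatrix {ι : Type} [DecidableEq ι] (f : Matrix ι ι 𝕜 →ₗ[𝕜] Matrix ι ι 𝕜) :
    Matrix (ι × ι) (ι × ι) 𝕜 :=
  Matrix.of fun p q => (f (Matrix.single q.2 q.1 1)).vec p

theorem superMatrix_mulVec_vec {ι : Type} [Fintype ι] [DecidableEq ι]
    (f : Matrix ι ι 𝕜 →ₗ[𝕜] Matrix ι ι 𝕜) (H : Matrix ι ι 𝕜) :
    superMatrix f *ᵥ H.vec = (f H).vec := by
  ext p
  conv_rhs => rw [Matrix.matrix_eq_sum_single H]
  simp only [Matrix.mulVec, dotProduct, superMatrix, Matrix.of_apply, Matrix.vec, map_sum,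
    Matrix.sum_apply]
  rw [Fintype.sum_prod_type_right]
  refine Finset.sum_congr rfl fun i _ => Finset.sum_congr rfl fun j _ => ?_
  have : Matrix.single i j (H i j) = H i j • Matrix.single i j (1 : 𝕜) := by
    rw [Matrix.smul_single, smul_eq_mul, mul_one]
  rw [this, map_smul, Matrix.smul_apply, smul_eq_mul, mul_comm]

end Tensor

/-! ### The dual of a compact group -/

section Dual

/-- A continuous irreducible representation of `Γ` by unitary (for `𝕜 = ℝ`: orthogonal)
matrices over `𝕜`. -/
structure Irrep (𝕜 : Type) [RCLike 𝕜] (Γ : Type) [Group Γ] [TopologicalSpace Γ] where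
  /-- the dimension -/
  dim : ℕ
  dim_pos : 0 < dim
  /-- the representing matrices -/
  rho : Γ →* Matrix.unitaryGroup (Fin dim) 𝕜
  continuous_rho : Continuous rho
  irreducible : ∀ W : Submodule 𝕜 (Fin dim → 𝕜),
    (∀ g : Γ, ∀ v ∈ W, (rho g : Matrix (Fin dim) (Fin dim) 𝕜) *ᵥ v ∈ W) → W = ⊥ ∨ W = ⊤

variable (𝕜 : Type) [RCLike 𝕜] (Γ : Type) [Group Γ] [TopologicalSpace Γ]

/-- Equivalence of irreducible representations: existence of an invertible intertwiner. -/
instance irrepSetoid : Setoid (Irrep 𝕜 Γ) where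
  r π π' := ∃ e : (Fin π.dim → 𝕜) ≃ₗ[𝕜] (Fin π'.dim → 𝕜), ∀ (g : Γ) (v : Fin π.dim → 𝕜),
    e ((π.rho g : Matrix _ _ 𝕜) *ᵥ v) = (π'.rho g : Matrix _ _ 𝕜) *ᵥ e v
  iseqv :=
    { refl := fun _ => ⟨LinearEquiv.refl 𝕜 _, fun _ _ => rfl⟩
      symm := by
        rintro π π' ⟨e, he⟩
        exact ⟨e.symm, fun g v => by rw [LinearEquiv.symm_apply_eq, he, e.apply_symm_apply]⟩
      trans := by
        rintro π π' π'' ⟨e, he⟩ ⟨f, hf⟩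
        exact ⟨e.trans f, fun g v => by simp only [LinearEquiv.trans_apply, he, hf]⟩ }

/-- The dual: the set of equivalence classes of irreducible representations. -/
def Dual : Type := Quotient (irrepSetoid 𝕜 Γ)

variable {𝕜 Γ}

/-- A fixed representative of a class in the dual. -/
noncomputable def Dual.rep (μ : Dual 𝕜 Γ) : Irrep 𝕜 Γ := Quotient.out μ

/-- The dimension `d_μ` of the class `μ`. -/
noncomputable abbrev Dual.dim (μ : Dual 𝕜 Γ) : ℕ := μ.rep.dim

/-- The matrix of `g` in the representative of `μ`. -/
noncomputable abbrev Dual.mat (μ : Dual 𝕜 Γ) (g : Γ) :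
    Matrix (Fin μ.dim) (Fin μ.dim) 𝕜 := μ.rep.rho g

/-- The dual of the symmetric group `S_k` (a discrete group). -/
abbrev SymDual (𝕜 : Type) [RCLike 𝕜] (k : ℕ) : Type :=
  @Dual 𝕜 _ (Equiv.Perm (Fin k)) _ ⊥

/-- The dimension `d'_{μ'}` of an irreducible representation of `S_k`. -/
noncomputable abbrev SymDual.dim {𝕜 : Type} [RCLike 𝕜] {k : ℕ} (μ' : SymDual 𝕜 k) : ℕ :=
  @Dual.dim 𝕜 _ (Equiv.Perm (Fin k)) _ ⊥ μ'

/-- The matrix of `σ` in the representative of `μ'`. -/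
noncomputable abbrev SymDual.mat {𝕜 : Type} [RCLike 𝕜] {k : ℕ} (μ' : SymDual 𝕜 k)
    (σ : Equiv.Perm (Fin k)) : Matrix (Fin (SymDual.dim μ')) (Fin (SymDual.dim μ')) 𝕜 :=
  @Dual.mat 𝕜 _ (Equiv.Perm (Fin k)) _ ⊥ μ' σ

end Dual

/-! ### Symmetry types of random matrices -/

/-- The data of a symmetry type: the group, the space of random matrices, how an operator `A` of
`V^{⊗k}` acts on matrices (`H ↦ A * H * right A`), and the `ℤ/2`-action `swap` exchanging the two
factors of `V^{⊗k} ⊗ V^{⊗k}`, which is the scalar `sign` on the space of random matrices.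
Only the five instances below are used. -/
structure MatrixModel (𝕜 : Type) [RCLike 𝕜] (n : Type) [Fintype n] [DecidableEq n] (k : ℕ) where
  /-- the group `G` of unitary matrices -/
  group : Subgroup (Matrix.unitaryGroup n 𝕜)
  /-- the real vector space in which the random matrix `H` lives -/
  space : Submodule ℝ (Matrix (MIdx n k) (MIdx n k) 𝕜)
  /-- the right factor of the action -/
  right : Matrix (MIdx n k) (MIdx n k) 𝕜 → Matrix (MIdx n k) (MIdx n k) 𝕜
  /-- the exchange of the two factors of `V^{⊗k} ⊗ V^{⊗k}` -/
  swap : Matrix (MIdx n k) (MIdx n k) 𝕜 →ₗ[𝕜] Matrix (MIdx n k) (MIdx n k) 𝕜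
  /-- the sign by which `swap` acts on `space` -/
  sign : ℤˣ

section Instances

/-- Transposition as a linear map. -/
def transposeMap (ι 𝕜 : Type) [RCLike 𝕜] : Matrix ι ι 𝕜 →ₗ[𝕜] Matrix ι ι 𝕜 where
  toFun H := Hᵀ
  map_add' _ _ := Matrix.transpose_add _ _
  map_smul' _ _ := Matrix.transpose_smul _ _

/-- The unitary group `U(d)` acting on Hermitian matrices by `H ↦ A H A†`. The exchange of the two
factors is `H ↦ H†` on Hermitian matrices, that is, the identity; its complex-linear extension to
all complex matrices is the identity. -/
noncomputable def unitaryModel (d k : ℕ) : MatrixModel ℂ (Fin d) k where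
  group := ⊤
  space :=
    { carrier := {H | Hᴴ = H}
      add_mem' := fun {a b} ha hb => by
        simp only [Set.mem_ofPred_eq] at *
        rw [Matrix.conjTranspose_add, ha, hb]
      zero_mem' := Matrix.conjTranspose_zero
      smul_mem' := fun c a ha => by
        simp only [Set.mem_ofPred_eq] at *
        rw [Matrix.conjTranspose_smul, ha, star_trivial] }
  right A := Aᴴ
  swap := LinearMap.id
  sign := 1

/-- The orthogonal group `O(d)` acting on real symmetric matrices by `H ↦ A H A†`. -/
noncomputable def orthogonalModel (d k : ℕ) : MatrixModel ℝ (Fin d) k where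
  group := ⊤
  space :=
    { carrier := {H | Hᵀ = H}
      add_mem' := fun {a b} ha hb => by
        simp only [Set.mem_ofPred_eq] at *
        rw [Matrix.transpose_add, ha, hb]
      zero_mem' := Matrix.transpose_zero
      smul_mem' := fun c a ha => by
        simp only [Set.mem_ofPred_eq] at *
        rw [Matrix.transpose_smul, ha] }
  right A := Aᴴ
  swap := transposeMap _ ℝ
  sign := 1

/-- The compact symplectic group `Sp(2m)`: the unitary matrices `g` with `g J gᵀ = J`. -/
def compactSymplectic (m : ℕ) : Subgroup (Matrix.unitaryGroup (Fin m ⊕ Fin m) ℂ) where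
  carrier := {g | (g : Matrix (Fin m ⊕ Fin m) (Fin m ⊕ Fin m) ℂ) ∈ Matrix.symplecticGroup (Fin m) ℂ}
  mul_mem' := fun {a b} ha hb => by
    simp only [Set.mem_ofPred_eq] at *
    exact mul_mem ha hb
  one_mem' := by
    simp only [Set.mem_ofPred_eq]
    exact one_mem _
  inv_mem' := fun {a} ha => by
    simp only [Set.mem_ofPred_eq, SymplecticGroup.mem_iff] at *
    have h1 : ((a⁻¹ : Matrix.unitaryGroup (Fin m ⊕ Fin m) ℂ) : Matrix (Fin m ⊕ Fin m) (Fin m ⊕ Fin m) ℂ) * a = 1 := by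
      rw [← Matrix.UnitaryGroup.mul_val, inv_mul_cancel, Matrix.UnitaryGroup.one_val]
    set b := ((a⁻¹ : Matrix.unitaryGroup (Fin m ⊕ Fin m) ℂ) : Matrix (Fin m ⊕ Fin m) (Fin m ⊕ Fin m) ℂ)
    have h2 : (a : Matrix (Fin m ⊕ Fin m) (Fin m ⊕ Fin m) ℂ)ᵀ * bᵀ = 1 := by
      rw [← Matrix.transpose_mul, h1, Matrix.transpose_one]
    calc b * Matrix.J (Fin m) ℂ * bᵀ
        = b * (a * Matrix.J (Fin m) ℂ * (a : Matrix (Fin m ⊕ Fin m) (Fin m ⊕ Fin m) ℂ)ᵀ) * bᵀ := by rw [ha]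
      _ = (b * a) * Matrix.J (Fin m) ℂ * ((a : Matrix (Fin m ⊕ Fin m) (Fin m ⊕ Fin m) ℂ)ᵀ * bᵀ) := by
          simp only [Matrix.mul_assoc]
      _ = Matrix.J (Fin m) ℂ := by rw [h1, h2, Matrix.one_mul, Matrix.mul_one]

/-- The subgroup of the real matrices in the compact symplectic group. -/
def realSymplectic (m : ℕ) : Subgroup (Matrix.unitaryGroup (Fin m ⊕ Fin m) ℂ) where
  carrier := {g | g ∈ compactSymplectic m ∧ (g : Matrix (Fin m ⊕ Fin m) (Fin m ⊕ Fin m) ℂ).map star = g}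
  mul_mem' := fun {a b} ha hb => by
    refine ⟨mul_mem ha.1 hb.1, ?_⟩
    have h := Matrix.map_mul (L := (a : Matrix (Fin m ⊕ Fin m) (Fin m ⊕ Fin m) ℂ)) (M := (b : Matrix (Fin m ⊕ Fin m) (Fin m ⊕ Fin m) ℂ))
      (f := starRingEnd ℂ)
    change ((a : Matrix (Fin m ⊕ Fin m) (Fin m ⊕ Fin m) ℂ) * (b : Matrix (Fin m ⊕ Fin m) (Fin m ⊕ Fin m) ℂ)).map (starRingEnd ℂ) = _
    rw [h]
    exact congrArg₂ (· * ·) ha.2 hb.2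
  one_mem' := by
    refine ⟨one_mem _, ?_⟩
    exact Matrix.map_one _ (star_zero ℂ) (star_one ℂ)
  inv_mem' := fun {a} ha => by
    refine ⟨inv_mem ha.1, ?_⟩
    change ((star (a : Matrix (Fin m ⊕ Fin m) (Fin m ⊕ Fin m) ℂ))).map star = star (a : Matrix (Fin m ⊕ Fin m) (Fin m ⊕ Fin m) ℂ)
    have h := ha.2
    ext i j
    have := congrFun (congrFun h j) i
    simp only [Matrix.map_apply, Matrix.star_apply] at this ⊢
    rw [this]
    exact this

/-- `Sp(2m)` acting on complex skew-symmetric matrices by change of basis of bilinear forms,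
`H ↦ A H Aᵀ` (the action of `A ⊗ A` on `vec H`). -/
noncomputable def symplecticModel (m k : ℕ) : MatrixModel ℂ (Fin m ⊕ Fin m) k where
  group := compactSymplectic m
  space :=
    { carrier := {H | Hᵀ = -H}
      add_mem' := fun {a b} ha hb => by
        simp only [Set.mem_ofPred_eq] at *
        rw [Matrix.transpose_add, ha, hb, neg_add]
      zero_mem' := by simp
      smul_mem' := fun c a ha => by
        simp only [Set.mem_ofPred_eq] at *
        rw [Matrix.transpose_smul, ha, smul_neg] }
  right A := Aᵀ
  swap := transposeMap _ ℂ
  sign := -1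

/-- `Sp(2m)` acting by `H ↦ A H A†` on Hermitian matrices `H` for which `H J^{⊗k}` is
skew-symmetric. For `k = 1` these are the matrices of the Gaussian symplectic ensemble. -/
noncomputable def hermitianSymplecticModel (m k : ℕ) : MatrixModel ℂ (Fin m ⊕ Fin m) k where
  group := compactSymplectic m
  space :=
    { carrier := {H | Hᴴ = H ∧ (H * tensorPow k (Matrix.J (Fin m) ℂ))ᵀ =
        -(H * tensorPow k (Matrix.J (Fin m) ℂ))}
      add_mem' := fun {a b} ha hb => by
        simp only [Set.mem_ofPred_eq] at *
        refine ⟨by rw [Matrix.conjTranspose_add, ha.1, hb.1], ?_⟩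
        rw [Matrix.add_mul, Matrix.transpose_add, ha.2, hb.2, neg_add]
      zero_mem' := by simp
      smul_mem' := fun c a ha => by
        simp only [Set.mem_ofPred_eq] at *
        refine ⟨by rw [Matrix.conjTranspose_smul, ha.1, star_trivial], ?_⟩
        rw [Matrix.smul_mul, Matrix.transpose_smul, ha.2, smul_neg] }
  right A := Aᴴ
  -- the transposition of `H * J^{⊗k}`; the inverse of `J^{⊗k}` is its transpose
  swap :=
    LinearMap.mulRight ℂ (tensorPow k (Matrix.J (Fin m) ℂ))ᵀ ∘ₗ transposeMap _ ℂ ∘ₗ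
      LinearMap.mulRight ℂ (tensorPow k (Matrix.J (Fin m) ℂ))
  sign := -1

/-- The real symplectic matrices in `Sp(2m)` acting on real skew-symmetric matrices by
`H ↦ A H A†`. -/
noncomputable def realSymplecticModel (m k : ℕ) : MatrixModel ℂ (Fin m ⊕ Fin m) k where
  group := realSymplectic m
  space :=
    { carrier := {H | H.map star = H ∧ Hᵀ = -H}
      add_mem' := fun {a b} ha hb => by
        refine ⟨?_, by rw [Matrix.transpose_add, ha.2, hb.2, neg_add]⟩
        ext i j
        have h1 := congrFun (congrFun ha.1 i) j
        have h2 := congrFun (congrFun hb.1 i) j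
        simp only [Matrix.map_apply, Matrix.add_apply, star_add] at *
        rw [h1, h2]
      zero_mem' := by
        refine ⟨?_, by simp⟩
        ext i j
        simp
      smul_mem' := fun c a ha => by
        refine ⟨?_, by rw [Matrix.transpose_smul, ha.2, smul_neg]⟩
        ext i j
        have h1 := congrFun (congrFun ha.1 i) j
        simp only [Matrix.map_apply, Matrix.smul_apply, star_smul, star_trivial] at *
        rw [h1] }
  right A := Aᴴ
  swap := transposeMap _ ℂ
  sign := -1

end Instances

/-- The unitary, orthogonal and symplectic symmetry types. -/
inductive IsClassical : {𝕜 : Type} → [RCLike 𝕜] → {n : Type} → [Fintype n] → [DecidableEq n] →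
    {k : ℕ} → MatrixModel 𝕜 n k → Prop
  | unitary (d k : ℕ) : IsClassical (unitaryModel d k)
  | orthogonal (d k : ℕ) : IsClassical (orthogonalModel d k)
  | symplectic (m k : ℕ) : IsClassical (symplecticModel m k)
  | hermitianSymplectic (m k : ℕ) : IsClassical (hermitianSymplecticModel m k)
  | realSymplectic (m k : ℕ) : IsClassical (realSymplecticModel m k)

namespace MatrixModel

variable {𝕜 : Type} [RCLike 𝕜] {n : Type} [Fintype n] [DecidableEq n] {k : ℕ}
  (X : MatrixModel 𝕜 n k)

/-- The transformation `H ↦ A * H * right A` of matrices. -/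
def act (A : Matrix (MIdx n k) (MIdx n k) 𝕜) :
    Matrix (MIdx n k) (MIdx n k) 𝕜 →ₗ[𝕜] Matrix (MIdx n k) (MIdx n k) 𝕜 :=
  LinearMap.mulRight 𝕜 (X.right A) ∘ₗ LinearMap.mulLeft 𝕜 A

/-! ### `k`-fold Gaussian ensembles -/

instance finite_space : Module.Finite ℝ X.space := by
  have : Module.Finite ℝ (Matrix (MIdx n k) (MIdx n k) 𝕜) :=
    inferInstanceAs (Module.Finite ℝ (MIdx n k → MIdx n k → 𝕜))
  infer_instance

/-- Lebesgue measure `dH` on the space of random matrices, in the coordinates of a basis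
(another basis changes it by a positive factor), as a measure on all matrices. -/
noncomputable def lebesgue : Measure (Matrix (MIdx n k) (MIdx n k) 𝕜) :=
  (volume : Measure (Fin (Module.finrank ℝ X.space) → ℝ)).map fun x =>
    (((Module.finBasis ℝ X.space).equivFun.symm x : X.space) : Matrix (MIdx n k) (MIdx n k) 𝕜)

/-- `P(H) dH ∝ exp(-½ vec(H)† Δ vec(H)) dH`. -/
def HasGaussianDensity (P : Measure (Matrix (MIdx n k) (MIdx n k) 𝕜))
    (Δ : Matrix (MIdx n k × MIdx n k) (MIdx n k × MIdx n k) 𝕜) : Prop :=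
  ∃ c : ℝ, 0 < c ∧ P = X.lebesgue.withDensity fun H =>
    ENNReal.ofReal (c * Real.exp (-(1 / 2) * RCLike.re (star H.vec ⬝ᵥ (Δ *ᵥ H.vec))))

/-- The defining properties of a `k`-fold Gaussian ensemble. -/
structure IsKFoldGaussian (P : Measure (Matrix (MIdx n k) (MIdx n k) 𝕜)) : Prop where
  isProbabilityMeasure : IsProbabilityMeasure P
  /-- invariance under `k`-fold conjugation -/
  map_tensorPow : ∀ g ∈ X.group, P.map (X.act (tensorPow k (g : Matrix n n 𝕜))) = P
  /-- Gaussian distribution of the matrix elements -/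
  gaussian : ∃ Δ : Matrix (MIdx n k × MIdx n k) (MIdx n k × MIdx n k) 𝕜,
    Δ.PosDef ∧ X.HasGaussianDensity P Δ
  /-- invariance under permutation of the tensor factors -/
  map_permOp : ∀ σ : Equiv.Perm (Fin k), P.map (X.act (permOp σ)) = P

/-! ### Representation theory of `G × S_k × ℤ/2` on `V^{⊗k} ⊗ V^{⊗k}` -/

/-- The matrix of `(g, σ) ∈ G × S_k` on vectorized matrices. -/
def rep (g : X.group) (σ : Equiv.Perm (Fin k)) :
    Matrix (MIdx n k × MIdx n k) (MIdx n k × MIdx n k) 𝕜 :=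
  superMatrix (X.act (tensorPow k ((g : Matrix.unitaryGroup n 𝕜) : Matrix n n 𝕜) * permOp σ))

/-- The matrix of the exchange of factors on vectorized matrices. -/
def swapMatrix : Matrix (MIdx n k × MIdx n k) (MIdx n k × MIdx n k) 𝕜 := superMatrix X.swap

/-- The labels `(μ, μ', s)`, with `s` a character of `ℤ/2`. -/
structure Label where
  /-- the irreducible representation of `G` -/
  mu : Dual 𝕜 X.group
  /-- the irreducible representation of `S_k` -/
  mu' : SymDual 𝕜 k
  /-- the sign by which the exchange of factors acts -/
  s : ℤˣ

noncomputable instance : DecidableEq X.Label := Classical.decEq _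

variable {X}

/-- The dimension `d_μ`. -/
noncomputable abbrev Label.dim (b : X.Label) : ℕ := b.mu.dim

/-- The dimension `d'_{μ'}`. -/
noncomputable abbrev Label.dim' (b : X.Label) : ℕ := SymDual.dim b.mu'

/-- The intertwiners from `μ ⊗ μ' ⊗ s` to the representation of `G × S_k × ℤ/2` on vectorized
matrices. -/
def Label.intertwiners (b : X.Label) :
    Submodule 𝕜 (Matrix (MIdx n k × MIdx n k) (Fin b.dim × Fin b.dim') 𝕜) where
  carrier := {F | (∀ g σ, X.rep g σ * F = F * (b.mu.mat g ⊗ₖ SymDual.mat b.mu' σ)) ∧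
    X.swapMatrix * F = ((b.s : ℤ) : 𝕜) • F}
  add_mem' := fun {F F'} hF hF' => by
    refine ⟨fun g σ => ?_, ?_⟩
    · rw [Matrix.mul_add, Matrix.add_mul, hF.1, hF'.1]
    · rw [Matrix.mul_add, smul_add, hF.2, hF'.2]
  zero_mem' := by simp
  smul_mem' := fun c F hF => by
    refine ⟨fun g σ => ?_, ?_⟩
    · rw [Matrix.mul_smul, Matrix.smul_mul, hF.1]
    · rw [Matrix.mul_smul, hF.2, smul_comm]

/-- The multiplicity `C_{μμ's}`. -/
noncomputable def Label.mult (b : X.Label) : ℕ := Module.finrank 𝕜 b.intertwiners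

variable (X)

/-- The index set of the basis adapted to `⊕ C_{μμ's} (μ ⊗ μ' ⊗ s)`. -/
abbrev BlockIndex : Type := (b : X.Label) × (Fin b.mult × (Fin b.dim × Fin b.dim'))

/-- `⊕ M_{μμ's} ⊗ 1_{d_μ} ⊗ 1_{d'_{μ'}}`. -/
noncomputable def blockMatrix (M : (b : X.Label) → Matrix (Fin b.mult) (Fin b.mult) 𝕜) :
    Matrix X.BlockIndex X.BlockIndex 𝕜 :=
  Matrix.blockDiagonal' fun b =>
    M b ⊗ₖ ((1 : Matrix (Fin b.dim) (Fin b.dim) 𝕜) ⊗ₖ (1 : Matrix (Fin b.dim') (Fin b.dim') 𝕜))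

end MatrixModel

end KFold

/-! A Gaussian density sees Δ only through its quadratic form on the real space 𝓗, and it determines
that form: continuous densities agree everywhere, so evaluation at 0 gives the constants and then
the exponents can be compared (`HasGaussianDensity.quadForm_eq`). A linear automorphism of 𝓗
rescales Lebesgue measure by a constant, so P is invariant exactly when the form on 𝓗 is. The
problem is to turn invariance of a form on 𝓗 into commutation of an operator on all of 𝕜^{N²}.

Over 𝕜, 𝓗 spans the s₀-eigenspace of the exchange of factors: it is either this eigenspace or the
real form of it fixed by an antilinear involution. Averaging Δ over the involution where there is
one, and then compressing it to the eigenspace with the identity added on the complement, yields a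
positive definite matrix that preserves 𝓗 and has the same form there (`exists_posDef_real`,
`posDef_compression`). By polarization, a Hermitian operator that preserves 𝓗 is determined on the
eigenspace by its form on 𝓗 (`sub_mul_signProj`). Hence invariance of the form makes the modified Δ
commute with G × S_k. The same rigidity shows that the blocks with s = s₀ are unique.

The rest is Schur's lemma. Orthonormal bases of the intertwiner spaces form the columns of U, and an
operator commuting with the representation has the form ⊕ M ⊗ 1 ⊗ 1 in this basis
(`exists_decomposition`). Conversely, positive definite blocks give a commuting, normalizable Δ,
hence an invariant Gaussian.

Schur's lemma with scalar commutants is immediate over ℂ. Over ℝ it says that the irreducible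
representations of O(d) and S_k are of real type. This is proved along a chain of subgroups from 1
to the whole group in which every element of a member is conjugate to its inverse under the
preceding member. A trace argument then makes elements of the larger algebra commuting with the
smaller group symmetric, so an idempotent with corner ℝ can be carried up the chain
(`HasMinimalIdempotent.step`), and one such idempotent for the whole group forces scalar commutants
(`HasMinimalIdempotent.schur`). The chain consists of stabilizers of points or coordinate vectors.
The conjugating elements reflect each cycle of a permutation about a chosen point, and act by p(g)e
↦ p(g⁻¹)e on a cyclic subspace of an isometry. -/

namespace KFold

/-! ### Gelfand chains of subgroups and Schur's lemma over the reals -/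

section GelfandChain

variable {m : Type} [Fintype m] [DecidableEq m] {Γ : Type} [Group Γ]

/-- The real algebra spanned by the representing matrices of a subgroup. -/
def groupSpan (ρ : Γ →* Matrix.unitaryGroup m ℝ) (H : Subgroup Γ) :
    Submodule ℝ (Matrix m m ℝ) :=
  Submodule.span ℝ ((fun g => (ρ g : Matrix m m ℝ)) '' (H : Set Γ))

variable {ρ : Γ →* Matrix.unitaryGroup m ℝ} {H H' : Subgroup Γ}

theorem coe_rho_inv (ρ : Γ →* Matrix.unitaryGroup m ℝ) (g : Γ) :
    (ρ g⁻¹ : Matrix m m ℝ) = (ρ g : Matrix m m ℝ)ᵀ := by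
  rw [map_inv, ← Matrix.conjTranspose_eq_transpose_of_trivial]
  rfl

theorem coe_rho_mul (ρ : Γ →* Matrix.unitaryGroup m ℝ) (g h : Γ) :
    (ρ (g * h) : Matrix m m ℝ) = (ρ g : Matrix m m ℝ) * (ρ h : Matrix m m ℝ) := by
  rw [map_mul, Matrix.UnitaryGroup.mul_val]

theorem coe_rho_one (ρ : Γ →* Matrix.unitaryGroup m ℝ) :
    (ρ 1 : Matrix m m ℝ) = 1 := by
  rw [map_one, Matrix.UnitaryGroup.one_val]

theorem rho_mem_groupSpan {g : Γ} (hg : g ∈ H) : (ρ g : Matrix m m ℝ) ∈ groupSpan ρ H :=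
  Submodule.subset_span ⟨g, hg, rfl⟩

theorem groupSpan_mono (h : H' ≤ H) : groupSpan ρ H' ≤ groupSpan ρ H :=
  Submodule.span_mono (Set.image_mono h)

theorem one_mem_groupSpan : (1 : Matrix m m ℝ) ∈ groupSpan ρ H := by
  rw [← coe_rho_one ρ]
  exact rho_mem_groupSpan (one_mem H)

theorem mul_mem_groupSpan {a b : Matrix m m ℝ} (ha : a ∈ groupSpan ρ H)
    (hb : b ∈ groupSpan ρ H) : a * b ∈ groupSpan ρ H := by
  refine Submodule.span_induction₂ (p := fun a b _ _ => a * b ∈ groupSpan ρ H)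
    ?_ ?_ ?_ ?_ ?_ ?_ ?_ ha hb
  · rintro _ _ ⟨g, hg, rfl⟩ ⟨h, hh, rfl⟩
    simp only [← coe_rho_mul]
    exact rho_mem_groupSpan (mul_mem hg hh)
  · intros; simp
  · intros; simp
  · intro x y z _ _ _ h1 h2
    rw [add_mul]; exact add_mem h1 h2
  · intro x y z _ _ _ h1 h2
    rw [mul_add]; exact add_mem h1 h2
  · intro r x y _ _ h
    rw [smul_mul_assoc]; exact Submodule.smul_mem _ _ h
  · intro r x y _ _ h
    rw [mul_smul_comm]; exact Submodule.smul_mem _ _ h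

theorem transpose_mem_groupSpan {a : Matrix m m ℝ} (ha : a ∈ groupSpan ρ H) :
    aᵀ ∈ groupSpan ρ H := by
  refine Submodule.span_induction (p := fun a _ => aᵀ ∈ groupSpan ρ H) ?_ ?_ ?_ ?_ ha
  · rintro _ ⟨g, hg, rfl⟩
    simp only [← coe_rho_inv]
    exact rho_mem_groupSpan (inv_mem hg)
  · simp
  · intro x y _ _ hx hy
    rw [Matrix.transpose_add]; exact add_mem hx hy
  · intro r x _ hx
    rw [Matrix.transpose_smul]; exact Submodule.smul_mem _ _ hx

omit [DecidableEq m] in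
theorem eq_zero_of_trace_transpose_mul_self {d : Matrix m m ℝ} (h : (dᵀ * d).trace = 0) :
    d = 0 := by
  rw [← Matrix.conjTranspose_eq_transpose_of_trivial] at h
  exact Matrix.trace_conjTranspose_mul_self_eq_zero_iff.1 h

omit [DecidableEq m] in
theorem eq_zero_of_transpose_mul_self {d : Matrix m m ℝ} (h : dᵀ * d = 0) : d = 0 :=
  eq_zero_of_trace_transpose_mul_self (by rw [h, Matrix.trace_zero])

/-- If every element of `H` is conjugate to its inverse under `H'`, then the elements of the
algebra of `H` that commute with `H'` are symmetric. -/
theorem isSymm_of_commute (hG : ∀ g ∈ H, ∃ h ∈ H', h * g * h⁻¹ = g⁻¹) {c : Matrix m m ℝ}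
    (hc : c ∈ groupSpan ρ H)
    (hcomm : ∀ h ∈ H', (ρ h : Matrix m m ℝ) * c = c * (ρ h : Matrix m m ℝ)) : cᵀ = c := by
  have hmul : ∀ h : Γ, (ρ h : Matrix m m ℝ)ᵀ * (ρ h : Matrix m m ℝ) = 1 := fun h => by
    rw [← coe_rho_inv, ← coe_rho_mul, inv_mul_cancel, coe_rho_one]
  have hcommT : ∀ h ∈ H', (ρ h : Matrix m m ℝ) * cᵀ = cᵀ * (ρ h : Matrix m m ℝ) := by
    intro h hh
    have := congrArg Matrix.transpose (hcomm h⁻¹ (inv_mem hh))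
    rw [Matrix.transpose_mul, Matrix.transpose_mul, coe_rho_inv, Matrix.transpose_transpose] at this
    exact this.symm
  set d := c - cᵀ with hd
  have hdT : dᵀ = -d := by rw [hd, Matrix.transpose_sub, Matrix.transpose_transpose, neg_sub]
  have hdcomm : ∀ h ∈ H', (ρ h : Matrix m m ℝ) * d = d * (ρ h : Matrix m m ℝ) := by
    intro h hh
    rw [hd, mul_sub, sub_mul, hcomm h hh, hcommT h hh]
  -- Conjugation by h preserves the trace against d because d commutes with ρ h; hence ρ g and its
  -- transpose pair equally with d. Taking a = c gives tr(d d) = 0, while dᵀ = -d.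
  have key : ∀ a ∈ groupSpan ρ H, (d * a).trace = (d * aᵀ).trace := by
    intro a ha
    refine Submodule.span_induction (p := fun a _ => (d * a).trace = (d * aᵀ).trace)
      ?_ ?_ ?_ ?_ ha
    · rintro _ ⟨g, hg, rfl⟩
      obtain ⟨h, hh, e⟩ := hG g hg
      simp only
      rw [← coe_rho_inv, ← e, coe_rho_mul, coe_rho_mul, ← mul_assoc, ← mul_assoc,
        ← hdcomm h hh, Matrix.trace_mul_comm _ (ρ h⁻¹ : Matrix m m ℝ), coe_rho_inv, mul_assoc,
        ← mul_assoc, hmul, one_mul]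
    · simp
    · intro x y _ _ hx hy
      rw [Matrix.transpose_add, mul_add, mul_add, Matrix.trace_add, Matrix.trace_add, hx, hy]
    · intro r x _ hx
      rw [Matrix.transpose_smul, mul_smul_comm, mul_smul_comm, Matrix.trace_smul,
        Matrix.trace_smul, hx]
  have h0 : (dᵀ * d).trace = 0 := by
    rw [hdT, neg_mul, Matrix.trace_neg, neg_eq_zero]
    conv_lhs => rw [hd, mul_sub, Matrix.trace_sub, ← hd]
    rw [key c hc, sub_self]
  exact (sub_eq_zero.1 (eq_zero_of_trace_transpose_mul_self h0)).symm

/-- The algebra of `H` contains a nonzero symmetric idempotent `E` whose corner consists of the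
multiples of `E`. -/
def HasMinimalIdempotent (ρ : Γ →* Matrix.unitaryGroup m ℝ) (H : Subgroup Γ) : Prop :=
  ∃ E ∈ groupSpan ρ H, Eᵀ = E ∧ E * E = E ∧ E ≠ 0 ∧
    ∀ a ∈ groupSpan ρ H, ∃ t : ℝ, E * a * E = t • E

/-- The algebra of the trivial subgroup is ℝ · 1, so E = 1 works; it is nonzero because the index
type is inhabited. -/
theorem hasMinimalIdempotent_bot [Nonempty m] : HasMinimalIdempotent ρ ⊥ := by
  refine ⟨1, one_mem_groupSpan, Matrix.transpose_one, one_mul 1, one_ne_zero, fun a ha => ?_⟩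
  refine Submodule.span_induction (p := fun a _ => ∃ t : ℝ, 1 * a * 1 = t • (1 : Matrix m m ℝ))
    ?_ ?_ ?_ ?_ ha
  · rintro _ ⟨g, hg, rfl⟩
    have : g = 1 := hg
    subst this
    exact ⟨1, by simp⟩
  · exact ⟨0, by simp⟩
  · rintro x y _ _ ⟨s, hs⟩ ⟨t, ht⟩
    exact ⟨s + t, by rw [mul_add, add_mul, hs, ht, add_smul]⟩
  · rintro r x _ ⟨s, hs⟩
    exact ⟨r * s, by rw [mul_smul_comm, smul_mul_assoc, hs, smul_smul]⟩

/-- A symmetric matrix has an eigenvector in the range of any nonzero matrix commuting with it. -/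
theorem exists_eigenvector_mem_range {x b : Matrix m m ℝ} (hx : xᵀ = x) (hxb : x * b = b * x)
    (hb : b ≠ 0) : ∃ (t : ℝ) (w : m → ℝ), b *ᵥ w ≠ 0 ∧ x *ᵥ (b *ᵥ w) = t • (b *ᵥ w) := by
  classical
  have hs : (Matrix.toEuclideanLin x).IsSymmetric := by
    rw [Matrix.isSymmetric_toEuclideanLin_iff, Matrix.IsHermitian,
      Matrix.conjTranspose_eq_transpose_of_trivial, hx]
  set V := LinearMap.range (Matrix.toEuclideanLin b) with hV
  have hinv : ∀ v ∈ V, Matrix.toEuclideanLin x v ∈ V := by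
    rintro _ ⟨w, rfl⟩
    refine ⟨Matrix.toEuclideanLin x w, ?_⟩
    simp only [Matrix.toLpLin_apply, Matrix.mulVec_mulVec, hxb]
  have hnt : Nontrivial V := by
    rw [Submodule.nontrivial_iff_ne_bot, hV, Ne, LinearMap.range_eq_bot]
    intro h
    exact hb (by simpa using h)
  obtain ⟨t, ht⟩ : ∃ t, Module.End.HasEigenvalue ((Matrix.toEuclideanLin x).restrict hinv) t :=
    ⟨_, (hs.restrict_invariant hinv).hasEigenvalue_iSup_of_finiteDimensional⟩
  obtain ⟨v, hv⟩ := ht.exists_hasEigenvector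
  obtain ⟨w, hw⟩ := v.2
  have hv0 := hv.2
  have hv1 := congrArg (Subtype.val) hv.apply_eq_smul
  refine ⟨t, w.ofLp, ?_, ?_⟩
  rotate_left
  · simp only [LinearMap.coe_restrict_apply, Submodule.coe_smul, ← hw] at hv1
    simpa [Matrix.toLpLin_apply] using congrArg WithLp.ofLp hv1
  · intro h
    apply hv0
    ext1
    rw [← hw]
    simp [Matrix.toLpLin_apply, h]

/-- Averaging an element of the corner of a minimal idempotent of `H'` over `H'`. -/
theorem exists_commute_mul_eq (hle : H' ≤ H) {E : Matrix m m ℝ} (hE : E ∈ groupSpan ρ H')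
    (hET : Eᵀ = E) (hEE : E * E = E) (hE0 : E ≠ 0)
    (hmin : ∀ a ∈ groupSpan ρ H', ∃ t : ℝ, E * a * E = t • E)
    {a : Matrix m m ℝ} (ha : a ∈ groupSpan ρ H) (haE : E * a * E = a) :
    ∃ c ∈ groupSpan ρ H, (∀ h ∈ H', (ρ h : Matrix m m ℝ) * c = c * (ρ h : Matrix m m ℝ)) ∧
      c * E = a := by
  classical
  obtain ⟨w, hw⟩ : ∃ w, E *ᵥ w ≠ 0 := by
    by_contra! hcon
    exact hE0 (Matrix.ext_of_mulVec_single fun i => by rw [hcon, Matrix.zero_mulVec])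
  set v := E *ᵥ w with hv
  have hEv : E *ᵥ v = v := by rw [hv, Matrix.mulVec_mulVec, hEE]
  -- an element of the left ideal of `E` is determined by its value at `v`
  have hinj : ∀ y ∈ groupSpan ρ H', y * E = y → y *ᵥ v = 0 → y = 0 := by
    intro y hy hyE hyv
    obtain ⟨t, ht⟩ := hmin (yᵀ * y) (mul_mem_groupSpan (transpose_mem_groupSpan hy) hy)
    have h1 : E * (yᵀ * y) * E = yᵀ * y := by
      calc E * (yᵀ * y) * E = (y * E)ᵀ * (y * E) := by
            rw [Matrix.transpose_mul, hET]; simp only [mul_assoc]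
        _ = _ := by rw [hyE]
    rw [h1] at ht
    have h2 : t • v = 0 := by
      have := congrArg (· *ᵥ v) ht
      simp only [← Matrix.mulVec_mulVec, hyv, Matrix.mulVec_zero, Matrix.smul_mulVec, hEv] at this
      exact this.symm
    have : t = 0 := (smul_eq_zero.1 h2).resolve_right hw
    rw [this, zero_smul] at ht
    exact eq_zero_of_transpose_mul_self ht
  -- Evaluation at v identifies the left ideal of E with the Euclidean space Y. The y j below
  -- correspond to an orthonormal basis of Y.
  let φ : Matrix m m ℝ →ₗ[ℝ] EuclideanSpace ℝ m :=
    { toFun := fun y => WithLp.toLp 2 (y *ᵥ v)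
      map_add' := fun y z => by rw [Matrix.add_mulVec]; rfl
      map_smul' := fun r y => by rw [Matrix.smul_mulVec]; rfl }
  let Y : Submodule ℝ (EuclideanSpace ℝ m) := (groupSpan ρ H').map φ
  let b := stdOrthonormalBasis ℝ Y
  have hx : ∀ j, ∃ x ∈ groupSpan ρ H', φ x = (b j : EuclideanSpace ℝ m) := fun j => (b j).2
  choose x hxm hxb using hx
  set y := fun j => x j * E with hy
  have hym : ∀ j, y j ∈ groupSpan ρ H' := fun j => mul_mem_groupSpan (hxm j) hE
  have hyE : ∀ j, y j * E = y j := fun j => by rw [hy]; simp only [mul_assoc, hEE]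
  have hyv : ∀ j, φ (y j) = (b j : EuclideanSpace ℝ m) := fun j => by
    rw [← hxb j]
    simp only [φ, LinearMap.coe_mk, AddHom.coe_mk, hy, ← Matrix.mulVec_mulVec, hEv]
  have hact : ∀ h ∈ H', ∀ j, (ρ h : Matrix m m ℝ) * y j =
      ∑ i, (inner ℝ (b i : EuclideanSpace ℝ m) (φ ((ρ h : Matrix m m ℝ) * y j))) • y i := by
    intro h hh j
    have hm : (ρ h : Matrix m m ℝ) * y j ∈ groupSpan ρ H' :=
      mul_mem_groupSpan (rho_mem_groupSpan hh) (hym j)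
    rw [← sub_eq_zero]
    apply hinj
    · exact sub_mem hm (Submodule.sum_mem _ fun i _ => Submodule.smul_mem _ _ (hym i))
    · rw [sub_mul, Finset.sum_mul, mul_assoc, hyE]
      simp only [smul_mul_assoc, hyE]
    · have h1 := b.sum_repr' ⟨φ ((ρ h : Matrix m m ℝ) * y j), ⟨_, hm, rfl⟩⟩
      have h2 : φ ((ρ h : Matrix m m ℝ) * y j - ∑ i, (inner ℝ (b i : EuclideanSpace ℝ m)
          (φ ((ρ h : Matrix m m ℝ) * y j))) • y i) = 0 := by
        rw [map_sub, map_sum, sub_eq_zero]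
        simp only [map_smul, hyv]
        have := congrArg Subtype.val h1
        simp only [AddSubmonoidClass.coe_finsetSum, Submodule.coe_smul, Submodule.coe_inner] at this
        exact this.symm
      exact congrArg WithLp.ofLp h2
  -- The coefficient matrix of h⁻¹ is the transpose of that of h, so H' acts on the y j
  -- orthogonally.
  have hO : ∀ h : Γ, ∀ i j,
      (inner ℝ (b i : EuclideanSpace ℝ m) (φ ((ρ h⁻¹ : Matrix m m ℝ) * y j))) =
      (inner ℝ (b j : EuclideanSpace ℝ m) (φ ((ρ h : Matrix m m ℝ) * y i))) := by
    intro h i j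
    rw [← hyv i, ← hyv j, coe_rho_inv]
    simp only [φ, LinearMap.coe_mk, AddHom.coe_mk, EuclideanSpace.inner_toLp_toLp,
      star_trivial, ← Matrix.mulVec_mulVec]
    rw [dotProduct_comm, Matrix.dotProduct_mulVec, ← Matrix.mulVec_transpose,
      Matrix.transpose_transpose]
  -- Invariant under H' for the same reason as ∑ b_j ⊗ b_j is invariant under orthogonal maps;
  -- cutting it down by E returns a multiple of a.
  set c := ∑ j, y j * a * (y j)ᵀ with hc
  have hcm : c ∈ groupSpan ρ H := Submodule.sum_mem _ fun j _ =>
    mul_mem_groupSpan (mul_mem_groupSpan (groupSpan_mono hle (hym j)) ha)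
      (groupSpan_mono hle (transpose_mem_groupSpan (hym j)))
  have hcc : ∀ h ∈ H', (ρ h : Matrix m m ℝ) * c = c * (ρ h : Matrix m m ℝ) := by
    intro h hh
    have h1 : ∀ j, (y j)ᵀ * (ρ h : Matrix m m ℝ) =
        ∑ i, (inner ℝ (b j : EuclideanSpace ℝ m) (φ ((ρ h : Matrix m m ℝ) * y i))) • (y i)ᵀ := by
      intro j
      have := congrArg Matrix.transpose (hact h⁻¹ (inv_mem hh) j)
      rw [Matrix.transpose_mul, coe_rho_inv, Matrix.transpose_transpose, Matrix.transpose_sum,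
        ← coe_rho_inv] at this
      simp only [hO, Matrix.transpose_smul] at this
      exact this
    rw [hc, Finset.mul_sum, Finset.sum_mul]
    simp only [← mul_assoc]
    rw [Finset.sum_congr rfl fun j _ => by rw [hact h hh j]]
    conv_rhs => rw [Finset.sum_congr rfl fun j _ => by rw [mul_assoc, h1 j]]
    simp only [Finset.sum_mul, Finset.mul_sum, smul_mul_assoc, mul_smul_comm]
    rw [Finset.sum_comm]
  have hs : ∀ j, ∃ s : ℝ, E * y j = s • E := fun j => by
    obtain ⟨s, hs⟩ := hmin (x j) (hxm j)
    exact ⟨s, by rw [← hs, mul_assoc]⟩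
  choose s hs using hs
  have hsT : ∀ j, (y j)ᵀ * E = s j • E := fun j => by
    have := congrArg Matrix.transpose (hs j)
    rwa [Matrix.transpose_mul, Matrix.transpose_smul, hET] at this
  have hcE : c * E = E * c := by
    refine Submodule.span_induction (p := fun e _ => c * e = e * c) ?_ ?_ ?_ ?_ hE
    · rintro _ ⟨g, hg, rfl⟩
      exact (hcc g hg).symm
    · simp
    · intro p q _ _ hp hq
      rw [mul_add, add_mul, hp, hq]
    · intro r p _ hp
      rw [mul_smul_comm, smul_mul_assoc, hp]
  have hEcE : c * E = (∑ j, s j * s j) • a := by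
    have h1 : c * E = E * c * E := by rw [← hcE, mul_assoc, hEE]
    rw [h1, hc, Finset.mul_sum, Finset.sum_mul, Finset.sum_smul]
    refine Finset.sum_congr rfl fun j _ => ?_
    calc E * (y j * a * (y j)ᵀ) * E = (E * y j) * a * ((y j)ᵀ * E) := by simp only [mul_assoc]
      _ = (s j * s j) • a := by
        rw [hs, hsT, smul_mul_assoc, smul_mul_assoc, mul_smul_comm, haE, smul_smul]
  -- The inner product of v with y j v is s j ‖v‖². If all s j vanished, v ∈ Y would be orthogonal
  -- to a basis of Y.
  have hne : ∑ j, s j * s j ≠ 0 := by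
    intro h0
    have hs0 : ∀ j, s j = 0 := fun j => by
      have := (Finset.sum_eq_zero_iff_of_nonneg (fun j _ => mul_self_nonneg (s j))).1 h0 j
        (Finset.mem_univ j)
      exact mul_self_eq_zero.1 this
    have hvY : WithLp.toLp 2 v ∈ Y := ⟨1, one_mem_groupSpan, by simp [φ]⟩
    have h1 := b.sum_repr' ⟨WithLp.toLp 2 v, hvY⟩
    have h2 : ∀ j, inner ℝ (b j) (⟨WithLp.toLp 2 v, hvY⟩ : Y) = 0 := by
      intro j
      rw [Submodule.coe_inner, ← hyv j]
      simp only [φ, LinearMap.coe_mk, AddHom.coe_mk, EuclideanSpace.inner_toLp_toLp, star_trivial]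
      calc v ⬝ᵥ (y j *ᵥ v) = (E *ᵥ v) ⬝ᵥ (y j *ᵥ v) := by rw [hEv]
        _ = v ⬝ᵥ ((E * y j) *ᵥ v) := by
          rw [← Matrix.mulVec_mulVec v E (y j), Matrix.dotProduct_mulVec v E, ← Matrix.mulVec_transpose, hET]
        _ = 0 := by rw [hs, hs0, zero_smul, Matrix.zero_mulVec, dotProduct_zero]
    rw [Finset.sum_eq_zero (fun j _ => by rw [h2, zero_smul])] at h1
    exact hw (congrArg (fun z : Y => (z : EuclideanSpace ℝ m).ofLp) h1).symm
  refine ⟨(∑ j, s j * s j)⁻¹ • c, Submodule.smul_mem _ _ hcm, fun h hh => ?_, ?_⟩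
  · rw [mul_smul_comm, smul_mul_assoc, hcc h hh]
  · rw [smul_mul_assoc, hEcE, smul_smul, inv_mul_cancel₀ hne, one_smul]

/-- Each element of the corner of E is c E with c commuting with H', and such c are symmetric; so
the corner consists of symmetric matrices and, being closed under products, is commutative. A
nonzero element b of least rank in it satisfies x b ∈ ℝ b for all x in the corner, and a multiple of
b is the new idempotent. -/
theorem HasMinimalIdempotent.step (hle : H' ≤ H)
    (hG : ∀ g ∈ H, ∃ h ∈ H', h * g * h⁻¹ = g⁻¹) (h' : HasMinimalIdempotent ρ H') :
    HasMinimalIdempotent ρ H := by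
  classical
  obtain ⟨E, hE, hET, hEE, hE0, hmin⟩ := h'
  have hEm := groupSpan_mono hle hE
  -- the corner of `E`
  let B : Set (Matrix m m ℝ) := {a | a ∈ groupSpan ρ H ∧ E * a * E = a}
  have hEl : ∀ a ∈ B, E * a = a := fun a ha => by
    rw [← ha.2, ← mul_assoc, ← mul_assoc, hEE]
  have hEr : ∀ a ∈ B, a * E = a := fun a ha => by
    rw [← ha.2, mul_assoc, hEE]
  have hBmul : ∀ a ∈ B, ∀ b ∈ B, a * b ∈ B := fun a ha b hb =>
    ⟨mul_mem_groupSpan ha.1 hb.1, by rw [← mul_assoc, hEl a ha, mul_assoc, hEr b hb]⟩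
  have hBsymm : ∀ a ∈ B, aᵀ = a := by
    intro a ha
    obtain ⟨c, hc, hcc, rfl⟩ := exists_commute_mul_eq hle hE hET hEE hE0 hmin ha.1 ha.2
    have hcT := isSymm_of_commute hG hc hcc
    have := hEl _ ha
    calc (c * E)ᵀ = (E * (c * E))ᵀ := by rw [this]
      _ = E * (c * E) := by
        rw [Matrix.transpose_mul, Matrix.transpose_mul, hET, hcT, mul_assoc]
      _ = c * E := this
  have hBcomm : ∀ a ∈ B, ∀ b ∈ B, a * b = b * a := fun a ha b hb => by
    have := hBsymm _ (hBmul a ha b hb)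
    rw [Matrix.transpose_mul, hBsymm a ha, hBsymm b hb] at this
    exact this.symm
  have hex : ∃ r, ∃ b ∈ B, b ≠ 0 ∧ b.rank = r := ⟨_, E, ⟨hEm, by rw [hEE, hEE]⟩, hE0, rfl⟩
  obtain ⟨b, hb, hb0, hbr⟩ := Nat.find_spec hex
  have hbmin : ∀ a ∈ B, a.rank < b.rank → a = 0 := fun a ha hlt => by
    by_contra hne
    rw [hbr] at hlt
    exact Nat.find_min hex hlt ⟨a, ha, hne, rfl⟩
  -- If t is an eigenvalue of x with an eigenvector in the range of b, then x b - t b is in the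
  -- corner and has smaller rank than b, hence vanishes.
  have hscal : ∀ x ∈ B, ∃ t : ℝ, x * b = t • b := by
    intro x hx
    obtain ⟨t, w, hw0, hw⟩ := exists_eigenvector_mem_range (hBsymm x hx) (hBcomm x hx b hb) hb0
    refine ⟨t, sub_eq_zero.1 (hbmin _ ?_ ?_)⟩
    · refine ⟨sub_mem (hBmul x hx b hb).1 (Submodule.smul_mem _ _ hb.1), ?_⟩
      rw [mul_sub, sub_mul, (hBmul x hx b hb).2, mul_smul_comm, smul_mul_assoc, hb.2]
    · have hfac : x * b - t • b = (x - t • 1) * b := by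
        rw [sub_mul, smul_mul_assoc, one_mul]
      have h1 : x * b - t • b = b * (x - t • 1) := by
        rw [mul_sub, mul_smul_comm, mul_one, hBcomm x hx b hb]
      rw [Matrix.rank, Matrix.rank, hfac, Matrix.mulVecLin_mul, LinearMap.range_comp]
      set V := LinearMap.range b.mulVecLin
      set f := (x - t • (1 : Matrix m m ℝ)).mulVecLin
      have h2 := LinearMap.finrank_range_add_finrank_ker (f.domRestrict V)
      rw [LinearMap.range_domRestrict] at h2
      have h3 : 0 < Module.finrank ℝ (LinearMap.ker (f.domRestrict V)) := by
        have h4 : (⟨b *ᵥ w, ⟨w, rfl⟩⟩ : V) ∈ LinearMap.ker (f.domRestrict V) := by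
          rw [LinearMap.mem_ker]
          simp [f, hw]
        have : Nontrivial (LinearMap.ker (f.domRestrict V)) :=
          ⟨⟨_, h4⟩, 0, fun h => hw0 (congrArg (fun z => ((z : V) : m → ℝ)) (congrArg Subtype.val h))⟩
        exact Module.finrank_pos (R := ℝ) (M := LinearMap.ker (f.domRestrict V))
      omega
  obtain ⟨t, ht⟩ := hscal b hb
  have ht0 : t ≠ 0 := by
    rintro rfl
    rw [zero_smul] at ht
    refine hb0 (eq_zero_of_transpose_mul_self ?_)
    rw [hBsymm b hb, ht]
  refine ⟨t⁻¹ • b, Submodule.smul_mem _ _ hb.1, by rw [Matrix.transpose_smul, hBsymm b hb], ?_,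
    smul_ne_zero (inv_ne_zero ht0) hb0, fun a ha => ?_⟩
  · rw [smul_mul_assoc, mul_smul_comm, ht, inv_smul_smul₀ ht0]
  · have hx : E * a * E ∈ B :=
      ⟨mul_mem_groupSpan (mul_mem_groupSpan hEm ha) hEm, by
        simp only [← mul_assoc, hEE]; simp only [mul_assoc, hEE]⟩
    obtain ⟨s, hs⟩ := hscal _ hx
    refine ⟨s, ?_⟩
    have h1 : b * a * b = b * ((E * a * E) * b) := by
      calc b * a * b = (b * E) * a * (E * b) := by rw [hEl b hb, hEr b hb]
        _ = _ := by simp only [mul_assoc]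
    rw [smul_mul_assoc, smul_mul_assoc, mul_smul_comm, h1, hs, mul_smul_comm, ht, smul_smul,
      smul_smul, smul_smul, smul_smul]
    congr 1
    field_simp

/-- The chain is indexed by finite sets that grow one element at a time, so induction on the set
applies `HasMinimalIdempotent.step` at each stage. -/
theorem hasMinimalIdempotent_of_chain [Nonempty m] {α : Type} [DecidableEq α]
    (K : Finset α → Subgroup Γ) (h0 : K ∅ = ⊥) (hle : ∀ j S, K S ≤ K (insert j S))
    (hstep : ∀ j S, ∀ g ∈ K (insert j S), ∃ h ∈ K S, h * g * h⁻¹ = g⁻¹) (S : Finset α) :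
    HasMinimalIdempotent ρ (K S) := by
  induction S using Finset.induction_on with
  | empty => rw [h0]; exact hasMinimalIdempotent_bot
  | insert j S _ ih => exact ih.step (hle j S) (hstep j S)

/-- Real representations with a minimal idempotent satisfy Schur's lemma. -/
theorem HasMinimalIdempotent.schur (hmin : HasMinimalIdempotent ρ ⊤)
    (hirr : ∀ W : Submodule ℝ (m → ℝ),
      (∀ g : Γ, ∀ v ∈ W, (ρ g : Matrix m m ℝ) *ᵥ v ∈ W) → W = ⊥ ∨ W = ⊤)
    {T : Matrix m m ℝ} (hT : ∀ g, (ρ g : Matrix m m ℝ) * T = T * (ρ g : Matrix m m ℝ)) :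
    ∃ t : ℝ, T = t • 1 := by
  obtain ⟨E, hE, hET, hEE, hE0, hmin⟩ := hmin
  have hcomm : ∀ a ∈ groupSpan ρ (⊤ : Subgroup Γ), T * a = a * T := by
    intro a ha
    refine Submodule.span_induction (p := fun a _ => T * a = a * T) ?_ ?_ ?_ ?_ ha
    · rintro _ ⟨g, -, rfl⟩
      exact (hT g).symm
    · simp
    · intro x y _ _ hx hy
      rw [mul_add, add_mul, hx, hy]
    · intro r x _ hx
      rw [mul_smul_comm, smul_mul_assoc, hx]
  obtain ⟨w, hw⟩ : ∃ w, E *ᵥ w ≠ 0 := by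
    by_contra! hcon
    exact hE0 (Matrix.ext_of_mulVec_single fun i => by rw [hcon, Matrix.zero_mulVec])
  set v := E *ᵥ w with hv
  have hEv : E *ᵥ v = v := by rw [hv, Matrix.mulVec_mulVec, hEE]
  let ψ : Matrix m m ℝ →ₗ[ℝ] (m → ℝ) :=
    { toFun := fun y => y *ᵥ v
      map_add' := fun y z => Matrix.add_mulVec _ _ _
      map_smul' := fun r y => Matrix.smul_mulVec _ _ _ }
  -- By irreducibility the algebra carries v to every vector, so T, which commutes with the algebra,
  -- is determined by T v.
  have htop : (groupSpan ρ (⊤ : Subgroup Γ)).map ψ = ⊤ := by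
    refine (hirr _ ?_).resolve_left ?_
    · rintro g _ ⟨y, hy, rfl⟩
      exact ⟨_, mul_mem_groupSpan (rho_mem_groupSpan (Subgroup.mem_top g)) hy,
        by simp [ψ, Matrix.mulVec_mulVec]⟩
    · intro h
      have : ψ 1 ∈ (groupSpan ρ (⊤ : Subgroup Γ)).map ψ := ⟨1, one_mem_groupSpan, rfl⟩
      rw [h, Submodule.mem_bot] at this
      exact hw (by simpa [ψ] using this)
  have hTv : T *ᵥ v ∈ (groupSpan ρ (⊤ : Subgroup Γ)).map ψ := by rw [htop]; trivial
  obtain ⟨a, ha, hav⟩ := hTv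
  obtain ⟨t, ht⟩ := hmin a ha
  -- T v = a v for some a in the algebra; since E commutes with T and fixes v, a may be replaced by
  -- E a E = t E.
  have hTt : T *ᵥ v = t • v := by
    calc T *ᵥ v = E *ᵥ (T *ᵥ v) := by
          rw [Matrix.mulVec_mulVec v E T, ← hcomm E hE, ← Matrix.mulVec_mulVec, hEv]
      _ = (E * a * E) *ᵥ v := by
          rw [← hav]
          simp only [ψ, LinearMap.coe_mk, AddHom.coe_mk]
          rw [← Matrix.mulVec_mulVec, ← Matrix.mulVec_mulVec, hEv]
      _ = t • v := by rw [ht, Matrix.smul_mulVec, hEv]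
  refine ⟨t, Matrix.ext_of_mulVec_single fun i => ?_⟩
  have hi : (Pi.single i 1 : m → ℝ) ∈ (groupSpan ρ (⊤ : Subgroup Γ)).map ψ := by
    rw [htop]; trivial
  obtain ⟨y, hy, hyi⟩ := hi
  rw [← hyi]
  simp only [ψ, LinearMap.coe_mk, AddHom.coe_mk]
  rw [Matrix.mulVec_mulVec, hcomm y hy, ← Matrix.mulVec_mulVec, hTt, Matrix.mulVec_smul,
    Matrix.smul_mulVec, Matrix.one_mulVec]

end GelfandChain

/-! ### Conjugating orthogonal matrices and permutations to their inverses -/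

section ConjInv

open Polynomial

theorem aeval_apply_mem {V : Type} [AddCommGroup V] [Module ℝ V] {A : Module.End ℝ V}
    {Z : Submodule ℝ V} (hA : ∀ z ∈ Z, A z ∈ Z) (p : ℝ[X]) {z : V} (hz : z ∈ Z) :
    aeval A p z ∈ Z := by
  induction p using Polynomial.induction_on' with
  | add p q hp hq => rw [map_add]; exact add_mem hp hq
  | monomial n a =>
    rw [aeval_monomial, Module.End.mul_apply, Module.algebraMap_end_apply]
    refine Submodule.smul_mem _ _ ?_
    induction n with
    | zero => simpa using hz
    | succ n ih => rw [pow_succ', Module.End.mul_apply]; exact hA _ ih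

theorem aeval_apply_of_fixed {V : Type} [AddCommGroup V] [Module ℝ V] {A : Module.End ℝ V}
    {z : V} (hz : A z = z) (p : ℝ[X]) : aeval A p z = p.eval 1 • z := by
  induction p using Polynomial.induction_on' with
  | add p q hp hq => rw [map_add, LinearMap.add_apply, hp, hq, eval_add, add_smul]
  | monomial n a =>
    rw [aeval_monomial, Module.End.mul_apply, Module.algebraMap_end_apply, eval_monomial, one_pow,
      mul_one]
    congr 1
    induction n with
    | zero => simp
    | succ n ih => rw [pow_succ', Module.End.mul_apply, ih, hz]

theorem inner_aeval_apply {V : Type} [NormedAddCommGroup V] [InnerProductSpace ℝ V]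
    {A B : Module.End ℝ V} (hAB : ∀ x y, inner ℝ (A x) y = inner ℝ x (B y)) (p : ℝ[X]) (x y : V) :
    inner ℝ (aeval A p x) y = inner ℝ x (aeval B p y) := by
  induction p using Polynomial.induction_on' with
  | add p q hp hq =>
    rw [map_add, map_add, LinearMap.add_apply, LinearMap.add_apply, inner_add_left,
      inner_add_right, hp, hq]
  | monomial n a =>
    simp only [aeval_monomial, Module.End.mul_apply, Module.algebraMap_end_apply,
      inner_smul_left, inner_smul_right]
    congr 1
    induction n generalizing x with
    | zero => simp
    | succ n ih =>
      rw [pow_succ, Module.End.mul_apply, ih, hAB, pow_succ', Module.End.mul_apply]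

/-- Every isometry `g` of a Euclidean space is conjugate to its inverse by an isometry that fixes
a given vector and all fixed vectors of `g`. -/
theorem exists_isometry_conj_inv (N : ℕ) : ∀ (V : Type) [NormedAddCommGroup V]
    [InnerProductSpace ℝ V] [FiniteDimensional ℝ V], Module.finrank ℝ V = N →
    ∀ (g : V ≃ₗᵢ[ℝ] V) (e : V), ∃ h : V ≃ₗᵢ[ℝ] V, h e = e ∧
      (∀ v, h (g v) = g.symm (h v)) ∧ ∀ f, g f = f → h f = f := by
  induction N using Nat.strong_induction_on with
  | _ N ih =>
  intro V _ _ _ hN g e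
  -- The induction descends only if the cyclic subspace of e is nonzero. For e = 0 any nonzero
  -- vector can take its place.
  suffices main : ∀ e : V, e ≠ 0 → ∃ h : V ≃ₗᵢ[ℝ] V, h e = e ∧
      (∀ v, h (g v) = g.symm (h v)) ∧ ∀ f, g f = f → h f = f by
    by_cases he : e = 0
    · by_cases hV : ∃ e' : V, e' ≠ 0
      · obtain ⟨e', he'⟩ := hV
        obtain ⟨h, -, h2⟩ := main e' he'
        exact ⟨h, by rw [he, map_zero], h2⟩
      · push Not at hV
        exact ⟨LinearIsometryEquiv.refl ℝ V, rfl, fun v => by rw [hV (g v), hV (g.symm _)]; simp,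
          fun f _ => rfl⟩
    · exact main e he
  clear e
  intro e he
  let A : Module.End ℝ V := g.toLinearEquiv.toLinearMap
  let B : Module.End ℝ V := g.symm.toLinearEquiv.toLinearMap
  have hAB : ∀ x y, inner ℝ (A x) y = inner ℝ x (B y) := fun x y => by
    change inner ℝ (g x) y = inner ℝ x (g.symm y)
    rw [← g.inner_map_map x, g.apply_symm_apply]
  have hBA : ∀ x y, inner ℝ (B x) y = inner ℝ x (A y) := fun x y => by
    rw [real_inner_comm, ← hAB, real_inner_comm]
  have hcomm : Commute A B := by
    ext v
    simp [A, B]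
  -- On the cyclic subspace of e the conjugating isometry is p(g)e ↦ p(g⁻¹)e; equality of the norms
  -- of both sides (`hnorm`) makes it well defined and isometric.
  let φ : ℝ[X] →ₗ[ℝ] V := LinearMap.applyₗ e ∘ₗ (aeval A).toLinearMap
  let ψ : ℝ[X] →ₗ[ℝ] V := LinearMap.applyₗ e ∘ₗ (aeval B).toLinearMap
  have hφ : ∀ p, φ p = aeval A p e := fun p => rfl
  have hψ : ∀ p, ψ p = aeval B p e := fun p => rfl
  have hcomm' : ∀ p q : ℝ[X], ∀ x, aeval A p (aeval B q x) = aeval B q (aeval A p x) := by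
    intro p q x
    have : Commute (aeval A p) (aeval B q) := by
      have h1 : Commute (aeval A p) B := by
        induction p using Polynomial.induction_on' with
        | add p q hp hq => rw [map_add]; exact hp.add_left hq
        | monomial n a =>
          rw [aeval_monomial]
          exact Commute.mul_left (Algebra.commutes a B) (hcomm.pow_left n)
      induction q using Polynomial.induction_on' with
      | add p q hp hq => rw [map_add]; exact hp.add_right hq
      | monomial n a =>
        rw [aeval_monomial]
        exact Commute.mul_right (Algebra.commutes a _).symm (h1.pow_right n)
    exact congrArg (fun T : Module.End ℝ V => T x) this
  have hnorm : ∀ p, ‖ψ p‖ = ‖φ p‖ := by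
    intro p
    have : inner ℝ (ψ p) (ψ p) = inner ℝ (φ p) (φ p) := by
      rw [hψ, hφ, inner_aeval_apply hBA, inner_aeval_apply hAB, hcomm']
    rwa [real_inner_self_eq_norm_sq, real_inner_self_eq_norm_sq,
      sq_eq_sq₀ (norm_nonneg _) (norm_nonneg _)] at this
  set Z := LinearMap.range φ with hZ
  have hAX : ∀ p, A (φ p) = φ (X * p) := fun p => by
    rw [hφ, hφ, map_mul, aeval_X, Module.End.mul_apply]
  have hBX : ∀ p, B (ψ p) = ψ (X * p) := fun p => by
    rw [hψ, hψ, map_mul, aeval_X, Module.End.mul_apply]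
  have hAZ : ∀ z ∈ Z, A z ∈ Z := by
    rintro _ ⟨p, rfl⟩
    exact ⟨X * p, (hAX p).symm⟩
  have hmapZ : Z.map A = Z := by
    refine Submodule.eq_of_le_of_finrank_eq ?_ ?_
    · rintro _ ⟨z, hz, rfl⟩
      exact hAZ z hz
    · exact LinearEquiv.finrank_map_eq g.toLinearEquiv Z
  have hBZ : ∀ z ∈ Z, B z ∈ Z := by
    intro z hz
    rw [← hmapZ] at hz
    obtain ⟨y, hy, rfl⟩ := hz
    have : B (A y) = y := g.symm_apply_apply y
    rwa [this]
  have heZ : e ∈ Z := ⟨1, by rw [hφ, map_one]; rfl⟩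
  have hψZ : ∀ p, ψ p ∈ Z := fun p => aeval_apply_mem hBZ p heZ
  -- A linear choice of polynomials representing the elements of Z; by `hnorm`, ψ ∘ s does not
  -- depend on it.
  obtain ⟨s, hs⟩ := φ.rangeRestrict.exists_rightInverse_of_surjective φ.range_rangeRestrict
  have hs' : ∀ z : Z, φ (s z) = z := fun z =>
    congrArg Subtype.val (LinearMap.congr_fun hs z)
  have hsφ : ∀ (p : ℝ[X]) (hp : φ p ∈ Z), ψ (s ⟨φ p, hp⟩) = ψ p := by
    intro p hp
    rw [← sub_eq_zero, ← map_sub, ← norm_eq_zero, hnorm, map_sub, hs', sub_self, norm_zero]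
  -- the isometry on the orthogonal complement of the cyclic subspace
  have hgZ : ∀ w ∈ Zᗮ, g w ∈ Zᗮ := by
    intro w hw
    rw [Submodule.mem_orthogonal'] at hw ⊢
    intro u hu
    change inner ℝ (A w) u = 0
    rw [hAB]
    exact hw _ (hBZ u hu)
  let g' : Zᗮ ≃ₗᵢ[ℝ] Zᗮ := LinearIsometry.toLinearIsometryEquiv
    { toLinearMap := A.restrict hgZ, norm_map' := fun w => g.norm_map w } rfl
  have hg' : ∀ w : Zᗮ, ((g' w : Zᗮ) : V) = g w := fun w => rfl
  have hlt : Module.finrank ℝ Zᗮ < N := by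
    have h1 := Submodule.finrank_add_finrank_orthogonal Z
    have h2 : 0 < Module.finrank ℝ Z := by
      have : Nontrivial Z := ⟨⟨⟨e, heZ⟩, 0, fun h => he (congrArg Subtype.val h)⟩⟩
      exact Module.finrank_pos
    omega
  -- On the complement no particular vector has to be fixed, so the prescribed vector is 0.
  obtain ⟨k, -, hk, hkfix⟩ := ih _ hlt Zᗮ rfl g' 0
  let P : V →ₗ[ℝ] Z := Z.orthogonalProjectionOnto.toLinearMap
  let Q : V →ₗ[ℝ] Zᗮ := Zᗮ.orthogonalProjectionOnto.toLinearMap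
  have hPQ : ∀ v, ((P v : Z) : V) + ((Q v : Zᗮ) : V) = v := fun v =>
    Submodule.starProjection_add_starProjection_orthogonal (K := Z) v
  let L : V →ₗ[ℝ] V := ψ ∘ₗ s ∘ₗ P + Zᗮ.subtype ∘ₗ k.toLinearEquiv.toLinearMap ∘ₗ Q
  have hL : ∀ v, L v = ψ (s (P v)) + ((k (Q v) : Zᗮ) : V) := fun v => rfl
  have hLadd : ∀ (z : Z) (w : Zᗮ), L (z + w) = ψ (s z) + ((k w : Zᗮ) : V) := by
    intro z w
    have h1 : P ((z : V) + w) = z := by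
      change Z.orthogonalProjectionOnto ((z : V) + w) = z
      rw [map_add, Submodule.orthogonalProjectionOnto_mem_subspace_eq_self,
        Submodule.orthogonalProjectionOnto_apply_of_mem_orthogonal w.2, add_zero]
    have h2 : Q ((z : V) + w) = w := by
      change Zᗮ.orthogonalProjectionOnto ((z : V) + w) = w
      rw [map_add, Submodule.orthogonalProjectionOnto_mem_subspace_eq_self,
        Submodule.orthogonalProjectionOnto_apply_of_mem_orthogonal (Z.le_orthogonal_orthogonal z.2),
        zero_add]
    rw [hL, h1, h2]
  have hpyth : ∀ z ∈ Z, ∀ w ∈ Zᗮ, ‖z + w‖ ^ 2 = ‖z‖ ^ 2 + ‖w‖ ^ 2 := by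
    intro z hz w hw
    rw [norm_add_sq_real, (Submodule.mem_orthogonal Z w).1 hw z hz]
    ring
  have hLnorm : ∀ v, ‖L v‖ = ‖v‖ := by
    intro v
    rw [← sq_eq_sq₀ (norm_nonneg _) (norm_nonneg _), hL, hpyth _ (hψZ _) _ (k (Q v)).2, hnorm, hs']
    conv_rhs => rw [← hPQ v]
    rw [hpyth _ (P v).2 _ (Q v).2]
    have : ‖((k (Q v) : Zᗮ) : V)‖ = ‖((Q v : Zᗮ) : V)‖ := k.norm_map (Q v)
    rw [this]
  let h : V ≃ₗᵢ[ℝ] V := LinearIsometry.toLinearIsometryEquiv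
    { toLinearMap := L, norm_map' := hLnorm } rfl
  have hh : ∀ v, h v = L v := fun v => rfl
  have hφL : ∀ p, L (φ p) = ψ p := by
    intro p
    have := hLadd ⟨φ p, p, rfl⟩ 0
    rw [hsφ p ⟨p, rfl⟩, map_zero] at this
    simpa using this
  refine ⟨h, ?_, ?_, ?_⟩
  · have := hφL 1
    rw [hφ, hψ, map_one, map_one] at this
    exact this
  · intro v
    obtain ⟨p, hp⟩ := (P v).2
    have hw : g ((Q v : Zᗮ) : V) = ((g' (Q v) : Zᗮ) : V) := rfl
    have hz : g ((P v : Z) : V) = φ (X * p) := by rw [← hAX, hp]; rfl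
    have hk' := congrArg (fun w => g ((w : Zᗮ) : V)) (hk (Q v))
    simp only [← hg', g'.apply_symm_apply] at hk'
    rw [hh, hh, ← hPQ v, map_add g, map_add L, map_add L, hz, hw, map_add g.symm, hφL, ← hp, hφL,
      ← hBX]
    congr 1
    have h0 : ∀ w : Zᗮ, L w = ((k w : Zᗮ) : V) := fun w => by
      simpa using hLadd 0 w
    rw [h0, h0, LinearIsometryEquiv.eq_symm_apply]
    exact hk'
  · intro f hf
    -- g preserves Z and Zᗮ, so both components of a fixed vector are fixed.
    have hsplit : g ((P f : Z) : V) = P f ∧ g ((Q f : Zᗮ) : V) = Q f := by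
      have h1 : (g ((P f : Z) : V) - P f) + (g ((Q f : Zᗮ) : V) - Q f) = 0 := by
        have : g ((P f : Z) : V) + g ((Q f : Zᗮ) : V) = P f + Q f := by
          rw [← map_add, hPQ, hf]
        rw [sub_add_sub_comm, this, sub_self]
      have h2 := hpyth _ (sub_mem (hAZ _ (P f).2) (P f).2) _ (sub_mem (hgZ _ (Q f).2) (Q f).2)
      change ‖(g ((P f : Z) : V) - P f) + _‖ ^ 2 = ‖g ((P f : Z) : V) - P f‖ ^ 2 + _ at h2
      rw [h1, norm_zero] at h2
      constructor <;> rw [← sub_eq_zero, ← norm_eq_zero, ← sq_eq_zero_iff] <;>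
        nlinarith [sq_nonneg ‖g ((P f : Z) : V) - P f‖, sq_nonneg ‖g ((Q f : Zᗮ) : V) - Q f‖]
    have hQ : k (Q f) = Q f := hkfix _ (Subtype.ext hsplit.2)
    have hP : ψ (s (P f)) = ((P f : Z) : V) := by
      set z : V := ((P f : Z) : V) with hz
      obtain ⟨p, hp⟩ : z ∈ LinearMap.range φ := (P f).2
      have hpz : φ p = z := hp
      have h1 : ψ (s (P f)) = ψ p := by
        have := hsφ p ⟨p, rfl⟩
        convert this using 3
        exact Subtype.ext hpz.symm
      have hAz : A z = z := hsplit.1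
      have hBz : B z = z := by
        conv_lhs => rw [← hAz]
        exact g.symm_apply_apply z
      -- The inner products of ψ p and of φ p = z with the fixed vector z both equal p(1) times that
      -- of e with z. Since also ‖ψ p‖ = ‖z‖, it follows that ψ p = z.
      have h2 : inner ℝ (ψ p) z = inner ℝ z z := by
        have h3 : inner ℝ z z = inner ℝ (φ p) z := by rw [hpz]
        rw [h3, hφ, hψ, inner_aeval_apply hBA, aeval_apply_of_fixed hAz, inner_aeval_apply hAB,
          aeval_apply_of_fixed hBz]
      rw [h1, ← sub_eq_zero, ← norm_eq_zero, ← sq_eq_zero_iff, norm_sub_sq_real, h2, hnorm, hpz,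
        real_inner_self_eq_norm_sq]
      ring
    rw [hh, hL, hP, hQ, hPQ]

/-- Every permutation `g` is conjugate to its inverse by a permutation that fixes a given point
and all fixed points of `g`. -/
theorem exists_perm_conj_inv {α : Type} (g : Equiv.Perm α) (x : α) :
    ∃ h : Equiv.Perm α, h x = x ∧ h * g * h⁻¹ = g⁻¹ ∧ ∀ y, g y = y → h y = y := by
  classical
  let S := Equiv.Perm.SameCycle.setoid g
  -- representatives of the cycles, chosen to be `x` on the cycle of `x`
  let r : α → α := fun y => if g.SameCycle y x then x else Quotient.out (Quotient.mk S y)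
  have hr : ∀ y, g.SameCycle (r y) y := by
    intro y
    by_cases hy : g.SameCycle y x
    · simp only [r, if_pos hy]; exact hy.symm
    · simp only [r, if_neg hy]
      exact Quotient.mk_out (s := S) y
  have hr' : ∀ y z, g.SameCycle y z → r y = r z := by
    intro y z h
    have h1 : g.SameCycle y x ↔ g.SameCycle z x := ⟨h.symm.trans, h.trans⟩
    have h2 : Quotient.mk S y = Quotient.mk S z := Quotient.sound h
    simp only [r, h1, h2]
  choose i hi using hr
  have hwd : ∀ (a b : ℤ) (y : α), (g ^ a) y = (g ^ b) y → (g ^ (-a)) y = (g ^ (-b)) y := by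
    intro a b y h
    have : (g ^ (-a - b)) ((g ^ a) y) = (g ^ (-a - b)) ((g ^ b) y) := by rw [h]
    rw [← Equiv.Perm.mul_apply, ← Equiv.Perm.mul_apply, ← zpow_add, ← zpow_add] at this
    ring_nf at this ⊢
    exact this.symm
  -- Reflection of each cycle about its representative, g^a r ↦ g^(-a) r; by `hwd` the choice of the
  -- exponent is immaterial.
  let f : α → α := fun y => (g ^ (-(i y))) (r y)
  have hf : ∀ (y : α) (a : ℤ), f ((g ^ a) (r y)) = (g ^ (-a)) (r y) := by
    intro y a
    have h1 : g.SameCycle ((g ^ a) (r y)) (r y) :=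
      Equiv.Perm.sameCycle_zpow_left.2 (Equiv.Perm.SameCycle.refl _ _)
    have h0 : g.SameCycle (r y) y := ⟨i y, hi y⟩
    have h2 : r ((g ^ a) (r y)) = r y := hr' _ _ (h1.trans h0)
    simp only [f]
    have h3 := hi ((g ^ a) (r y))
    rw [h2] at h3 ⊢
    exact hwd _ _ _ h3
  have hff : ∀ y, f (f y) = y := by
    intro y
    conv_lhs => arg 1; simp only [f]
    rw [hf, neg_neg, hi]
  let h : Equiv.Perm α := ⟨f, f, hff, hff⟩
  have hh : ∀ y, h y = f y := fun y => rfl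
  refine ⟨h, ?_, ?_, ?_⟩
  · have hx : r x = x := if_pos (Equiv.Perm.SameCycle.refl g x)
    have := hf x 0
    rw [hx, zpow_zero, neg_zero, zpow_zero] at this
    exact this
  · rw [mul_inv_eq_iff_eq_mul]
    ext y
    rw [Equiv.Perm.mul_apply, Equiv.Perm.mul_apply, hh, hh]
    have hy := hi y
    rw [← hy]
    rw [← Equiv.Perm.mul_apply, ← zpow_one_add, hf, hf, ← Equiv.Perm.mul_apply, ← zpow_neg_one, ← zpow_add]
    congr 2
    ring
  · intro y hy
    have h0 := hi y
    have hfix : ∀ a : ℤ, (g ^ a) y = y := fun a => Equiv.Perm.zpow_apply_eq_self_of_apply_eq_self hy a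
    have h1 : r y = y := by
      rw [← Equiv.Perm.eq_inv_iff_eq, ← zpow_neg, hfix] at h0
      exact h0
    have := hf y 0
    rw [h1, zpow_zero, neg_zero, zpow_zero] at this
    exact this

end ConjInv

/-! ### Schur's lemma -/

section Schur

/-- Schur's lemma holds for the irreducible representations of `Γ` over `𝕜`. -/
def SchurProperty (𝕜 : Type) [RCLike 𝕜] (Γ : Type) [Group Γ] [TopologicalSpace Γ] : Prop :=
  ∀ (π : Irrep 𝕜 Γ) (T : Matrix (Fin π.dim) (Fin π.dim) 𝕜),
    (∀ g, (π.rho g : Matrix (Fin π.dim) (Fin π.dim) 𝕜) * T =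
      T * (π.rho g : Matrix (Fin π.dim) (Fin π.dim) 𝕜)) →
    ∃ t : 𝕜, T = t • 1

/-- Over ℂ the operator has an eigenvalue, and its eigenspace is nonzero and invariant. -/
theorem schurProperty_complex (Γ : Type) [Group Γ] [TopologicalSpace Γ] : SchurProperty ℂ Γ := by
  intro π T hT
  have : Nonempty (Fin π.dim) := ⟨⟨0, π.dim_pos⟩⟩
  obtain ⟨t, ht⟩ := Module.End.exists_eigenvalue (Matrix.toLin' T)
  have htop : Module.End.eigenspace (Matrix.toLin' T) t = ⊤ := by
    refine (π.irreducible _ fun g v hv => ?_).resolve_left ht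
    rw [Module.End.mem_eigenspace_iff, Matrix.toLin'_apply] at hv ⊢
    rw [Matrix.mulVec_mulVec, ← hT, ← Matrix.mulVec_mulVec, hv, Matrix.mulVec_smul]
  refine ⟨t, Matrix.ext_of_mulVec_single fun i => ?_⟩
  have hi : (Pi.single i 1 : Fin π.dim → ℂ) ∈ Module.End.eigenspace (Matrix.toLin' T) t := by
    rw [htop]; trivial
  rw [Module.End.mem_eigenspace_iff, Matrix.toLin'_apply] at hi
  rw [hi, Matrix.smul_mulVec, Matrix.one_mulVec]

/-- Schur's lemma over `ℝ` for a group with a Gelfand chain of subgroups. -/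
theorem schurProperty_of_chain {Γ : Type} [Group Γ] [TopologicalSpace Γ] {α : Type} [Fintype α]
    [DecidableEq α] (K : Finset α → Subgroup Γ) (h0 : K ∅ = ⊥) (h1 : K Finset.univ = ⊤)
    (hle : ∀ j S, K S ≤ K (insert j S))
    (hstep : ∀ j S, ∀ g ∈ K (insert j S), ∃ h ∈ K S, h * g * h⁻¹ = g⁻¹) : SchurProperty ℝ Γ := by
  intro π T hT
  have : Nonempty (Fin π.dim) := ⟨⟨0, π.dim_pos⟩⟩
  refine HasMinimalIdempotent.schur (ρ := π.rho) ?_ π.irreducible hT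
  rw [← h1]
  exact hasMinimalIdempotent_of_chain K h0 hle hstep _

/-- The chain consists of the pointwise stabilizers of the complements of S. The conjugating
permutation fixes j and all fixed points of g, so it lies one step down the chain. -/
theorem schurProperty_perm (k : ℕ) [TopologicalSpace (Equiv.Perm (Fin k))] :
    SchurProperty ℝ (Equiv.Perm (Fin k)) := by
  let K : Finset (Fin k) → Subgroup (Equiv.Perm (Fin k)) := fun S =>
    { carrier := {g | ∀ j, j ∉ S → g j = j}
      mul_mem' := fun {a b} ha hb j hj => by rw [Equiv.Perm.mul_apply, hb j hj, ha j hj]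
      one_mem' := fun _ _ => rfl
      inv_mem' := fun {a} ha j hj => by rw [Equiv.Perm.inv_eq_iff_eq, ha j hj] }
  refine schurProperty_of_chain K ?_ ?_ ?_ ?_
  · rw [eq_bot_iff]
    intro g hg
    exact Equiv.ext fun j => hg j (Finset.notMem_empty j)
  · rw [eq_top_iff]
    intro g _ j hj
    exact absurd (Finset.mem_univ j) hj
  · intro j S g hg i hi
    exact hg i fun h => hi (Finset.mem_insert_of_mem h)
  · intro j S g hg
    obtain ⟨h, h1, h2, h3⟩ := exists_perm_conj_inv g j
    refine ⟨h, fun i hi => ?_, h2⟩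
    by_cases hij : i = j
    · rw [hij, h1]
    · exact h3 i (hg i fun hmem => (Finset.mem_insert.1 hmem).elim hij hi)

/-- The isometry of Euclidean space given by an orthogonal matrix. -/
noncomputable def orthogonalIsometry {n : Type} [Fintype n] [DecidableEq n]
    (g : Matrix.unitaryGroup n ℝ) : EuclideanSpace ℝ n ≃ₗᵢ[ℝ] EuclideanSpace ℝ n :=
  LinearIsometry.toLinearIsometryEquiv
    { toLinearMap := Matrix.toEuclideanLin (g : Matrix n n ℝ)
      norm_map' := fun v => by
        have h : (g : Matrix n n ℝ)ᵀ * (g : Matrix n n ℝ) = 1 := by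
          rw [← Matrix.conjTranspose_eq_transpose_of_trivial]
          exact Matrix.UnitaryGroup.star_mul_self g
        rw [← sq_eq_sq₀ (norm_nonneg _) (norm_nonneg _), ← real_inner_self_eq_norm_sq,
          ← real_inner_self_eq_norm_sq, Matrix.toLpLin_apply, EuclideanSpace.inner_toLp_toLp,
          star_trivial, Matrix.dotProduct_mulVec, ← Matrix.mulVec_transpose,
          Matrix.mulVec_mulVec, h, Matrix.one_mulVec, EuclideanSpace.inner_eq_star_dotProduct,
          star_trivial] } rfl

/-- Every orthogonal matrix `g` is conjugate to its inverse by an orthogonal matrix that fixes a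
given vector and all fixed vectors of `g`. -/
theorem exists_orthogonal_conj_inv {n : Type} [Fintype n] [DecidableEq n]
    (g : Matrix.unitaryGroup n ℝ) (e : n → ℝ) : ∃ h : Matrix.unitaryGroup n ℝ,
      (h : Matrix n n ℝ) *ᵥ e = e ∧ h * g * h⁻¹ = g⁻¹ ∧
      ∀ f, (g : Matrix n n ℝ) *ᵥ f = f → (h : Matrix n n ℝ) *ᵥ f = f := by
  obtain ⟨h, h1, h2, h3⟩ := exists_isometry_conj_inv _ (EuclideanSpace ℝ n) rfl
    (orthogonalIsometry g) (WithLp.toLp 2 e)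
  let A : Matrix n n ℝ := Matrix.toEuclideanLin.symm h.toLinearEquiv.toLinearMap
  have hA : ∀ v : n → ℝ, A *ᵥ v = (h (WithLp.toLp 2 v)).ofLp := by
    intro v
    have : Matrix.toEuclideanLin A (WithLp.toLp 2 v) = h (WithLp.toLp 2 v) := by
      simp [A]
    rw [← this]; rfl
  have hU : A ∈ Matrix.unitaryGroup n ℝ := by
    rw [Matrix.mem_unitaryGroup_iff', Matrix.star_eq_conjTranspose,
      Matrix.conjTranspose_eq_transpose_of_trivial]
    ext i j
    have h4 := h.inner_map_map (WithLp.toLp 2 (Pi.single i 1)) (WithLp.toLp 2 (Pi.single j 1))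
    rw [EuclideanSpace.inner_eq_star_dotProduct, EuclideanSpace.inner_eq_star_dotProduct,
      ← hA, ← hA, star_trivial, star_trivial] at h4
    simp only [Matrix.mulVec_single_one, single_dotProduct, Pi.single_apply, one_mul] at h4
    rw [Matrix.mul_apply, Matrix.one_apply]
    simp only [dotProduct, Matrix.col_apply] at h4
    simp only [Matrix.transpose_apply, mul_comm (A _ i)]
    rw [h4]
    simp only [eq_comm]
  refine ⟨⟨A, hU⟩, ?_, ?_, ?_⟩
  · change A *ᵥ e = e
    rw [hA, h1]
  · rw [mul_inv_eq_iff_eq_mul, eq_inv_mul_iff_mul_eq]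
    refine Subtype.ext ?_
    rw [Matrix.UnitaryGroup.mul_val, Matrix.UnitaryGroup.mul_val]
    change (g : Matrix n n ℝ) * (A * (g : Matrix n n ℝ)) = A
    refine Matrix.ext_of_mulVec_single fun i => ?_
    rw [← Matrix.mulVec_mulVec, ← Matrix.mulVec_mulVec, hA, hA]
    have h5 := h2 (WithLp.toLp 2 (Pi.single i 1))
    rw [LinearIsometryEquiv.eq_symm_apply] at h5
    exact congrArg WithLp.ofLp h5
  · intro f hf
    change A *ᵥ f = f
    rw [hA, h3 _ (by ext1; exact congrFun hf _)]

/-- The chain consists of the stabilizers of the coordinate vectors outside S, and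
`exists_orthogonal_conj_inv` is applied with the vector of index j. -/
theorem schurProperty_orthogonal (n : Type) [Fintype n] [DecidableEq n] :
    SchurProperty ℝ (⊤ : Subgroup (Matrix.unitaryGroup n ℝ)) := by
  let K : Finset n → Subgroup (⊤ : Subgroup (Matrix.unitaryGroup n ℝ)) := fun S =>
    { carrier := {g | ∀ j, j ∉ S → ((g : Matrix.unitaryGroup n ℝ) : Matrix n n ℝ) *ᵥ Pi.single j 1 =
        Pi.single j 1}
      mul_mem' := fun {a b} ha hb j hj => by
        rw [Subgroup.coe_mul, Matrix.UnitaryGroup.mul_val, ← Matrix.mulVec_mulVec, hb j hj, ha j hj]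
      one_mem' := fun j hj => by
        rw [Subgroup.coe_one, Matrix.UnitaryGroup.one_val, Matrix.one_mulVec]
      inv_mem' := fun {a} ha j hj => by
        conv_lhs => rw [← ha j hj]
        rw [Matrix.mulVec_mulVec, ← Matrix.UnitaryGroup.mul_val, ← Subgroup.coe_mul,
          inv_mul_cancel, Subgroup.coe_one, Matrix.UnitaryGroup.one_val, Matrix.one_mulVec] }
  refine schurProperty_of_chain K ?_ ?_ ?_ ?_
  · rw [eq_bot_iff]
    intro g hg
    rw [Subgroup.mem_bot]
    refine Subtype.ext (Subtype.ext ?_)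
    refine Matrix.ext_of_mulVec_single fun j => ?_
    rw [hg j (Finset.notMem_empty j), Subgroup.coe_one, Matrix.UnitaryGroup.one_val,
      Matrix.one_mulVec]
  · rw [eq_top_iff]
    intro g _ j hj
    exact absurd (Finset.mem_univ j) hj
  · intro j S g hg i hi
    exact hg i fun h => hi (Finset.mem_insert_of_mem h)
  · intro j S g hg
    obtain ⟨h, h1, h2, h3⟩ := exists_orthogonal_conj_inv (g : Matrix.unitaryGroup n ℝ)
      (Pi.single j 1)
    refine ⟨⟨h, Subgroup.mem_top h⟩, fun i hi => ?_, Subtype.ext h2⟩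
    by_cases hij : i = j
    · rw [hij]; exact h1
    · exact h3 _ (hg i fun hmem => (Finset.mem_insert.1 hmem).elim hij hi)

end Schur

/-! ### Unitary representations: irreducible subrepresentations and Schur orthogonality -/

section Unitary

variable {𝕜 : Type} [RCLike 𝕜] {Γ : Type} [Group Γ] [TopologicalSpace Γ]

omit [TopologicalSpace Γ] in
theorem coe_unitary_inv {ι : Type} [Fintype ι] [DecidableEq ι]
    (ρ : Γ →* Matrix.unitaryGroup ι 𝕜) (g : Γ) :
    (ρ g⁻¹ : Matrix ι ι 𝕜) = (ρ g : Matrix ι ι 𝕜)ᴴ := by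
  rw [map_inv]; rfl

omit [TopologicalSpace Γ] in
theorem coe_unitary_mul {ι : Type} [Fintype ι] [DecidableEq ι]
    (ρ : Γ →* Matrix.unitaryGroup ι 𝕜) (g h : Γ) :
    (ρ (g * h) : Matrix ι ι 𝕜) = (ρ g : Matrix ι ι 𝕜) * (ρ h : Matrix ι ι 𝕜) := by
  rw [map_mul, Matrix.UnitaryGroup.mul_val]

omit [TopologicalSpace Γ] in
theorem coe_unitary_one {ι : Type} [Fintype ι] [DecidableEq ι]
    (ρ : Γ →* Matrix.unitaryGroup ι 𝕜) : (ρ 1 : Matrix ι ι 𝕜) = 1 := by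
  rw [map_one, Matrix.UnitaryGroup.one_val]

theorem exists_minimal_invariant {V : Type} [AddCommGroup V] [Module 𝕜 V] [FiniteDimensional 𝕜 V]
    (p : Submodule 𝕜 V → Prop) {W : Submodule 𝕜 V} (hW : W ≠ ⊥) (hp : p W) :
    ∃ Y ≤ W, Y ≠ ⊥ ∧ p Y ∧ ∀ Z ≤ Y, p Z → Z = ⊥ ∨ Z = Y := by
  classical
  have hex : ∃ r, ∃ Y ≤ W, Y ≠ ⊥ ∧ p Y ∧ Module.finrank 𝕜 Y = r := ⟨_, W, le_rfl, hW, hp, rfl⟩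
  obtain ⟨Y, hYW, hY0, hpY, hr⟩ := Nat.find_spec hex
  refine ⟨Y, hYW, hY0, hpY, fun Z hZ hpZ => ?_⟩
  by_cases h0 : Z = ⊥
  · exact Or.inl h0
  · refine Or.inr (Submodule.eq_of_le_of_finrank_le hZ ?_)
    rw [hr]
    exact Nat.find_min' hex ⟨Z, hZ.trans hYW, h0, hpZ, rfl⟩

/-- A nonzero invariant subspace contains an irreducible representation. -/
theorem exists_irrep {ι : Type} [Fintype ι] [DecidableEq ι] (ρ : Γ →* Matrix.unitaryGroup ι 𝕜)
    (hρ : Continuous fun g => (ρ g : Matrix ι ι 𝕜)) {W : Submodule 𝕜 (ι → 𝕜)} (hW : W ≠ ⊥)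
    (hinv : ∀ g, ∀ v ∈ W, (ρ g : Matrix ι ι 𝕜) *ᵥ v ∈ W) :
    ∃ (π : Irrep 𝕜 Γ) (F : Matrix ι (Fin π.dim) 𝕜), Fᴴ * F = 1 ∧
      (∀ g, (ρ g : Matrix ι ι 𝕜) * F = F * (π.rho g : Matrix (Fin π.dim) (Fin π.dim) 𝕜)) ∧ ∀ v, F *ᵥ v ∈ W := by
  obtain ⟨Y, hYW, hY0, hYinv, hYmin⟩ := exists_minimal_invariant
    (fun Y : Submodule 𝕜 (ι → 𝕜) => ∀ g, ∀ v ∈ Y, (ρ g : Matrix ι ι 𝕜) *ᵥ v ∈ Y) hW hinv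
  let Y' : Submodule 𝕜 (EuclideanSpace 𝕜 ι) :=
    Y.map (WithLp.linearEquiv 2 𝕜 (ι → 𝕜)).symm.toLinearMap
  have hY' : ∀ v, v ∈ Y' ↔ v.ofLp ∈ Y := by
    intro v
    constructor
    · rintro ⟨w, hw, rfl⟩; exact hw
    · intro h; exact ⟨v.ofLp, h, rfl⟩
  let b := stdOrthonormalBasis 𝕜 Y'
  let F : Matrix ι (Fin (Module.finrank 𝕜 Y')) 𝕜 := Matrix.of fun x j =>
    (b j : EuclideanSpace 𝕜 ι).ofLp x
  have hFF : Fᴴ * F = 1 := by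
    ext i j
    have := orthonormal_iff_ite.1 b.orthonormal i j
    rw [Submodule.coe_inner, EuclideanSpace.inner_eq_star_dotProduct] at this
    rw [Matrix.mul_apply, Matrix.one_apply, ← this]
    simp [F, dotProduct, mul_comm]
  have hFv : ∀ v, F *ᵥ v = ((∑ j, v j • b j : Y') : EuclideanSpace 𝕜 ι).ofLp := by
    intro v
    ext x
    simp [F, Matrix.mulVec, dotProduct, mul_comm]
  have hFmem : ∀ v, F *ᵥ v ∈ Y := by
    intro v
    rw [hFv, ← hY']
    exact (∑ j, v j • b j : Y').2
  have hFsurj : ∀ y ∈ Y, ∃ v, F *ᵥ v = y := by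
    intro y hy
    refine ⟨fun j => inner 𝕜 (b j) (⟨WithLp.toLp 2 y, (hY' _).2 hy⟩ : Y'), ?_⟩
    rw [hFv, b.sum_repr']
  have hFFy : ∀ y ∈ Y, (F * Fᴴ) *ᵥ y = y := by
    intro y hy
    obtain ⟨v, rfl⟩ := hFsurj y hy
    rw [Matrix.mulVec_mulVec, Matrix.mul_assoc, hFF, Matrix.mul_one]
  -- F Fᴴ is the orthogonal projection onto Y, so this is the invariance of Y. It makes the
  -- compressions Fᴴ ρ(g) F multiplicative.
  have hproj : ∀ g, F * Fᴴ * ((ρ g : Matrix ι ι 𝕜) * F) = (ρ g : Matrix ι ι 𝕜) * F := by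
    intro g
    refine Matrix.ext_of_mulVec_single fun i => ?_
    rw [← Matrix.mulVec_mulVec, hFFy]
    rw [← Matrix.mulVec_mulVec]
    exact hYinv g _ (hFmem _)
  have hmul : ∀ g h, (Fᴴ * (ρ g : Matrix ι ι 𝕜) * F) * (Fᴴ * (ρ h : Matrix ι ι 𝕜) * F) =
      Fᴴ * (ρ (g * h) : Matrix ι ι 𝕜) * F := by
    intro g h
    calc _ = Fᴴ * (ρ g : Matrix ι ι 𝕜) * (F * Fᴴ * ((ρ h : Matrix ι ι 𝕜) * F)) := by
          simp only [Matrix.mul_assoc]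
      _ = _ := by rw [hproj, coe_unitary_mul]; simp only [Matrix.mul_assoc]
  have hone : Fᴴ * (ρ 1 : Matrix ι ι 𝕜) * F = 1 := by
    rw [coe_unitary_one, Matrix.mul_one, hFF]
  let rho : Γ →* Matrix.unitaryGroup (Fin (Module.finrank 𝕜 Y')) 𝕜 :=
    { toFun := fun g => ⟨Fᴴ * (ρ g : Matrix ι ι 𝕜) * F, by
        rw [Matrix.mem_unitaryGroup_iff, Matrix.star_eq_conjTranspose,
          Matrix.conjTranspose_mul, Matrix.conjTranspose_mul, Matrix.conjTranspose_conjTranspose,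
          ← coe_unitary_inv, ← Matrix.mul_assoc Fᴴ, hmul, mul_inv_cancel, hone]⟩
      map_one' := Subtype.ext hone
      map_mul' := fun g h => Subtype.ext (hmul g h).symm }
  have hrho : ∀ g, (rho g : Matrix (Fin (Module.finrank 𝕜 Y')) (Fin (Module.finrank 𝕜 Y')) 𝕜) = Fᴴ * (ρ g : Matrix ι ι 𝕜) * F := fun g => rfl
  have hinter : ∀ g, (ρ g : Matrix ι ι 𝕜) * F = F * (rho g : Matrix (Fin (Module.finrank 𝕜 Y')) (Fin (Module.finrank 𝕜 Y')) 𝕜) := by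
    intro g
    rw [hrho, ← hproj g]
    simp only [Matrix.mul_assoc]
  refine ⟨⟨Module.finrank 𝕜 Y', ?_, rho, ?_, ?_⟩, F, hFF, hinter, fun v => hYW (hFmem v)⟩
  · obtain ⟨y, hy, hy0⟩ := Submodule.exists_mem_ne_zero_of_ne_bot hY0
    have : Nontrivial Y' := ⟨⟨⟨WithLp.toLp 2 y, (hY' _).2 hy⟩, 0, fun h => hy0
      (congrArg (fun z : Y' => (z : EuclideanSpace 𝕜 ι).ofLp) h)⟩⟩
    exact Module.finrank_pos
  · refine Continuous.subtype_mk ?_ _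
    exact (continuous_const.matrix_mul hρ).matrix_mul continuous_const
  · intro Z hZ
    have hle : Z.map F.mulVecLin ≤ Y := by
      rintro _ ⟨z, -, rfl⟩
      exact hFmem z
    have hZF : ∀ g, ∀ v ∈ Z.map F.mulVecLin, (ρ g : Matrix ι ι 𝕜) *ᵥ v ∈ Z.map F.mulVecLin := by
      rintro g _ ⟨z, hz, rfl⟩
      refine ⟨_, hZ g z hz, ?_⟩
      simp only [Matrix.mulVecLin_apply, Matrix.mulVec_mulVec, hinter]
    rcases hYmin _ hle hZF with h | h
    · left
      rw [eq_bot_iff]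
      intro z hz
      have h1 : F *ᵥ z ∈ Z.map F.mulVecLin := ⟨z, hz, rfl⟩
      rw [h, Submodule.mem_bot] at h1
      have h2 := congrArg (Fᴴ *ᵥ ·) h1
      simpa [Matrix.mulVec_mulVec, hFF] using h2
    · right
      rw [eq_top_iff]
      intro z _
      have h1 : F *ᵥ z ∈ Z.map F.mulVecLin := by rw [h]; exact hFmem z
      obtain ⟨z', hz', e⟩ := h1
      have h2 := congrArg (Fᴴ *ᵥ ·) e
      simp only [Matrix.mulVecLin_apply, Matrix.mulVec_mulVec, hFF, Matrix.one_mulVec] at h2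
      rwa [← h2]

/-- A nonzero invariant subspace contains a nonzero image of an intertwiner from the fixed
representative of some class in the dual. -/
theorem exists_dual {ι : Type} [Fintype ι] [DecidableEq ι] (ρ : Γ →* Matrix.unitaryGroup ι 𝕜)
    (hρ : Continuous fun g => (ρ g : Matrix ι ι 𝕜)) {W : Submodule 𝕜 (ι → 𝕜)} (hW : W ≠ ⊥)
    (hinv : ∀ g, ∀ v ∈ W, (ρ g : Matrix ι ι 𝕜) *ᵥ v ∈ W) :
    ∃ (μ : Dual 𝕜 Γ) (F : Matrix ι (Fin μ.dim) 𝕜), F ≠ 0 ∧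
      (∀ g, (ρ g : Matrix ι ι 𝕜) * F = F * μ.mat g) ∧ ∀ v, F *ᵥ v ∈ W := by
  obtain ⟨π, F, hFF, hF, hFW⟩ := exists_irrep ρ hρ hW hinv
  let μ : Dual 𝕜 Γ := Quotient.mk _ π
  obtain ⟨e, he⟩ : μ.rep ≈ π := Quotient.mk_out π
  -- The equivalence with the fixed representative need not be isometric, so the result is only
  -- claimed to be nonzero; orthonormality is arranged later.
  let A : Matrix (Fin π.dim) (Fin μ.dim) 𝕜 := LinearMap.toMatrix' e.toLinearMap
  have hA : ∀ v, A *ᵥ v = e v := fun v => by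
    rw [← Matrix.toLin'_apply]
    simp [A]
  refine ⟨μ, F * A, ?_, ?_, ?_⟩
  · intro h0
    have h1 : A = 0 := by
      rw [← Matrix.one_mul A, ← hFF, Matrix.mul_assoc, h0, Matrix.mul_zero]
    have h2 : e (Pi.single ⟨0, μ.rep.dim_pos⟩ 1) = 0 := by rw [← hA, h1, Matrix.zero_mulVec]
    rw [LinearEquiv.map_eq_zero_iff] at h2
    simpa using congrFun h2 ⟨0, μ.rep.dim_pos⟩
  · intro g
    rw [← Matrix.mul_assoc, hF, Matrix.mul_assoc, Matrix.mul_assoc]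
    congr 1
    refine Matrix.ext_of_mulVec_single fun i => ?_
    rw [← Matrix.mulVec_mulVec, ← Matrix.mulVec_mulVec, hA, hA, he]
  · intro v
    rw [← Matrix.mulVec_mulVec]
    exact hFW _

/-- Intertwiners between inequivalent irreducible representations vanish. -/
theorem Irrep.intertwiner_eq_zero {π π' : Irrep 𝕜 Γ} (hne : ¬ π ≈ π')
    {A : Matrix (Fin π'.dim) (Fin π.dim) 𝕜}
    (hA : ∀ g, (π'.rho g : Matrix (Fin π'.dim) (Fin π'.dim) 𝕜) * A = A * (π.rho g : Matrix (Fin π.dim) (Fin π.dim) 𝕜)) : A = 0 := by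
  by_contra hA0
  apply hne
  have hA' : ∀ g v, A *ᵥ ((π.rho g : Matrix (Fin π.dim) (Fin π.dim) 𝕜) *ᵥ v) = (π'.rho g : Matrix (Fin π'.dim) (Fin π'.dim) 𝕜) *ᵥ (A *ᵥ v) :=
    fun g v => by rw [Matrix.mulVec_mulVec, Matrix.mulVec_mulVec, hA]
  have hex : ∃ v, A *ᵥ v ≠ 0 := by
    by_contra! h
    exact hA0 (Matrix.ext_of_mulVec_single fun i => by rw [h, Matrix.zero_mulVec])
  obtain ⟨v, hv⟩ := hex
  have hker : LinearMap.ker A.mulVecLin = ⊥ := by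
    refine (π.irreducible _ fun g w hw => ?_).resolve_right fun h => hv ?_
    · rw [LinearMap.mem_ker, Matrix.mulVecLin_apply] at hw ⊢
      rw [hA', hw, Matrix.mulVec_zero]
    · have : v ∈ LinearMap.ker A.mulVecLin := by rw [h]; trivial
      exact this
  have hran : LinearMap.range A.mulVecLin = ⊤ := by
    refine (π'.irreducible _ ?_).resolve_left fun h => hv ?_
    · rintro g _ ⟨w, rfl⟩
      exact ⟨_, hA' g w⟩
    · have : A *ᵥ v ∈ LinearMap.range A.mulVecLin := ⟨v, rfl⟩
      rwa [h, Submodule.mem_bot] at this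
  exact ⟨LinearEquiv.ofBijective A.mulVecLin
    ⟨LinearMap.ker_eq_bot.1 hker, LinearMap.range_eq_top.1 hran⟩, fun g w => hA' g w⟩

theorem Dual.intertwiner_eq_zero {μ ν : Dual 𝕜 Γ} (hne : μ ≠ ν)
    {A : Matrix (Fin μ.dim) (Fin ν.dim) 𝕜} (hA : ∀ g, μ.mat g * A = A * ν.mat g) : A = 0 :=
  Irrep.intertwiner_eq_zero (fun h => hne (Quotient.out_equiv_out.1 h).symm) hA

end Unitary

/-! ### Slices of intertwiners between tensor products -/

section Kronecker

variable {𝕜 : Type} [RCLike 𝕜] {a b c d : Type} [Fintype a] [Fintype b] [Fintype c] [Fintype d]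

/-- Fixing the indices on which the identity acts reduces an intertwiner of tensor products to
intertwiners of a single factor, to which Schur's lemma applies. -/
theorem block_mul_of_kronecker_one [DecidableEq c] [DecidableEq d] {A : Matrix a a 𝕜} {B : Matrix b b 𝕜}
    {Z : Matrix (a × c) (b × d) 𝕜} (h : (A ⊗ₖ (1 : Matrix c c 𝕜)) * Z = Z * (B ⊗ₖ (1 : Matrix d d 𝕜)))
    (j : c) (l : d) : A * (Matrix.of fun i k => Z (i, j) (k, l)) =
      (Matrix.of fun i k => Z (i, j) (k, l)) * B := by
  ext i k
  have := congrFun (congrFun h (i, j)) (k, l)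
  simp only [Matrix.mul_apply, Fintype.sum_prod_type, Matrix.kroneckerMap_apply,
    Matrix.one_apply] at this
  simpa [Matrix.mul_apply] using this

theorem block_mul_of_one_kronecker [DecidableEq a] [DecidableEq b] {A : Matrix c c 𝕜} {B : Matrix d d 𝕜}
    {Z : Matrix (a × c) (b × d) 𝕜} (h : ((1 : Matrix a a 𝕜) ⊗ₖ A) * Z = Z * ((1 : Matrix b b 𝕜) ⊗ₖ B))
    (i : a) (k : b) : A * (Matrix.of fun j l => Z (i, j) (k, l)) =
      (Matrix.of fun j l => Z (i, j) (k, l)) * B := by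
  ext j l
  have := congrFun (congrFun h (i, j)) (k, l)
  simp only [Matrix.mul_apply, Fintype.sum_prod_type, Matrix.kroneckerMap_apply,
    Matrix.one_apply] at this
  simpa [Matrix.mul_apply] using this

end Kronecker

/-! ### Decomposition of the representation on vectorized matrices -/

section SymDual

variable {𝕜 : Type} [RCLike 𝕜] {k : ℕ}

theorem SymDual.dim_pos (μ' : SymDual 𝕜 k) : 0 < SymDual.dim μ' :=
  letI : TopologicalSpace (Equiv.Perm (Fin k)) := ⊥
  μ'.rep.dim_pos

theorem SymDual.mat_one (μ' : SymDual 𝕜 k) : SymDual.mat μ' 1 = 1 :=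
  letI : TopologicalSpace (Equiv.Perm (Fin k)) := ⊥
  coe_unitary_one μ'.rep.rho

theorem SymDual.mat_mul_conjTranspose (μ' : SymDual 𝕜 k) (σ : Equiv.Perm (Fin k)) :
    SymDual.mat μ' σ * (SymDual.mat μ' σ)ᴴ = 1 :=
  letI : TopologicalSpace (Equiv.Perm (Fin k)) := ⊥
  Matrix.mem_unitaryGroup_iff.1 (μ'.rep.rho σ).2

theorem SymDual.intertwiner_eq_zero {μ ν : SymDual 𝕜 k} (hne : μ ≠ ν)
    {A : Matrix (Fin (SymDual.dim μ)) (Fin (SymDual.dim ν)) 𝕜}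
    (hA : ∀ σ, SymDual.mat μ σ * A = A * SymDual.mat ν σ) : A = 0 :=
  letI : TopologicalSpace (Equiv.Perm (Fin k)) := ⊥
  Dual.intertwiner_eq_zero hne hA

theorem exists_symDual {ι : Type} [Fintype ι] [DecidableEq ι]
    (ρ : Equiv.Perm (Fin k) →* Matrix.unitaryGroup ι 𝕜) {W : Submodule 𝕜 (ι → 𝕜)} (hW : W ≠ ⊥)
    (hinv : ∀ σ, ∀ v ∈ W, (ρ σ : Matrix ι ι 𝕜) *ᵥ v ∈ W) :
    ∃ (μ : SymDual 𝕜 k) (F : Matrix ι (Fin (SymDual.dim μ)) 𝕜), F ≠ 0 ∧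
      (∀ σ, (ρ σ : Matrix ι ι 𝕜) * F = F * SymDual.mat μ σ) ∧ ∀ v, F *ᵥ v ∈ W :=
  letI : TopologicalSpace (Equiv.Perm (Fin k)) := ⊥
  exists_dual ρ continuous_bot hW hinv

/-- Currying: an intertwiner from ν into the space of intertwiners out of μ is the same as an
intertwiner out of μ ⊗ ν. The columns of F are flattened intertwiners out of μ. -/
theorem mul_eq_mul_kronecker {ι a c : Type} [Fintype ι] [Fintype a] [Fintype c] [DecidableEq a]
    {R S : Matrix ι ι 𝕜} {μ : Matrix a a 𝕜} {ν : Matrix c c 𝕜} {F : Matrix (ι × a) c 𝕜}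
    (hR : ∀ j, R * (Matrix.of fun x i => F (x, i) j) = (Matrix.of fun x i => F (x, i) j) * μ)
    (hS : (S ⊗ₖ (1 : Matrix a a 𝕜)) * F = F * ν) :
    R * S * (Matrix.of fun x p => F (x, p.1) p.2) =
      (Matrix.of fun x p => F (x, p.1) p.2) * (μ ⊗ₖ ν) := by
  ext x p
  obtain ⟨l, j⟩ := p
  have h2 : ∀ y, (S * (Matrix.of fun x p => F (x, p.1) p.2 : Matrix ι (a × c) 𝕜)) y (l, j) =
      ∑ j', F (y, l) j' * ν j' j := by
    intro y
    have := congrFun (congrFun hS (y, l)) j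
    rw [Matrix.mul_apply, Matrix.mul_apply] at this
    rw [← this, Matrix.mul_apply, Fintype.sum_prod_type]
    simp [Matrix.one_apply]
  have h3 : ∀ j', ∑ y, R x y * F (y, l) j' = ∑ i, F (x, i) j' * μ i l := by
    intro j'
    have := congrFun (congrFun (hR j') x) l
    rw [Matrix.mul_apply, Matrix.mul_apply] at this
    exact this
  rw [Matrix.mul_assoc, Matrix.mul_apply, Finset.sum_congr rfl fun y _ => by rw [h2]]
  simp only [Finset.mul_sum, ← mul_assoc]
  rw [Finset.sum_comm]
  simp only [← Finset.sum_mul, h3]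
  refine Eq.trans ?_ (Matrix.mul_apply (M := Matrix.of fun x p => F (x, p.1) p.2)
    (N := μ ⊗ₖ ν) (i := x) (k := (l, j))).symm
  rw [Fintype.sum_prod_type_right]
  refine Finset.sum_congr rfl fun j' _ => ?_
  rw [Finset.sum_mul]
  refine Finset.sum_congr rfl fun i _ => ?_
  simp only [Matrix.of_apply, Matrix.kroneckerMap_apply, mul_assoc]

end SymDual

namespace MatrixModel

variable {𝕜 : Type} [RCLike 𝕜] {n : Type} [Fintype n] [DecidableEq n] {k : ℕ}

/-- The group `G × S_k × ℤ/2` acts by a continuous unitary representation, and its irreducible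
representations satisfy Schur's lemma. -/
structure IsUnitaryModel (X : MatrixModel 𝕜 n k) : Prop where
  rep_mul : ∀ g σ g' σ', X.rep g σ * X.rep g' σ' = X.rep (g * g') (σ * σ')
  rep_one : X.rep 1 1 = 1
  rep_conjTranspose : ∀ g σ, (X.rep g σ)ᴴ = X.rep g⁻¹ σ⁻¹
  continuous_rep : Continuous fun g => X.rep g 1
  swap_conjTranspose : X.swapMatrixᴴ = X.swapMatrix
  swap_mul_swap : X.swapMatrix * X.swapMatrix = 1
  swap_mul_rep : ∀ g σ, X.swapMatrix * X.rep g σ = X.rep g σ * X.swapMatrix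
  schur : SchurProperty 𝕜 X.group
  schur_perm : @SchurProperty 𝕜 _ (Equiv.Perm (Fin k)) _ ⊥

variable {X : MatrixModel 𝕜 n k}

namespace IsUnitaryModel

variable (hX : X.IsUnitaryModel)
include hX

theorem conjTranspose_rep_mul (g : X.group) (σ : Equiv.Perm (Fin k)) :
    (X.rep g σ)ᴴ * X.rep g σ = 1 := by
  rw [hX.rep_conjTranspose, hX.rep_mul, inv_mul_cancel, inv_mul_cancel, hX.rep_one]

theorem rep_mul_conjTranspose (g : X.group) (σ : Equiv.Perm (Fin k)) :
    X.rep g σ * (X.rep g σ)ᴴ = 1 := by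
  rw [hX.rep_conjTranspose, hX.rep_mul, mul_inv_cancel, mul_inv_cancel, hX.rep_one]

/-- A nonzero invariant subspace contains a nonzero image of an intertwiner. -/
theorem exists_intertwiner {W : Submodule 𝕜 (MIdx n k × MIdx n k → 𝕜)} (hW : W ≠ ⊥)
    (hrep : ∀ g σ, ∀ v ∈ W, X.rep g σ *ᵥ v ∈ W) (hswap : ∀ v ∈ W, X.swapMatrix *ᵥ v ∈ W) :
    ∃ b : X.Label, ∃ F ∈ b.intertwiners, F ≠ 0 ∧ ∀ v, F *ᵥ v ∈ W := by
  classical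
  -- an eigenspace of the exchange of factors
  obtain ⟨s, Ws, hWs, hWs0⟩ : ∃ (s : ℤˣ) (Ws : Submodule 𝕜 (MIdx n k × MIdx n k → 𝕜)),
      (∀ v, v ∈ Ws ↔ v ∈ W ∧ X.swapMatrix *ᵥ v = ((s : ℤ) : 𝕜) • v) ∧ Ws ≠ ⊥ := by
    let Ws : ℤˣ → Submodule 𝕜 (MIdx n k × MIdx n k → 𝕜) := fun s =>
      W ⊓ LinearMap.ker (X.swapMatrix.mulVecLin - ((s : ℤ) : 𝕜) • LinearMap.id)
    have hWs : ∀ s v, v ∈ Ws s ↔ v ∈ W ∧ X.swapMatrix *ᵥ v = ((s : ℤ) : 𝕜) • v := by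
      intro s v
      simp only [Ws, Submodule.mem_inf, LinearMap.mem_ker, LinearMap.sub_apply,
        LinearMap.smul_apply, LinearMap.id_apply, Matrix.mulVecLin_apply, sub_eq_zero]
    by_cases h1 : Ws 1 = ⊥
    · refine ⟨-1, Ws (-1), hWs _, fun h2 => hW ?_⟩
      rw [eq_bot_iff]
      intro w hw
      have ha : w + X.swapMatrix *ᵥ w ∈ Ws 1 := by
        rw [hWs]
        refine ⟨add_mem hw (hswap w hw), ?_⟩
        rw [Matrix.mulVec_add, Matrix.mulVec_mulVec, hX.swap_mul_swap, Matrix.one_mulVec]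
        simp [add_comm]
      have hb : w - X.swapMatrix *ᵥ w ∈ Ws (-1) := by
        rw [hWs]
        refine ⟨sub_mem hw (hswap w hw), ?_⟩
        rw [Matrix.mulVec_sub, Matrix.mulVec_mulVec, hX.swap_mul_swap, Matrix.one_mulVec]
        simp
      rw [h1, Submodule.mem_bot] at ha
      rw [h2, Submodule.mem_bot] at hb
      have hc : (2 : 𝕜) • w = 0 := by
        rw [two_smul]
        calc w + w = (w + X.swapMatrix *ᵥ w) + (w - X.swapMatrix *ᵥ w) := by abel
          _ = 0 := by rw [ha, hb, add_zero]
      exact (smul_eq_zero.1 hc).resolve_left two_ne_zero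
    · exact ⟨1, Ws 1, hWs 1, h1⟩
  have hWsrep : ∀ g σ, ∀ v ∈ Ws, X.rep g σ *ᵥ v ∈ Ws := by
    intro g σ v hv
    rw [hWs] at hv ⊢
    refine ⟨hrep g σ v hv.1, ?_⟩
    rw [Matrix.mulVec_mulVec, hX.swap_mul_rep, ← Matrix.mulVec_mulVec, hv.2, Matrix.mulVec_smul]
  -- an irreducible representation of `G`
  let ρ : X.group →* Matrix.unitaryGroup (MIdx n k × MIdx n k) 𝕜 :=
    { toFun := fun g => ⟨X.rep g 1, by
        rw [Matrix.mem_unitaryGroup_iff, Matrix.star_eq_conjTranspose, hX.rep_mul_conjTranspose]⟩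
      map_one' := Subtype.ext hX.rep_one
      map_mul' := fun g h => Subtype.ext (by
        rw [Matrix.UnitaryGroup.mul_val]
        simp only [hX.rep_mul, mul_one]) }
  obtain ⟨μ, F₁, hF₁0, hF₁, hF₁W⟩ := exists_dual ρ hX.continuous_rep hWs0
    fun g v hv => hWsrep g 1 v hv
  change ∀ g, X.rep g 1 * F₁ = F₁ * μ.mat g at hF₁
  -- an irreducible representation of `S_k` on the space of intertwiners
  let toM : (((MIdx n k × MIdx n k) × Fin μ.dim) → 𝕜) → Matrix (MIdx n k × MIdx n k) (Fin μ.dim) 𝕜 :=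
    fun φ => Matrix.of fun x i => φ (x, i)
  have toM_add : ∀ φ φ', toM (φ + φ') = toM φ + toM φ' := fun _ _ => rfl
  have toM_smul : ∀ (c : 𝕜) φ, toM (c • φ) = c • toM φ := fun _ _ => rfl
  have toM_mulVec : ∀ A φ, toM ((A ⊗ₖ (1 : Matrix (Fin μ.dim) (Fin μ.dim) 𝕜)) *ᵥ φ) = A * toM φ := by
    intro A φ
    ext x i
    simp [toM, Matrix.mulVec, dotProduct, Matrix.mul_apply, Fintype.sum_prod_type,
      Matrix.one_apply]
  -- Hom_G(μ, Ws), flattened to vectors so that S_k acts on the ambient space by the unitary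
  -- matrices `X.rep 1 σ ⊗ₖ 1`.
  let Ω : Submodule 𝕜 (((MIdx n k × MIdx n k) × Fin μ.dim) → 𝕜) :=
    { carrier := {φ | (∀ g, X.rep g 1 * toM φ = toM φ * μ.mat g) ∧ ∀ v, toM φ *ᵥ v ∈ Ws}
      add_mem' := fun {φ φ'} h h' => by
        refine ⟨fun g => ?_, fun v => ?_⟩
        · rw [toM_add, Matrix.mul_add, Matrix.add_mul, h.1, h'.1]
        · rw [toM_add, Matrix.add_mulVec]; exact add_mem (h.2 v) (h'.2 v)
      zero_mem' := by
        have h0 : toM 0 = 0 := rfl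
        refine ⟨fun g => ?_, fun v => ?_⟩
        · rw [h0, Matrix.mul_zero, Matrix.zero_mul]
        · rw [h0, Matrix.zero_mulVec]; exact zero_mem _
      smul_mem' := fun c φ h => by
        refine ⟨fun g => ?_, fun v => ?_⟩
        · rw [toM_smul, Matrix.mul_smul, Matrix.smul_mul, h.1]
        · rw [toM_smul, Matrix.smul_mulVec]; exact Submodule.smul_mem _ _ (h.2 v) }
  have hΩ0 : Ω ≠ ⊥ := by
    intro h
    have h1 : (fun p : (MIdx n k × MIdx n k) × Fin μ.dim => F₁ p.1 p.2) ∈ Ω := ⟨hF₁, hF₁W⟩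
    rw [h, Submodule.mem_bot] at h1
    exact hF₁0 (Matrix.ext fun x i => congrFun h1 (x, i))
  let τ : Equiv.Perm (Fin k) →*
      Matrix.unitaryGroup ((MIdx n k × MIdx n k) × Fin μ.dim) 𝕜 :=
    { toFun := fun σ => ⟨X.rep 1 σ ⊗ₖ (1 : Matrix (Fin μ.dim) (Fin μ.dim) 𝕜), by
        rw [Matrix.mem_unitaryGroup_iff, Matrix.star_eq_conjTranspose,
          Matrix.conjTranspose_kronecker, ← Matrix.mul_kronecker_mul, hX.rep_mul_conjTranspose,
          Matrix.conjTranspose_one, Matrix.one_mul, Matrix.one_kronecker_one]⟩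
      map_one' := Subtype.ext (by
        simp only [hX.rep_one, Matrix.one_kronecker_one, Matrix.UnitaryGroup.one_val])
      map_mul' := fun σ σ' => Subtype.ext (by
        rw [Matrix.UnitaryGroup.mul_val]
        have h := Matrix.mul_kronecker_mul (X.rep 1 σ) (X.rep 1 σ')
          (1 : Matrix (Fin μ.dim) (Fin μ.dim) 𝕜) (1 : Matrix (Fin μ.dim) (Fin μ.dim) 𝕜)
        rw [hX.rep_mul, Matrix.one_mul, one_mul] at h
        exact h) }
  have hΩinv : ∀ σ, ∀ φ ∈ Ω, (X.rep 1 σ ⊗ₖ (1 : Matrix (Fin μ.dim) (Fin μ.dim) 𝕜)) *ᵥ φ ∈ Ω := by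
    intro σ φ hφ
    refine ⟨fun g => ?_, fun v => ?_⟩
    · rw [toM_mulVec, ← Matrix.mul_assoc, hX.rep_mul, mul_one, one_mul, Matrix.mul_assoc, ← hφ.1,
        ← Matrix.mul_assoc, hX.rep_mul, mul_one, one_mul]
    · rw [toM_mulVec, ← Matrix.mulVec_mulVec]
      exact hWsrep _ _ _ (hφ.2 v)
  obtain ⟨μ', F₂, hF₂0, hF₂, hF₂W⟩ := exists_symDual τ hΩ0 hΩinv
  change ∀ σ, (X.rep 1 σ ⊗ₖ (1 : Matrix (Fin μ.dim) (Fin μ.dim) 𝕜)) * F₂ =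
    F₂ * SymDual.mat μ' σ at hF₂
  have hcol : ∀ j, (fun p => F₂ p j) ∈ Ω := fun j => by
    have := hF₂W (Pi.single j 1)
    rwa [Matrix.mulVec_single_one] at this
  refine ⟨⟨μ, μ', s⟩, Matrix.of fun x p => F₂ (x, p.1) p.2, ⟨fun g σ => ?_, ?_⟩, ?_, ?_⟩
  · have h1 : X.rep g σ = X.rep g 1 * X.rep 1 σ := by rw [hX.rep_mul, mul_one, one_mul]
    rw [h1]
    exact mul_eq_mul_kronecker (fun j => (hcol j).1 g) (hF₂ σ)
  · ext x p
    have h1 := ((hWs _).1 ((hcol p.2).2 (Pi.single p.1 1))).2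
    have h2 := congrFun h1 x
    rw [Matrix.mulVec_single_one] at h2
    rw [Matrix.mul_apply]
    exact h2
  · intro h
    exact hF₂0 (Matrix.ext fun x j => congrFun (congrFun h x.1) (x.2, j))
  · intro v
    have h1 : (Matrix.of fun x p => F₂ (x, p.1) p.2 :
        Matrix (MIdx n k × MIdx n k) (Fin μ.dim × Fin (SymDual.dim μ')) 𝕜) *ᵥ v =
        ∑ j, toM (fun p => F₂ p j) *ᵥ fun i => v (i, j) := by
      ext x
      simp [Matrix.mulVec, dotProduct, Fintype.sum_prod_type_right, toM, Finset.sum_apply]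
    rw [h1]
    exact Submodule.sum_mem _ fun j _ => ((hWs _).1 ((hcol j).2 _)).1

/-- By unitarity the adjoint of an intertwiner is an intertwiner in the opposite direction, so the
composite is one between irreducible tensor products. -/
theorem conjTranspose_mul_intertwines {b b' : X.Label} {F F'} (hF : F ∈ b.intertwiners)
    (hF' : F' ∈ b'.intertwiners) (g : X.group) (σ : Equiv.Perm (Fin k)) :
    (b.mu.mat g ⊗ₖ SymDual.mat b.mu' σ) * (Fᴴ * F') =
      (Fᴴ * F') * (b'.mu.mat g ⊗ₖ SymDual.mat b'.mu' σ) := by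
  have h1 : (b.mu.mat g ⊗ₖ SymDual.mat b.mu' σ) * (b.mu.mat g ⊗ₖ SymDual.mat b.mu' σ)ᴴ = 1 := by
    rw [Matrix.conjTranspose_kronecker, ← Matrix.mul_kronecker_mul]
    have h2 : b.mu.mat g * (b.mu.mat g)ᴴ = 1 := Matrix.mem_unitaryGroup_iff.1 (b.mu.rep.rho g).2
    rw [h2, SymDual.mat_mul_conjTranspose, Matrix.one_kronecker_one]
  have h4 : (b.mu.mat g ⊗ₖ SymDual.mat b.mu' σ) * Fᴴ = Fᴴ * X.rep g σ := by
    calc (b.mu.mat g ⊗ₖ SymDual.mat b.mu' σ) * Fᴴ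
        = (b.mu.mat g ⊗ₖ SymDual.mat b.mu' σ) * (X.rep g σ * F)ᴴ * X.rep g σ := by
          rw [Matrix.conjTranspose_mul, Matrix.mul_assoc, Matrix.mul_assoc,
            hX.conjTranspose_rep_mul, Matrix.mul_one]
      _ = Fᴴ * X.rep g σ := by
          rw [hF.1, Matrix.conjTranspose_mul, ← Matrix.mul_assoc, h1, Matrix.one_mul]
  rw [← Matrix.mul_assoc, h4, Matrix.mul_assoc, hF'.1, Matrix.mul_assoc]

/-- Labels that differ in μ or μ' are separated by Schur's lemma for the slices; labels that differ
only in s are separated as eigenvalues of the self-adjoint exchange. -/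
theorem conjTranspose_mul_eq_zero {b b' : X.Label} (hne : b ≠ b') {F F'}
    (hF : F ∈ b.intertwiners) (hF' : F' ∈ b'.intertwiners) : Fᴴ * F' = 0 := by
  have hcomm := hX.conjTranspose_mul_intertwines hF hF'
  by_cases hmu : b.mu = b'.mu
  · by_cases hmu' : b.mu' = b'.mu'
    · have hs : b.s ≠ b'.s := by
        intro h
        apply hne
        cases b; cases b'
        simp_all
      have h1 : ((b.s : ℤ) : 𝕜) • (Fᴴ * F') = ((b'.s : ℤ) : 𝕜) • (Fᴴ * F') := by
        have h2 : Fᴴ * X.swapMatrix = ((b.s : ℤ) : 𝕜) • Fᴴ := by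
          have := congrArg Matrix.conjTranspose hF.2
          rw [Matrix.conjTranspose_mul, hX.swap_conjTranspose, Matrix.conjTranspose_smul] at this
          rw [this]
          simp
        rw [← Matrix.smul_mul, ← h2, Matrix.mul_assoc, hF'.2, Matrix.mul_smul]
      have h3 : ((b.s : ℤ) : 𝕜) - ((b'.s : ℤ) : 𝕜) ≠ 0 := by
        rw [sub_ne_zero, Ne, Int.cast_inj, Units.val_inj]
        exact hs
      rw [← sub_eq_zero, ← sub_smul] at h1
      exact (smul_eq_zero.1 h1).resolve_left h3
    · ext ⟨i, j⟩ ⟨l, m⟩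
      have h := SymDual.intertwiner_eq_zero hmu' fun σ =>
        block_mul_of_one_kronecker (by
          have := hcomm 1 σ
          rw [Dual.mat, Dual.mat, coe_unitary_one, coe_unitary_one] at this
          exact this) i l
      exact congrFun (congrFun h j) m
  · ext ⟨i, j⟩ ⟨l, m⟩
    have h := Dual.intertwiner_eq_zero hmu fun g =>
      block_mul_of_kronecker_one (by
        have := hcomm g 1
        rw [SymDual.mat_one, SymDual.mat_one] at this
        exact this) j m
    exact congrFun (congrFun h i) l

/-- Schur's lemma for G makes the matrix a family z_{jm} δ_{il}, and for S_k a family y_{il} δ_{jm};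
a matrix of both forms is scalar. -/
theorem exists_conjTranspose_mul_eq_smul {b : X.Label} {F F'}
    (hF : F ∈ b.intertwiners) (hF' : F' ∈ b.intertwiners) : ∃ z : 𝕜, Fᴴ * F' = z • 1 := by
  have hcomm := hX.conjTranspose_mul_intertwines hF hF'
  have h1 : ∀ j m, ∃ z : 𝕜, (Matrix.of fun i l => (Fᴴ * F') (i, j) (l, m)) = z • 1 := fun j m =>
    hX.schur b.mu.rep _ fun g => block_mul_of_kronecker_one (by
        have := hcomm g 1
        rw [SymDual.mat_one] at this
        exact this) j m
  choose z hz using h1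
  have h2 : ∀ i l, ∃ y : 𝕜, (Matrix.of fun j m => (Fᴴ * F') (i, j) (l, m)) = y • 1 := fun i l =>
    hX.schur_perm (@Dual.rep 𝕜 _ (Equiv.Perm (Fin k)) _ ⊥ b.mu') _ fun σ => block_mul_of_one_kronecker (by
          have := hcomm 1 σ
          rw [Dual.mat, coe_unitary_one] at this
          exact this) i l
  choose y hy using h2
  let i₀ : Fin b.dim := ⟨0, b.mu.rep.dim_pos⟩
  refine ⟨y i₀ i₀, ?_⟩
  ext ⟨i, j⟩ ⟨l, m⟩
  have e1 := congrFun (congrFun (hz j m) i) l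
  have e2 := congrFun (congrFun (hz j m) i₀) i₀
  have e3 := congrFun (congrFun (hy i₀ i₀) j) m
  simp only [Matrix.of_apply, Matrix.smul_apply, Matrix.one_apply, smul_eq_mul] at e1 e2 e3
  rw [e1, Matrix.smul_apply, ← Matrix.one_kronecker_one, Matrix.kroneckerMap_apply, smul_eq_mul,
    Matrix.one_apply, Matrix.one_apply]
  simp only [if_true, mul_one] at e2
  rw [← e2, e3]
  ring

/-- An orthonormal basis of the space of intertwiners. -/
theorem exists_orthonormal_intertwiners (b : X.Label) :
    ∃ Φ : Fin b.mult → Matrix (MIdx n k × MIdx n k) (Fin b.dim × Fin b.dim') 𝕜,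
      (∀ c, Φ c ∈ b.intertwiners) ∧ (∀ c c', (Φ c)ᴴ * Φ c' = if c = c' then 1 else 0) ∧
      ∀ F ∈ b.intertwiners, ∃ a : Fin b.mult → 𝕜, F = ∑ c, a c • Φ c := by
  let p₀ : Fin b.dim × Fin b.dim' :=
    (⟨0, b.mu.rep.dim_pos⟩, ⟨0, SymDual.dim_pos b.mu'⟩)
  -- Since Fᴴ F' is scalar, the scalar can be read off from one column. An orthonormal basis for the
  -- resulting inner product consists of isometries with mutually orthogonal ranges.
  let col : b.intertwiners →ₗ[𝕜] EuclideanSpace 𝕜 (MIdx n k × MIdx n k) :=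
    { toFun := fun F => WithLp.toLp 2 fun x =>
        (F : Matrix (MIdx n k × MIdx n k) (Fin b.dim × Fin b.dim') 𝕜) x p₀
      map_add' := fun _ _ => rfl
      map_smul' := fun _ _ => rfl }
  have hinner : ∀ F F' : b.intertwiners, F.1ᴴ * F'.1 =
      (inner 𝕜 (col F) (col F')) • (1 : Matrix (Fin b.dim × Fin b.dim') (Fin b.dim × Fin b.dim') 𝕜) := by
    intro F F'
    obtain ⟨z, hz⟩ := hX.exists_conjTranspose_mul_eq_smul F.2 F'.2
    have h1 : z = inner 𝕜 (col F) (col F') := by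
      have h2 := congrFun (congrFun hz p₀) p₀
      rw [Matrix.mul_apply, Matrix.smul_apply, Matrix.one_apply_eq, smul_eq_mul, mul_one] at h2
      rw [← h2]
      rw [PiLp.inner_apply]
      exact Finset.sum_congr rfl fun x _ => mul_comm _ _
    rw [← h1]
    exact hz
  have hinj : Function.Injective col := by
    rw [← LinearMap.ker_eq_bot, eq_bot_iff]
    intro F hF
    rw [LinearMap.mem_ker] at hF
    have h1 := hinner F F
    rw [hF, inner_zero_left, zero_smul, Matrix.conjTranspose_mul_self_eq_zero] at h1
    exact Subtype.ext h1
  let e := LinearEquiv.ofInjective col hinj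
  have hfr : Module.finrank 𝕜 (LinearMap.range col) = b.mult := e.finrank_eq.symm
  let B := (stdOrthonormalBasis 𝕜 (LinearMap.range col)).reindex (finCongr hfr)
  have hcol : ∀ z, col (e.symm z) = z := fun z =>
    congrArg Subtype.val (e.apply_symm_apply z)
  refine ⟨fun c => (e.symm (B c)).1, fun c => (e.symm (B c)).2, fun c c' => ?_,
    fun F hF => ?_⟩
  · rw [hinner, hcol, hcol, ← Submodule.coe_inner, orthonormal_iff_ite.1 B.orthonormal c c']
    split_ifs <;> simp
  · refine ⟨fun c => inner 𝕜 (B c) (e ⟨F, hF⟩), ?_⟩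
    let f := b.intertwiners.subtype ∘ₗ e.symm.toLinearMap
    have h1 := congrArg f (B.sum_repr' (e ⟨F, hF⟩))
    have h2 : f (e ⟨F, hF⟩) = F := congrArg Subtype.val (e.symm_apply_apply ⟨F, hF⟩)
    rw [h2, map_sum] at h1
    simp only [map_smul] at h1
    exact h1.symm

end IsUnitaryModel

end MatrixModel

/-! ### Block diagonal matrices with finite total index set -/

section BlockDiagonal

variable {𝕜 : Type} [RCLike 𝕜] {o : Type} [DecidableEq o] {β : o → Type}
  [Fintype (Σ b, β b)] [∀ b, Fintype (β b)]

-- The set of labels may be infinite; only its total space of indices is finite. Sums therefore run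
-- over the total space and are cut down to one fibre.
omit [DecidableEq o] in
theorem sum_sigma_eq_sum_fiber (f : (Σ b, β b) → 𝕜) (b : o) (h : ∀ p, p.1 ≠ b → f p = 0) :
    ∑ p, f p = ∑ q : β b, f ⟨b, q⟩ := by
  refine (Fintype.sum_of_injective (Sigma.mk b) sigma_mk_injective _ _ ?_ fun _ => rfl).symm
  rintro ⟨b', q⟩ hp
  refine h _ ?_
  rintro rfl
  exact hp ⟨q, rfl⟩

theorem mul_blockDiagonal'_apply {ι : Type} (U : Matrix ι (Σ b, β b) 𝕜)
    (N : (b : o) → Matrix (β b) (β b) 𝕜) (x : ι) (b : o) (q : β b) :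
    (U * Matrix.blockDiagonal' N) x ⟨b, q⟩ = ∑ p : β b, U x ⟨b, p⟩ * N b p q := by
  rw [Matrix.mul_apply, sum_sigma_eq_sum_fiber _ b]
  · simp only [Matrix.blockDiagonal'_apply_eq]
  · rintro ⟨b', p⟩ hne
    rw [Matrix.blockDiagonal'_apply_ne _ _ _ hne, mul_zero]

theorem blockDiagonal'_mul_blockDiagonal' (M N : (b : o) → Matrix (β b) (β b) 𝕜) :
    Matrix.blockDiagonal' M * Matrix.blockDiagonal' N =
      Matrix.blockDiagonal' fun b => M b * N b := by
  ext ⟨b', p⟩ ⟨b, q⟩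
  rw [mul_blockDiagonal'_apply]
  by_cases h : b' = b
  · subst h
    simp only [Matrix.blockDiagonal'_apply_eq, Matrix.mul_apply]
  · rw [Matrix.blockDiagonal'_apply_ne _ _ _ h]
    exact Finset.sum_eq_zero fun r _ => by rw [Matrix.blockDiagonal'_apply_ne _ _ _ h, zero_mul]

end BlockDiagonal

open scoped MatrixOrder in
theorem exists_conjTranspose_mul_self {𝕜 : Type} [RCLike 𝕜] {n : Type} [Fintype n] [DecidableEq n]
    {M : Matrix n n 𝕜} (hM : M.PosDef) : ∃ N : Matrix n n 𝕜, M = Nᴴ * N :=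
  CStarAlgebra.nonneg_iff_eq_star_mul_self.1 (Matrix.nonneg_iff_posSemidef.2 hM.posSemidef)

/-! ### Block matrices and the commutant -/

namespace MatrixModel

variable {𝕜 : Type} [RCLike 𝕜] {n : Type} [Fintype n] [DecidableEq n] {k : ℕ}
  {X : MatrixModel 𝕜 n k}

section BlockMatrix

variable [Fintype X.BlockIndex]

theorem blockMatrix_mul (M N : (b : X.Label) → Matrix (Fin b.mult) (Fin b.mult) 𝕜) :
    X.blockMatrix M * X.blockMatrix N = X.blockMatrix fun b => M b * N b := by
  rw [blockMatrix, blockMatrix, blockDiagonal'_mul_blockDiagonal']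
  simp only [← Matrix.mul_kronecker_mul, Matrix.one_mul]
  rfl

omit [Fintype X.BlockIndex] in
theorem blockMatrix_one : (X.blockMatrix fun _ => 1) = 1 := by
  simp only [blockMatrix, Matrix.one_kronecker_one]
  exact Matrix.blockDiagonal'_one

omit [Fintype X.BlockIndex] in
theorem blockMatrix_conjTranspose (M : (b : X.Label) → Matrix (Fin b.mult) (Fin b.mult) 𝕜) :
    (X.blockMatrix M)ᴴ = X.blockMatrix fun b => (M b)ᴴ := by
  simp only [blockMatrix, Matrix.blockDiagonal'_conjTranspose, Matrix.conjTranspose_kronecker,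
    Matrix.conjTranspose_one]

/-- Factoring each block as Nᴴ N with N invertible factors the whole matrix in the same way. -/
theorem blockMatrix_posDef {M : (b : X.Label) → Matrix (Fin b.mult) (Fin b.mult) 𝕜}
    (hM : ∀ b, (M b).PosDef) : (X.blockMatrix M).PosDef := by
  have h : ∀ b, ∃ N N' : Matrix (Fin b.mult) (Fin b.mult) 𝕜, M b = Nᴴ * N ∧ N' * N = 1 := by
    intro b
    obtain ⟨N, hMN⟩ := exists_conjTranspose_mul_self (hM b)
    have hu : IsUnit N.det := by
      have h1 := (hM b).isUnit
      rw [Matrix.isUnit_iff_isUnit_det, hMN, Matrix.det_mul] at h1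
      exact isUnit_of_mul_isUnit_right h1
    exact ⟨N, N⁻¹, hMN, Matrix.nonsing_inv_mul _ hu⟩
  choose N N' hN hN' using h
  have h1 : X.blockMatrix M = (X.blockMatrix N)ᴴ * X.blockMatrix N := by
    rw [blockMatrix_conjTranspose, blockMatrix_mul]
    congr 1
    funext b
    exact hN b
  have h2 : X.blockMatrix N' * X.blockMatrix N = 1 := by
    rw [blockMatrix_mul]
    simp only [hN']
    exact blockMatrix_one
  rw [h1]
  refine Matrix.PosDef.conjTranspose_mul_self _ fun v w hvw => ?_
  have := congrArg (X.blockMatrix N' *ᵥ ·) hvw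
  simpa only [Matrix.mulVec_mulVec, h2, Matrix.one_mulVec] using this

-- Fixing one basis vector of μ ⊗ μ' exhibits the block as a principal submatrix.
omit [Fintype X.BlockIndex] in
theorem posDef_of_blockMatrix {M : (b : X.Label) → Matrix (Fin b.mult) (Fin b.mult) 𝕜}
    (hM : (X.blockMatrix M).PosDef) (b : X.Label) : (M b).PosDef := by
  let q : Fin b.dim × Fin b.dim' := (⟨0, b.mu.rep.dim_pos⟩, ⟨0, SymDual.dim_pos b.mu'⟩)
  have h := hM.submatrix (e := fun c : Fin b.mult => (⟨b, (c, q)⟩ : X.BlockIndex)) (by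
    intro c c' h
    simpa using h)
  convert h using 1
  ext c c'
  simp [blockMatrix, Matrix.blockDiagonal'_apply_eq]

theorem blockMatrix_mul_comm (M : (b : X.Label) → Matrix (Fin b.mult) (Fin b.mult) 𝕜)
    (g : X.group) (σ : Equiv.Perm (Fin k)) :
    X.blockMatrix M * Matrix.blockDiagonal' (fun b : X.Label =>
      (1 : Matrix (Fin b.mult) (Fin b.mult) 𝕜) ⊗ₖ (b.mu.mat g ⊗ₖ SymDual.mat b.mu' σ)) =
    Matrix.blockDiagonal' (fun b : X.Label =>
      (1 : Matrix (Fin b.mult) (Fin b.mult) 𝕜) ⊗ₖ (b.mu.mat g ⊗ₖ SymDual.mat b.mu' σ)) *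
    X.blockMatrix M := by
  rw [blockMatrix, blockDiagonal'_mul_blockDiagonal', blockDiagonal'_mul_blockDiagonal']
  simp only [← Matrix.mul_kronecker_mul, Matrix.one_mul, Matrix.mul_one]

end BlockMatrix

namespace IsUnitaryModel

variable (hX : X.IsUnitaryModel)
include hX

/-- The decomposition into irreducible representations, together with the commutant. -/
theorem exists_decomposition : ∃ (_ : Fintype X.BlockIndex)
    (U : Matrix (MIdx n k × MIdx n k) X.BlockIndex 𝕜),
    U * Uᴴ = 1 ∧ Uᴴ * U = 1 ∧
    (∀ g σ, X.rep g σ * U = U * Matrix.blockDiagonal' fun b : X.Label =>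
      (1 : Matrix (Fin b.mult) (Fin b.mult) 𝕜) ⊗ₖ (b.mu.mat g ⊗ₖ SymDual.mat b.mu' σ)) ∧
    X.swapMatrix * U = U * Matrix.blockDiagonal' (fun b : X.Label => ((b.s : ℤ) : 𝕜) •
        (1 : Matrix (Fin b.mult × (Fin b.dim × Fin b.dim'))
          (Fin b.mult × (Fin b.dim × Fin b.dim')) 𝕜)) ∧
    ∀ Δ : Matrix (MIdx n k × MIdx n k) (MIdx n k × MIdx n k) 𝕜,
      (∀ g σ, X.rep g σ * Δ = Δ * X.rep g σ) → X.swapMatrix * Δ = Δ * X.swapMatrix →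
      ∃ M, Δ * U = U * X.blockMatrix M := by
  choose Φ hΦmem hΦorth hΦspan using hX.exists_orthonormal_intertwiners
  let U : Matrix (MIdx n k × MIdx n k) X.BlockIndex 𝕜 := Matrix.of fun x p => Φ p.1 p.2.1 x p.2.2
  have hU : ∀ x b c q, U x ⟨b, (c, q)⟩ = Φ b c x q := fun _ _ _ _ => rfl
  have hUU : Uᴴ * U = 1 := by
    ext ⟨b, c, q⟩ ⟨b', c', q'⟩
    have h1 : (Uᴴ * U) ⟨b, c, q⟩ ⟨b', c', q'⟩ = ((Φ b c)ᴴ * Φ b' c') q q' := rfl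
    rw [h1]
    by_cases hb : b = b'
    · subst hb
      rw [hΦorth]
      by_cases hc : c = c'
      · subst hc
        by_cases hq : q = q'
        · subst hq
          simp
        · rw [if_pos rfl, Matrix.one_apply_ne hq, Matrix.one_apply_ne]
          intro h
          exact hq (by simpa using h)
      · rw [if_neg hc, Matrix.zero_apply, Matrix.one_apply_ne]
        intro h
        have := sigma_mk_injective h
        exact hc (congrArg Prod.fst this)
    · rw [hX.conjTranspose_mul_eq_zero hb (hΦmem b c) (hΦmem b' c'), Matrix.zero_apply,
        Matrix.one_apply_ne]
      intro h
      exact hb (congrArg Sigma.fst h)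
  -- Orthonormal columns of a finite-dimensional space are finite in number; this is the finiteness
  -- of the set of nonzero multiplicities.
  have hfin : Finite X.BlockIndex := by
    have horth : Orthonormal 𝕜 fun p : X.BlockIndex =>
        (WithLp.toLp 2 fun x => U x p : EuclideanSpace 𝕜 (MIdx n k × MIdx n k)) := by
      rw [orthonormal_iff_ite]
      intro p p'
      have h1 := congrFun (congrFun hUU p) p'
      rw [Matrix.mul_apply, Matrix.one_apply] at h1
      rw [← h1, PiLp.inner_apply]
      exact Finset.sum_congr rfl fun x _ => mul_comm _ _
    exact horth.linearIndependent.finite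
  let inst : Fintype X.BlockIndex := Fintype.ofFinite _
  have hrepU : ∀ g σ, X.rep g σ * U = U * Matrix.blockDiagonal' fun b : X.Label =>
      (1 : Matrix (Fin b.mult) (Fin b.mult) 𝕜) ⊗ₖ (b.mu.mat g ⊗ₖ SymDual.mat b.mu' σ) := by
    intro g σ
    ext x ⟨b, c, q⟩
    have h1 : (X.rep g σ * U) x ⟨b, c, q⟩ = (X.rep g σ * Φ b c) x q := rfl
    rw [mul_blockDiagonal'_apply, h1, (hΦmem b c).1, Matrix.mul_apply,
      Fintype.sum_prod_type (α₁ := Fin b.mult), Finset.sum_eq_single c]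
    · refine Finset.sum_congr rfl fun p _ => ?_
      rw [hU, Matrix.kroneckerMap_apply (f := (· * ·)) (A := 1), Matrix.one_apply_eq, one_mul]
    · intro c' _ hc'
      refine Finset.sum_eq_zero fun p _ => ?_
      rw [Matrix.kroneckerMap_apply (f := (· * ·)) (A := 1), Matrix.one_apply_ne hc', zero_mul, mul_zero]
    · intro h; exact absurd (Finset.mem_univ c) h
  have hswapU : X.swapMatrix * U =
      U * Matrix.blockDiagonal' (fun b : X.Label => ((b.s : ℤ) : 𝕜) •
        (1 : Matrix (Fin b.mult × (Fin b.dim × Fin b.dim'))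
          (Fin b.mult × (Fin b.dim × Fin b.dim')) 𝕜)) := by
    ext x ⟨b, c, q⟩
    have h1 : (X.swapMatrix * U) x ⟨b, c, q⟩ = (X.swapMatrix * Φ b c) x q := rfl
    rw [h1, (hΦmem b c).2]
    refine Eq.trans ?_ (mul_blockDiagonal'_apply U (fun b : X.Label => ((b.s : ℤ) : 𝕜) •
      (1 : Matrix (Fin b.mult × (Fin b.dim × Fin b.dim')) _ 𝕜)) x b (c, q)).symm
    simp [Matrix.one_apply, hU, mul_comm]
  -- If A and its adjoint both preserve the range of U, then A commutes with the projection U Uᴴ.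
  have hcommU : ∀ A B : Matrix (MIdx n k × MIdx n k) (MIdx n k × MIdx n k) 𝕜, ∀ D D' : Matrix X.BlockIndex X.BlockIndex 𝕜,
      Aᴴ = B → A * U = U * D → B * U = U * D' → A * (U * Uᴴ) = (U * Uᴴ) * A := by
    intro A B D D' hAB hA hB
    have h1 : Uᴴ * A = D'ᴴ * Uᴴ := by
      have := congrArg Matrix.conjTranspose hB
      rwa [Matrix.conjTranspose_mul, Matrix.conjTranspose_mul, ← hAB,
        Matrix.conjTranspose_conjTranspose] at this
    have h2 : D = D'ᴴ := by
      calc D = Uᴴ * (A * U) := by rw [hA, ← Matrix.mul_assoc, hUU, Matrix.one_mul]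
        _ = D'ᴴ := by rw [← Matrix.mul_assoc, h1, Matrix.mul_assoc, hUU, Matrix.mul_one]
    rw [← Matrix.mul_assoc, hA, Matrix.mul_assoc U Uᴴ, h1, h2, Matrix.mul_assoc]
  -- Otherwise the complement of the range of U is a nonzero invariant subspace and contains the
  -- image of a nonzero intertwiner F. This F is orthogonal to every Φ b c, yet a combination of
  -- them.
  have hUU' : U * Uᴴ = 1 := by
    by_contra hne
    let W : Submodule 𝕜 (MIdx n k × MIdx n k → 𝕜) := LinearMap.range (1 - U * Uᴴ).mulVecLin
    have hW : W ≠ ⊥ := by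
      intro h
      rw [LinearMap.range_eq_bot] at h
      apply hne
      have h1 : 1 - U * Uᴴ = 0 := Matrix.ext_of_mulVec_single fun i => by
        rw [Matrix.zero_mulVec]
        exact LinearMap.congr_fun h _
      exact (sub_eq_zero.1 h1).symm
    have hinv : ∀ A, A * (U * Uᴴ) = (U * Uᴴ) * A → ∀ v ∈ W, A *ᵥ v ∈ W := by
      rintro A hA _ ⟨v, rfl⟩
      refine ⟨A *ᵥ v, ?_⟩
      simp only [Matrix.mulVecLin_apply, Matrix.mulVec_mulVec, Matrix.sub_mul, Matrix.mul_sub,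
        Matrix.one_mul, Matrix.mul_one, hA]
    obtain ⟨b, F, hF, hF0, hFW⟩ := hX.exists_intertwiner hW
      (fun g σ => hinv _ (hcommU _ _ _ _ (hX.rep_conjTranspose g σ) (hrepU g σ) (hrepU g⁻¹ σ⁻¹)))
      (hinv _ (hcommU _ _ _ _ hX.swap_conjTranspose hswapU hswapU))
    have h1 : Uᴴ * F = 0 := by
      refine Matrix.ext_of_mulVec_single fun i => ?_
      obtain ⟨w, hw⟩ := hFW (Pi.single i 1)
      rw [← Matrix.mulVec_mulVec, ← hw, Matrix.mulVecLin_apply, Matrix.mulVec_mulVec,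
        Matrix.mul_sub, Matrix.mul_one, ← Matrix.mul_assoc, hUU, Matrix.one_mul, sub_self,
        Matrix.zero_mulVec, Matrix.zero_mulVec]
    have h2 : ∀ c, (Φ b c)ᴴ * F = 0 := by
      intro c
      ext q q'
      exact congrFun (congrFun h1 ⟨b, c, q⟩) q'
    obtain ⟨a, ha⟩ := hΦspan b F hF
    apply hF0
    rw [ha]
    refine Finset.sum_eq_zero fun c _ => ?_
    have h3 := h2 c
    rw [ha, Matrix.mul_sum, Finset.sum_eq_single c] at h3
    · rw [Matrix.mul_smul, hΦorth, if_pos rfl] at h3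
      let q : Fin b.dim × Fin b.dim' := (⟨0, b.mu.rep.dim_pos⟩, ⟨0, SymDual.dim_pos b.mu'⟩)
      have h4 := congrFun (congrFun h3 q) q
      rw [Matrix.smul_apply, Matrix.one_apply_eq, smul_eq_mul, mul_one, Matrix.zero_apply] at h4
      rw [h4, zero_smul]
    · intro c' _ hc'
      rw [Matrix.mul_smul, hΦorth, if_neg hc'.symm, smul_zero]
    · intro h; exact absurd (Finset.mem_univ c) h
  refine ⟨inst, U, hUU', hUU, hrepU, hswapU, fun Δ hΔ hΔs => ?_⟩
  -- Δ maps intertwiners to intertwiners; the block M b is its matrix in the basis Φ b.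
  have hΔmem : ∀ b c, Δ * Φ b c ∈ b.intertwiners := by
    intro b c
    refine ⟨fun g σ => ?_, ?_⟩
    · rw [← Matrix.mul_assoc, hΔ, Matrix.mul_assoc, (hΦmem b c).1, Matrix.mul_assoc]
    · rw [← Matrix.mul_assoc, hΔs, Matrix.mul_assoc, (hΦmem b c).2, Matrix.mul_smul]
  have hcoef : ∀ b c, ∃ a : Fin b.mult → 𝕜, Δ * Φ b c = ∑ c', a c' • Φ b c' := fun b c =>
    hΦspan b _ (hΔmem b c)
  choose a ha using hcoef
  refine ⟨fun b => Matrix.of fun c' c => a b c c', ?_⟩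
  ext x ⟨b, c, q⟩
  have h1 : (Δ * U) x ⟨b, c, q⟩ = (Δ * Φ b c) x q := rfl
  rw [blockMatrix, mul_blockDiagonal'_apply, h1, ha, Matrix.sum_apply,
    Fintype.sum_prod_type (α₁ := Fin b.mult)]
  refine Finset.sum_congr rfl fun c' _ => ?_
  rw [Matrix.one_kronecker_one]
  simp [Matrix.one_apply, hU, mul_comm]

end IsUnitaryModel

end MatrixModel

/-! ### Gaussian densities -/

theorem map_withDensity_comp {α β : Type} [MeasurableSpace α] [MeasurableSpace β] (μ : Measure α)
    {L : α → β} (hL : Measurable L) {f : β → ENNReal} (hf : Measurable f) :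
    (μ.withDensity (f ∘ L)).map L = (μ.map L).withDensity f := by
  ext s hs
  rw [Measure.map_apply hL hs, withDensity_apply _ (hL hs), withDensity_apply _ hs,
    setLIntegral_map hs hf hL]
  rfl

instance matrixBorelSpace {m n 𝕜 : Type} [Countable m] [Countable n] [RCLike 𝕜] :
    BorelSpace (Matrix m n 𝕜) :=
  inferInstanceAs (BorelSpace (m → n → 𝕜))

section QuadraticForm

variable {𝕜 : Type} [RCLike 𝕜] {ι : Type} [Fintype ι]

/-- The quadratic form `H ↦ vec(H)† Δ vec(H)`. -/
noncomputable def quadForm (Δ : Matrix (ι × ι) (ι × ι) 𝕜) (H : Matrix ι ι 𝕜) : ℝ :=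
  RCLike.re (star H.vec ⬝ᵥ (Δ *ᵥ H.vec))

omit [Fintype ι] in
theorem continuous_vec : Continuous fun H : Matrix ι ι 𝕜 => H.vec :=
  continuous_pi fun p => continuous_id.matrix_elem p.2 p.1

theorem continuous_quadForm (Δ : Matrix (ι × ι) (ι × ι) 𝕜) : Continuous (quadForm Δ) :=
  RCLike.continuous_re.comp (Continuous.dotProduct continuous_vec.star
    (continuous_const.matrix_mulVec continuous_vec))

theorem quadForm_zero (Δ : Matrix (ι × ι) (ι × ι) 𝕜) : quadForm Δ 0 = 0 := by
  simp [quadForm]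

theorem quadForm_smul (Δ : Matrix (ι × ι) (ι × ι) 𝕜) (r : ℝ) (H : Matrix ι ι 𝕜) :
    quadForm Δ (r • H) = r ^ 2 * quadForm Δ H := by
  have h : (r • H).vec = (r : 𝕜) • H.vec := by
    ext p
    simp [Matrix.vec, RCLike.real_smul_eq_coe_mul]
  rw [quadForm, quadForm, h, Matrix.mulVec_smul, star_smul, smul_dotProduct, dotProduct_smul,
    smul_smul, smul_eq_mul]
  have : star (r : 𝕜) * (r : 𝕜) = ((r ^ 2 : ℝ) : 𝕜) := by
    rw [RCLike.star_def, RCLike.conj_ofReal]; push_cast; ring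
  rw [this, RCLike.re_ofReal_mul]

theorem quadForm_pos {Δ : Matrix (ι × ι) (ι × ι) 𝕜} (hΔ : Δ.PosDef) {H : Matrix ι ι 𝕜}
    (hH : H ≠ 0) : 0 < quadForm Δ H := by
  have h : H.vec ≠ 0 := by rwa [Ne, Matrix.vec_eq_zero_iff]
  exact (RCLike.pos_iff.1 (hΔ.dotProduct_mulVec_pos h)).1

end QuadraticForm

namespace MatrixModel

variable {𝕜 : Type} [RCLike 𝕜] {n : Type} [Fintype n] [DecidableEq n] {k : ℕ}
  {X : MatrixModel 𝕜 n k}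

variable (X) in
/-- The coordinates on the space of random matrices that define Lebesgue measure. -/
noncomputable def coord :
    (Fin (Module.finrank ℝ X.space) → ℝ) →ₗ[ℝ] Matrix (MIdx n k) (MIdx n k) 𝕜 :=
  X.space.subtype ∘ₗ (Module.finBasis ℝ X.space).equivFun.symm.toLinearMap

theorem coord_mem (x) : X.coord x ∈ X.space :=
  ((Module.finBasis ℝ X.space).equivFun.symm x).2

theorem exists_coord_eq {H} (hH : H ∈ X.space) : ∃ x, X.coord x = H :=
  ⟨(Module.finBasis ℝ X.space).equivFun ⟨H, hH⟩,
    congrArg Subtype.val ((Module.finBasis ℝ X.space).equivFun.symm_apply_apply ⟨H, hH⟩)⟩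

theorem coord_injective : Function.Injective X.coord := by
  intro x y h
  exact (Module.finBasis ℝ X.space).equivFun.symm.injective (Subtype.ext h)

theorem continuous_coord : Continuous X.coord :=
  X.coord.continuous_of_finiteDimensional

theorem lebesgue_eq : X.lebesgue = (volume : Measure (Fin (Module.finrank ℝ X.space) → ℝ)).map
    X.coord := rfl

theorem measurableEmbedding_coord : MeasurableEmbedding X.coord :=
  continuous_coord.measurableEmbedding coord_injective

theorem ae_lebesgue {p : Matrix (MIdx n k) (MIdx n k) 𝕜 → Prop} (h : ∀ H ∈ X.space, p H) :
    ∀ᵐ H ∂X.lebesgue, p H := by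
  rw [lebesgue_eq, measurableEmbedding_coord.ae_map_iff]
  exact Filter.Eventually.of_forall fun x => h _ (coord_mem x)

/-- The density of a Gaussian. -/
noncomputable def gaussianDensity (c : ℝ)
    (Δ : Matrix (MIdx n k × MIdx n k) (MIdx n k × MIdx n k) 𝕜)
    (H : Matrix (MIdx n k) (MIdx n k) 𝕜) : ENNReal :=
  ENNReal.ofReal (c * Real.exp (-(1 / 2) * quadForm Δ H))

omit [DecidableEq n] in
theorem continuous_density (c : ℝ) (Δ : Matrix (MIdx n k × MIdx n k) (MIdx n k × MIdx n k) 𝕜) :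
    Continuous (gaussianDensity c Δ) :=
  ENNReal.continuous_ofReal.comp (continuous_const.mul
    (Real.continuous_exp.comp (continuous_const.mul (continuous_quadForm Δ))))

theorem hasGaussianDensity_iff {P : Measure (Matrix (MIdx n k) (MIdx n k) 𝕜)}
    {Δ : Matrix (MIdx n k × MIdx n k) (MIdx n k × MIdx n k) 𝕜} :
    X.HasGaussianDensity P Δ ↔ ∃ c : ℝ, 0 < c ∧ P = X.lebesgue.withDensity (gaussianDensity c Δ) :=
  Iff.rfl

theorem HasGaussianDensity.congr {P : Measure (Matrix (MIdx n k) (MIdx n k) 𝕜)}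
    {Δ Δ' : Matrix (MIdx n k × MIdx n k) (MIdx n k × MIdx n k) 𝕜} (h : X.HasGaussianDensity P Δ)
    (hq : ∀ H ∈ X.space, quadForm Δ' H = quadForm Δ H) : X.HasGaussianDensity P Δ' := by
  rw [hasGaussianDensity_iff] at h ⊢
  obtain ⟨c, hc, rfl⟩ := h
  refine ⟨c, hc, withDensity_congr_ae (ae_lebesgue fun H hH => ?_)⟩
  rw [gaussianDensity, gaussianDensity, hq H hH]

/-- In coordinates, continuous densities that agree almost everywhere agree everywhere. Their values
at 0 identify the constants, and injectivity of exp identifies the forms. -/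
theorem HasGaussianDensity.quadForm_eq {P : Measure (Matrix (MIdx n k) (MIdx n k) 𝕜)}
    {Δ Δ' : Matrix (MIdx n k × MIdx n k) (MIdx n k × MIdx n k) 𝕜} (h : X.HasGaussianDensity P Δ)
    (h' : X.HasGaussianDensity P Δ') : ∀ H ∈ X.space, quadForm Δ H = quadForm Δ' H := by
  rw [hasGaussianDensity_iff] at h h'
  obtain ⟨c, hc, rfl⟩ := h
  obtain ⟨c', hc', he⟩ := h'
  have h1 : (volume.withDensity (gaussianDensity c Δ ∘ X.coord)).map X.coord =
      (volume.withDensity (gaussianDensity c' Δ' ∘ X.coord)).map X.coord := by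
    rw [map_withDensity_comp _ continuous_coord.measurable (continuous_density c Δ).measurable,
      map_withDensity_comp _ continuous_coord.measurable (continuous_density c' Δ').measurable,
      ← lebesgue_eq, he]
  have h2 : volume.withDensity (gaussianDensity c Δ ∘ X.coord) =
      volume.withDensity (gaussianDensity c' Δ' ∘ X.coord) := by
    have := congrArg (Measure.comap X.coord) h1
    rwa [measurableEmbedding_coord.comap_map, measurableEmbedding_coord.comap_map] at this
  have hcont := (continuous_density c Δ).comp (continuous_coord (X := X))
  have hcont' := (continuous_density c' Δ').comp (continuous_coord (X := X))
  rw [withDensity_eq_iff_of_sigmaFinite hcont.measurable.aemeasurable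
    hcont'.measurable.aemeasurable, Continuous.ae_eq_iff_eq _ hcont hcont'] at h2
  have h3 : ∀ H ∈ X.space, c * Real.exp (-(1 / 2) * quadForm Δ H) =
      c' * Real.exp (-(1 / 2) * quadForm Δ' H) := by
    intro H hH
    obtain ⟨x, rfl⟩ := exists_coord_eq hH
    have := congrFun h2 x
    simp only [Function.comp_apply, gaussianDensity] at this
    rwa [ENNReal.ofReal_eq_ofReal_iff (by positivity) (by positivity)] at this
  have h0 : c = c' := by
    simpa [quadForm_zero] using h3 0 (zero_mem _)
  intro H hH
  have h4 := h3 H hH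
  rw [← h0] at h4
  have h5 := Real.exp_injective (mul_left_cancel₀ hc.ne' h4)
  linarith

/-- The image of a Gaussian measure under a linear automorphism of the space of random
matrices. -/
theorem HasGaussianDensity.map {P : Measure (Matrix (MIdx n k) (MIdx n k) 𝕜)}
    {Δ Δ' : Matrix (MIdx n k × MIdx n k) (MIdx n k × MIdx n k) 𝕜} (h : X.HasGaussianDensity P Δ)
    {L : Matrix (MIdx n k) (MIdx n k) 𝕜 →ₗ[𝕜] Matrix (MIdx n k) (MIdx n k) 𝕜} (hL : Continuous L)
    (hinj : Function.Injective L) (hspace : ∀ H ∈ X.space, L H ∈ X.space)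
    (hq : ∀ H ∈ X.space, quadForm Δ' (L H) = quadForm Δ H) :
    X.HasGaussianDensity (P.map L) Δ' := by
  rw [hasGaussianDensity_iff] at h ⊢
  obtain ⟨c, hc, rfl⟩ := h
  let E := (Module.finBasis ℝ X.space).equivFun
  let L' : X.space →ₗ[ℝ] X.space := (L.restrictScalars ℝ).restrict hspace
  let T : (Fin (Module.finrank ℝ X.space) → ℝ) →ₗ[ℝ] (Fin (Module.finrank ℝ X.space) → ℝ) :=
    E.toLinearMap ∘ₗ L' ∘ₗ E.symm.toLinearMap
  have hT : ∀ x, X.coord (T x) = L (X.coord x) := fun x =>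
    congrArg Subtype.val (E.symm_apply_apply (L' (E.symm x)))
  have hTinj : Function.Injective T := by
    intro x y hxy
    apply coord_injective (X := X)
    apply hinj
    rw [← hT, ← hT, hxy]
  have hdet : LinearMap.det T ≠ 0 := by
    have := LinearEquiv.isUnit_det' (LinearEquiv.ofInjectiveEndo T hTinj)
    exact this.ne_zero
  -- The factor by which the change of variables scales Lebesgue measure; it is absorbed into the
  -- normalizing constant.
  set r : ℝ := |(LinearMap.det T)⁻¹| with hr
  have hr0 : 0 < r := abs_pos.2 (inv_ne_zero hdet)
  have hleb : X.lebesgue.map L = ENNReal.ofReal r • X.lebesgue := by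
    rw [lebesgue_eq, Measure.map_map hL.measurable continuous_coord.measurable]
    have h1 : L ∘ X.coord = X.coord ∘ T := funext fun x => (hT x).symm
    have hTm : Measurable T := T.continuous_of_finiteDimensional.measurable
    rw [h1, ← Measure.map_map continuous_coord.measurable hTm,
      Measure.map_linearMap_addHaar_eq_smul_addHaar _ hdet, Measure.map_smul]
  refine ⟨r * c, mul_pos hr0 hc, ?_⟩
  have h2 : X.lebesgue.withDensity (gaussianDensity c Δ) =
      X.lebesgue.withDensity (gaussianDensity c Δ' ∘ L) := by
    refine withDensity_congr_ae (ae_lebesgue fun H hH => ?_)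
    rw [Function.comp_apply, gaussianDensity, gaussianDensity, hq H hH]
  have h3 : gaussianDensity (r * c) Δ' = ENNReal.ofReal r • gaussianDensity c Δ' := by
    funext H
    rw [Pi.smul_apply, smul_eq_mul, gaussianDensity, gaussianDensity, mul_assoc,
      ENNReal.ofReal_mul hr0.le]
  rw [h2, map_withDensity_comp _ hL.measurable (continuous_density c Δ').measurable, hleb, h3,
    withDensity_smul _ (continuous_density c Δ').measurable, withDensity_smul_measure]

/-- The normalizing constant is determined by total mass one. -/
theorem HasGaussianDensity.unique {P P' : Measure (Matrix (MIdx n k) (MIdx n k) 𝕜)}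
    [IsProbabilityMeasure P] [IsProbabilityMeasure P']
    {Δ : Matrix (MIdx n k × MIdx n k) (MIdx n k × MIdx n k) 𝕜} (h : X.HasGaussianDensity P Δ)
    (h' : X.HasGaussianDensity P' Δ) : P = P' := by
  rw [hasGaussianDensity_iff] at h h'
  obtain ⟨c, hc, hP⟩ := h
  obtain ⟨c', hc', hP'⟩ := h'
  have h1 : ∀ c : ℝ, 0 < c → X.lebesgue.withDensity (gaussianDensity c Δ) =
      ENNReal.ofReal c • X.lebesgue.withDensity (gaussianDensity 1 Δ) := by
    intro c hc
    rw [← withDensity_smul _ (continuous_density 1 Δ).measurable]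
    congr 1
    funext H
    rw [Pi.smul_apply, smul_eq_mul, gaussianDensity, gaussianDensity, one_mul,
      ENNReal.ofReal_mul hc.le]
  rw [h1 c hc] at hP
  rw [h1 c' hc'] at hP'
  have h2 := congrArg (fun μ : Measure _ => μ Set.univ) hP
  have h2' := congrArg (fun μ : Measure _ => μ Set.univ) hP'
  simp only [measure_univ, Measure.smul_apply, smul_eq_mul] at h2 h2'
  rw [hP, hP', ENNReal.eq_inv_of_mul_eq_one_left h2.symm,
    ENNReal.eq_inv_of_mul_eq_one_left h2'.symm]

/-- By compactness the form attains a positive minimum on the unit sphere of the coordinates, and it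
is homogeneous. The sphere is empty exactly when 𝓗 = 0. -/
theorem exists_pos_mul_norm_sq_le {Δ : Matrix (MIdx n k × MIdx n k) (MIdx n k × MIdx n k) 𝕜}
    (hΔ : Δ.PosDef) : ∃ ε : ℝ, 0 < ε ∧ ∀ x, ε * ‖x‖ ^ 2 ≤ quadForm Δ (X.coord x) := by
  have hcont : Continuous fun x => quadForm Δ (X.coord x) :=
    (continuous_quadForm Δ).comp continuous_coord
  rcases (Metric.sphere (0 : Fin (Module.finrank ℝ X.space) → ℝ) 1).eq_empty_or_nonempty with h | h
  · refine ⟨1, one_pos, fun x => ?_⟩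
    have hx : x = 0 := by
      by_contra hx
      have : ‖x‖⁻¹ • x ∈ Metric.sphere (0 : Fin (Module.finrank ℝ X.space) → ℝ) 1 := by
        rw [mem_sphere_zero_iff_norm, norm_smul, norm_inv, norm_norm,
          inv_mul_cancel₀ (norm_ne_zero_iff.2 hx)]
      rw [h] at this
      exact this
    rw [hx, map_zero, quadForm_zero]
    simp
  · obtain ⟨x₀, hx₀, hmin⟩ := (isCompact_sphere _ _).exists_isMinOn h hcont.continuousOn
    have hx0 : x₀ ≠ 0 := by
      rintro rfl
      simp at hx₀
    refine ⟨quadForm Δ (X.coord x₀), quadForm_pos hΔ fun h0 => hx0 ?_, fun x => ?_⟩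
    · exact coord_injective (h0.trans (map_zero _).symm)
    · by_cases hx : x = 0
      · rw [hx, map_zero, quadForm_zero]; simp
      · have hn : ‖x‖ ≠ 0 := norm_ne_zero_iff.2 hx
        have h1 : ‖x‖⁻¹ • x ∈ Metric.sphere (0 : Fin (Module.finrank ℝ X.space) → ℝ) 1 := by
          rw [mem_sphere_zero_iff_norm, norm_smul, norm_inv, norm_norm, inv_mul_cancel₀ hn]
        have h2 := hmin h1
        have h3 : quadForm Δ (X.coord x) = ‖x‖ ^ 2 * quadForm Δ (X.coord (‖x‖⁻¹ • x)) := by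
          rw [← quadForm_smul, ← map_smul, smul_inv_smul₀ hn]
        rw [h3, mul_comm]
        exact mul_le_mul_of_nonneg_left h2 (sq_nonneg _)

theorem exists_hasGaussianDensity {Δ : Matrix (MIdx n k × MIdx n k) (MIdx n k × MIdx n k) 𝕜}
    (hΔ : Δ.PosDef) : ∃ P : Measure (Matrix (MIdx n k) (MIdx n k) 𝕜),
      IsProbabilityMeasure P ∧ X.HasGaussianDensity P Δ := by
  obtain ⟨ε, hε, hle⟩ := exists_pos_mul_norm_sq_le (X := X) hΔ
  set D := Module.finrank ℝ X.space
  have hcont : Continuous fun x => Real.exp (-(1 / 2) * quadForm Δ (X.coord x)) :=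
    Real.continuous_exp.comp (continuous_const.mul ((continuous_quadForm Δ).comp continuous_coord))
  -- The coordinates carry the sup norm, so ∑ x_i² ≤ D ‖x‖². The 2 comes from the ½ in the exponent,
  -- and D + 1 avoids dividing by 0 when 𝓗 = 0. A product of one-dimensional Gaussians then
  -- dominates the density.
  set δ : ℝ := ε / (2 * (D + 1)) with hδ
  have hδ0 : 0 < δ := by positivity
  have hint : Integrable fun x : Fin D → ℝ => Real.exp (-(1 / 2) * quadForm Δ (X.coord x)) := by
    have h1 : Integrable fun x : Fin D → ℝ => ∏ i, Real.exp (-δ * x i ^ 2) :=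
      Integrable.fintype_prod (f := fun _ y => Real.exp (-δ * y ^ 2)) (μ := fun _ => volume)
        fun _ => integrable_exp_neg_mul_sq hδ0
    refine h1.mono' hcont.aestronglyMeasurable (Filter.Eventually.of_forall fun x => ?_)
    rw [Real.norm_eq_abs, abs_of_pos (Real.exp_pos _), ← Real.exp_sum, Real.exp_le_exp]
    have h2 : ∑ i, x i ^ 2 ≤ D * ‖x‖ ^ 2 := by
      calc ∑ i, x i ^ 2 ≤ ∑ _i : Fin D, ‖x‖ ^ 2 := by
            refine Finset.sum_le_sum fun i _ => ?_
            rw [← sq_abs]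
            exact pow_le_pow_left₀ (abs_nonneg _) (norm_le_pi_norm x i) 2
        _ = D * ‖x‖ ^ 2 := by simp
    have h3 : δ * ∑ i, x i ^ 2 ≤ 1 / 2 * (ε * ‖x‖ ^ 2) := by
      calc δ * ∑ i, x i ^ 2 ≤ δ * ((D + 1) * ‖x‖ ^ 2) := by
            refine mul_le_mul_of_nonneg_left (h2.trans ?_) hδ0.le
            nlinarith [sq_nonneg ‖x‖]
        _ = 1 / 2 * (ε * ‖x‖ ^ 2) := by rw [hδ]; field_simp
    rw [← Finset.mul_sum]
    linarith [hle x]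
  set I := ∫ x : Fin D → ℝ, Real.exp (-(1 / 2) * quadForm Δ (X.coord x)) with hI
  have hI0 : 0 < I := by
    rw [hI, integral_pos_iff_support_of_nonneg (fun x => (Real.exp_pos _).le) hint]
    have : Function.support (fun x : Fin D → ℝ => Real.exp (-(1 / 2) * quadForm Δ (X.coord x))) =
        Set.univ := Set.eq_univ_of_forall fun x => (Real.exp_pos _).ne'
    rw [this]
    exact isOpen_univ.measure_pos _ Set.univ_nonempty
  refine ⟨X.lebesgue.withDensity (gaussianDensity I⁻¹ Δ), ⟨?_⟩,
    hasGaussianDensity_iff.2 ⟨I⁻¹, inv_pos.2 hI0, rfl⟩⟩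
  rw [withDensity_apply _ MeasurableSet.univ, Measure.restrict_univ, lebesgue_eq,
    lintegral_map (continuous_density _ _).measurable continuous_coord.measurable]
  simp only [gaussianDensity]
  rw [← ofReal_integral_eq_lintegral_ofReal (hint.const_mul _)
    (Filter.Eventually.of_forall fun x => by positivity), integral_const_mul, ← hI,
    inv_mul_cancel₀ hI0.ne', ENNReal.ofReal_one]

end MatrixModel

/-! ### Hermitian operators preserving a real subspace -/

section Hermitian

variable {𝕜 : Type} [RCLike 𝕜] {ι : Type} [Fintype ι]

theorem re_dotProduct_comm {A : Matrix (ι × ι) (ι × ι) 𝕜} (hA : Aᴴ = A) (v w : ι × ι → 𝕜) :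
    RCLike.re (star v ⬝ᵥ (A *ᵥ w)) = RCLike.re (star w ⬝ᵥ (A *ᵥ v)) := by
  have h : star (star v ⬝ᵥ (A *ᵥ w)) = star w ⬝ᵥ (A *ᵥ v) := by
    rw [Matrix.star_dotProduct, star_star, Matrix.star_mulVec, hA, ← Matrix.dotProduct_mulVec]
  rw [← h, RCLike.star_def, RCLike.conj_re]

/-- A Hermitian operator that preserves a real subspace and whose quadratic form vanishes there
vanishes on the subspace. -/
theorem mulVec_vec_eq_zero {S : Submodule ℝ (Matrix ι ι 𝕜)} {A : Matrix (ι × ι) (ι × ι) 𝕜}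
    (hA : Aᴴ = A) (hS : ∀ H ∈ S, ∃ H' ∈ S, A *ᵥ H.vec = H'.vec) (hq : ∀ H ∈ S, quadForm A H = 0) :
    ∀ H ∈ S, A *ᵥ H.vec = 0 := by
  intro H hH
  obtain ⟨H', hH', e⟩ := hS H hH
  -- Polarization of the vanishing form at H and H' = A H: the cross term is twice ‖A H‖².
  have h1 := hq _ (add_mem hH hH')
  have h2 := hq H hH
  have h3 := hq H' hH'
  rw [quadForm] at h1 h2 h3
  rw [Matrix.vec_add, Matrix.mulVec_add, star_add, add_dotProduct, dotProduct_add, dotProduct_add,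
    map_add, map_add, map_add, h2, h3, re_dotProduct_comm hA, e] at h1
  have h4 : RCLike.re (star H'.vec ⬝ᵥ H'.vec) = 0 := by linarith
  by_contra hne
  rw [e] at hne
  have h5 := RCLike.pos_iff.1 (Matrix.dotProduct_star_self_pos_iff.2 hne)
  rw [dotProduct_comm] at h5
  rw [dotProduct_comm] at h4
  exact h5.1.ne' h4

theorem quadForm_sub (A B : Matrix (ι × ι) (ι × ι) 𝕜) (H : Matrix ι ι 𝕜) :
    quadForm (A - B) H = quadForm A H - quadForm B H := by
  rw [quadForm, quadForm, quadForm, Matrix.sub_mulVec, dotProduct_sub, map_sub]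

theorem quadForm_conjTranspose_mul_mul {R A : Matrix (ι × ι) (ι × ι) 𝕜} {H H' : Matrix ι ι 𝕜}
    (h : R *ᵥ H.vec = H'.vec) : quadForm (Rᴴ * A * R) H = quadForm A H' := by
  rw [quadForm, quadForm, ← h, Matrix.star_mulVec, ← Matrix.dotProduct_mulVec, Matrix.mulVec_mulVec,
    Matrix.mulVec_mulVec]

theorem exists_vec_eq {ι R : Type} (v : ι × ι → R) : ∃ H : Matrix ι ι R, H.vec = v :=
  ⟨Matrix.of fun i j => v (j, i), rfl⟩

end Hermitian

section TensorPower

variable {𝕜 : Type} [RCLike 𝕜] {n : Type} [Fintype n] [DecidableEq n] {k : ℕ}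

omit [Fintype n] in
theorem tensorPow_one : tensorPow k (1 : Matrix n n 𝕜) = 1 := by
  ext i j
  simp only [tensorPow, Matrix.of_apply, Matrix.one_apply]
  rw [Finset.prod_ite_zero]
  simp [funext_iff]

omit [Fintype n] in
theorem permOp_one : permOp (1 : Equiv.Perm (Fin k)) = (1 : Matrix (MIdx n k) (MIdx n k) 𝕜) := by
  ext i j
  rfl

end TensorPower

/-! ### Invariant precision matrices and the characterization -/

namespace MatrixModel

variable {𝕜 : Type} [RCLike 𝕜] {n : Type} [Fintype n] [DecidableEq n] {k : ℕ}

/-- The orthogonal projection onto the eigenspace of the exchange of factors that contains the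
space of random matrices. -/
noncomputable def signProj (X : MatrixModel 𝕜 n k) :
    Matrix (MIdx n k × MIdx n k) (MIdx n k × MIdx n k) 𝕜 :=
  (2 : 𝕜)⁻¹ • (1 + ((X.sign : ℤ) : 𝕜) • X.swapMatrix)

/-- The properties of the symmetry types on which the characterization of the ensembles rests. -/
structure IsEnsembleModel (X : MatrixModel 𝕜 n k) : Prop extends X.IsUnitaryModel where
  act_mem : ∀ (g : X.group) (σ : Equiv.Perm (Fin k)), ∀ H ∈ X.space,
    X.act (tensorPow k ((g : Matrix.unitaryGroup n 𝕜) : Matrix n n 𝕜) * permOp σ) H ∈ X.space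
  swap_eq : ∀ H ∈ X.space, X.swap H = ((X.sign : ℤ) : 𝕜) • H
  mem_span : ∀ H, X.swap H = ((X.sign : ℤ) : 𝕜) • H →
    H ∈ Submodule.span 𝕜 (X.space : Set (Matrix (MIdx n k) (MIdx n k) 𝕜))
  -- The compression of Δ to the eigenspace need not carry 𝓗 to itself when 𝓗 is only a real form of
  -- it; the compression of Δ' does.
  exists_posDef : ∀ Δ : Matrix (MIdx n k × MIdx n k) (MIdx n k × MIdx n k) 𝕜, Δ.PosDef →
    ∃ Δ' : Matrix (MIdx n k × MIdx n k) (MIdx n k × MIdx n k) 𝕜, Δ'.PosDef ∧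
      (∀ H ∈ X.space, quadForm Δ' H = quadForm Δ H) ∧
      ∀ H ∈ X.space, ∃ H' ∈ X.space, X.signProj *ᵥ (Δ' *ᵥ H.vec) = H'.vec

variable {X : MatrixModel 𝕜 n k}

theorem rep_mulVec_vec (g : X.group) (σ : Equiv.Perm (Fin k)) (H : Matrix (MIdx n k) (MIdx n k) 𝕜) :
    X.rep g σ *ᵥ H.vec = (X.act (tensorPow k ((g : Matrix.unitaryGroup n 𝕜) : Matrix n n 𝕜) *
      permOp σ) H).vec :=
  superMatrix_mulVec_vec _ _

theorem swapMatrix_mulVec_vec (H : Matrix (MIdx n k) (MIdx n k) 𝕜) :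
    X.swapMatrix *ᵥ H.vec = (X.swap H).vec :=
  superMatrix_mulVec_vec _ _

theorem continuous_act (A : Matrix (MIdx n k) (MIdx n k) 𝕜) : Continuous (X.act A) :=
  (continuous_const.matrix_mul continuous_id).matrix_mul continuous_const

theorem sign_mul_sign (s : ℤˣ) : ((s : ℤ) : 𝕜) * ((s : ℤ) : 𝕜) = 1 := by
  rw [← Int.cast_mul, ← Units.val_mul, Int.units_mul_self, Units.val_one, Int.cast_one]

theorem signProj_mul_swap : X.signProj * X.swapMatrix = X.swapMatrix * X.signProj := by
  rw [signProj, Matrix.smul_mul, Matrix.mul_smul, Matrix.add_mul, Matrix.mul_add, Matrix.smul_mul,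
    Matrix.mul_smul, Matrix.one_mul, Matrix.mul_one]

namespace IsUnitaryModel

variable (hX : X.IsUnitaryModel)
include hX

theorem act_injective (g : X.group) (σ : Equiv.Perm (Fin k)) : Function.Injective
    (X.act (tensorPow k ((g : Matrix.unitaryGroup n 𝕜) : Matrix n n 𝕜) * permOp σ)) := by
  intro H H' h
  have h1 : X.rep g σ *ᵥ H.vec = X.rep g σ *ᵥ H'.vec := by
    rw [rep_mulVec_vec, rep_mulVec_vec, h]
  have h2 := congrArg ((X.rep g σ)ᴴ *ᵥ ·) h1
  simp only [Matrix.mulVec_mulVec, hX.conjTranspose_rep_mul, Matrix.one_mulVec] at h2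
  exact Matrix.vec_inj.1 h2

theorem swapMatrix_mul_signProj : X.swapMatrix * X.signProj = ((X.sign : ℤ) : 𝕜) • X.signProj := by
  rw [signProj, Matrix.mul_smul, smul_comm ((X.sign : ℤ) : 𝕜) (2 : 𝕜)⁻¹, Matrix.mul_add,
    Matrix.mul_smul, hX.swap_mul_swap, Matrix.mul_one, smul_add ((X.sign : ℤ) : 𝕜),
    smul_smul ((X.sign : ℤ) : 𝕜), sign_mul_sign, one_smul, add_comm]

theorem signProj_conjTranspose : X.signProjᴴ = X.signProj := by
  simp only [signProj, Matrix.conjTranspose_smul, Matrix.conjTranspose_add, hX.swap_conjTranspose,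
    Matrix.conjTranspose_one]
  simp

theorem signProj_mul_signProj : X.signProj * X.signProj = X.signProj := by
  conv_lhs => lhs; rw [signProj]
  rw [Matrix.smul_mul, Matrix.add_mul, Matrix.one_mul, Matrix.smul_mul,
    hX.swapMatrix_mul_signProj, smul_smul, sign_mul_sign, one_smul, ← two_smul 𝕜, smul_smul,
    inv_mul_cancel₀ two_ne_zero, one_smul]

theorem signProj_mul_rep (g : X.group) (σ : Equiv.Perm (Fin k)) :
    X.signProj * X.rep g σ = X.rep g σ * X.signProj := by
  rw [signProj, Matrix.smul_mul, Matrix.mul_smul, Matrix.add_mul, Matrix.mul_add, Matrix.smul_mul,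
    Matrix.mul_smul, hX.swap_mul_rep, Matrix.one_mul, Matrix.mul_one]

end IsUnitaryModel

theorem one_sub_mul_one_sub {ι : Type} [Fintype ι] [DecidableEq ι] {P : Matrix ι ι 𝕜}
    (hPP : P * P = P) : (1 - P) * (1 - P) = 1 - P := by
  rw [Matrix.mul_sub, Matrix.mul_one, Matrix.sub_mul, Matrix.one_mul, hPP, sub_self, sub_zero]

/-- Compressing a positive definite matrix to the range of a projection and extending it by the
identity. -/
theorem posDef_compression {ι : Type} [Fintype ι] [DecidableEq ι] {Δ P : Matrix ι ι 𝕜}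
    (hΔ : Δ.PosDef) (hP : Pᴴ = P) (hPP : P * P = P) : (P * Δ * P + (1 - P)).PosDef := by
  have h1 : (P * Δ * P).PosSemidef := by
    have := hΔ.posSemidef.conjTranspose_mul_mul_same P
    rwa [hP] at this
  have hQ : (1 - P) = (1 - P)ᴴ * (1 - P) := by
    rw [Matrix.conjTranspose_sub, Matrix.conjTranspose_one, hP, one_sub_mul_one_sub hPP]
  have h2 : (1 - P).PosSemidef := by
    rw [hQ]; exact Matrix.posSemidef_conjTranspose_mul_self _
  refine (h1.add h2).posDef_iff_isUnit.2 ?_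
  rw [← Matrix.mulVec_injective_iff_isUnit]
  refine (injective_iff_map_eq_zero (Matrix.mulVecLin (P * Δ * P + (1 - P)))).2 fun v hv => ?_
  rw [Matrix.mulVecLin_apply, Matrix.add_mulVec] at hv
  -- Applying 1 - P to the kernel equation leaves (1 - P) v = 0; then Δ pairs v with itself to 0.
  have h3 : P *ᵥ v = v := by
    have := congrArg ((1 - P) *ᵥ ·) hv
    simp only [Matrix.mulVec_add, Matrix.mulVec_mulVec, Matrix.mulVec_zero, ← Matrix.mul_assoc] at this
    rw [Matrix.sub_mul, Matrix.one_mul, hPP, sub_self, Matrix.zero_mul, Matrix.zero_mul,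
      Matrix.zero_mulVec, zero_add] at this
    rw [one_sub_mul_one_sub hPP, Matrix.sub_mulVec, Matrix.one_mulVec, sub_eq_zero] at this
    exact this.symm
  by_contra hne
  have h5 := hΔ.dotProduct_mulVec_pos hne
  have h6 : star v ⬝ᵥ (Δ *ᵥ v) = star v ⬝ᵥ ((P * Δ * P) *ᵥ v + (1 - P) *ᵥ v) := by
    rw [Matrix.sub_mulVec, Matrix.one_mulVec, h3, sub_self, add_zero, ← Matrix.mulVec_mulVec, h3,
      ← Matrix.mulVec_mulVec, Matrix.dotProduct_mulVec _ P]
    have : star v ᵥ* P = star v := by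
      conv_rhs => rw [← h3, Matrix.star_mulVec, hP]
    rw [this]
  rw [h6, hv, dotProduct_zero] at h5
  exact lt_irrefl _ h5

namespace IsEnsembleModel

variable (hX : X.IsEnsembleModel)
include hX

theorem signProj_mulVec_vec {H : Matrix (MIdx n k) (MIdx n k) 𝕜} (hH : H ∈ X.space) :
    X.signProj *ᵥ H.vec = H.vec := by
  rw [signProj, Matrix.smul_mulVec, Matrix.add_mulVec, Matrix.one_mulVec, Matrix.smul_mulVec,
    swapMatrix_mulVec_vec, hX.swap_eq H hH, Matrix.vec_smul, smul_smul, sign_mul_sign, one_smul,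
    ← two_smul 𝕜, smul_smul, inv_mul_cancel₀ two_ne_zero, one_smul]

/-- By 𝕜-linearity A vanishes on the span of 𝓗, which contains the range of `signProj`. -/
theorem mul_signProj_eq_zero {A : Matrix (MIdx n k × MIdx n k) (MIdx n k × MIdx n k) 𝕜}
    (hA : ∀ H ∈ X.space, A *ᵥ H.vec = 0) : A * X.signProj = 0 := by
  refine Matrix.ext_of_mulVec_single fun i => ?_
  rw [← Matrix.mulVec_mulVec, Matrix.zero_mulVec]
  obtain ⟨H, hH⟩ := exists_vec_eq (X.signProj *ᵥ Pi.single i 1)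
  have h1 : X.swap H = ((X.sign : ℤ) : 𝕜) • H := by
    apply Matrix.vec_inj.1
    rw [← swapMatrix_mulVec_vec, Matrix.vec_smul, hH, Matrix.mulVec_mulVec,
      hX.swapMatrix_mul_signProj, Matrix.smul_mulVec]
  rw [← hH]
  refine Submodule.span_induction (p := fun H _ => A *ᵥ H.vec = 0) ?_ ?_ ?_ ?_ (hX.mem_span H h1)
  · exact fun H hH => hA H hH
  · rw [Matrix.vec_zero, Matrix.mulVec_zero]
  · intro H H' _ _ h h'
    rw [Matrix.vec_add, Matrix.mulVec_add, h, h', add_zero]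
  · intro c H _ h
    rw [Matrix.vec_smul, Matrix.mulVec_smul, h, smul_zero]

/-- Two Hermitian matrices that preserve the space of random matrices and define the same
quadratic form there agree on the eigenspace of the exchange of factors. -/
theorem sub_mul_signProj {A B : Matrix (MIdx n k × MIdx n k) (MIdx n k × MIdx n k) 𝕜}
    (hA : Aᴴ = A) (hB : Bᴴ = B)
    (hAS : ∀ H ∈ X.space, ∃ H' ∈ X.space, A *ᵥ H.vec = H'.vec)
    (hBS : ∀ H ∈ X.space, ∃ H' ∈ X.space, B *ᵥ H.vec = H'.vec)
    (hq : ∀ H ∈ X.space, quadForm A H = quadForm B H) : (A - B) * X.signProj = 0 := by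
  refine hX.mul_signProj_eq_zero (mulVec_vec_eq_zero ?_ ?_ ?_)
  · rw [Matrix.conjTranspose_sub, hA, hB]
  · intro H hH
    obtain ⟨H₁, h₁, e₁⟩ := hAS H hH
    obtain ⟨H₂, h₂, e₂⟩ := hBS H hH
    exact ⟨H₁ - H₂, sub_mem h₁ h₂, by rw [Matrix.sub_mulVec, e₁, e₂, Matrix.vec_sub]⟩
  · intro H hH
    rw [quadForm_sub, hq H hH, sub_self]

/-- The image of P under the action of R = `X.rep g σ` has precision matrix R Δ Rᴴ; as the image is
P, the two forms agree on 𝓗. -/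
theorem quadForm_act {P : Measure (Matrix (MIdx n k) (MIdx n k) 𝕜)}
    {Δ : Matrix (MIdx n k × MIdx n k) (MIdx n k × MIdx n k) 𝕜} (hP : X.HasGaussianDensity P Δ)
    {g : X.group} {σ : Equiv.Perm (Fin k)}
    (hinv : P.map (X.act (tensorPow k ((g : Matrix.unitaryGroup n 𝕜) : Matrix n n 𝕜) *
      permOp σ)) = P) : ∀ H ∈ X.space, quadForm Δ
    (X.act (tensorPow k ((g : Matrix.unitaryGroup n 𝕜) : Matrix n n 𝕜) * permOp σ) H) =
      quadForm Δ H := by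
  set L := X.act (tensorPow k ((g : Matrix.unitaryGroup n 𝕜) : Matrix n n 𝕜) * permOp σ) with hL
  have hq : ∀ H ∈ X.space, quadForm ((X.rep g σ)ᴴᴴ * Δ * (X.rep g σ)ᴴ) (L H) = quadForm Δ H := by
    intro H _
    refine quadForm_conjTranspose_mul_mul ?_
    rw [hL, ← rep_mulVec_vec, Matrix.mulVec_mulVec, hX.conjTranspose_rep_mul, Matrix.one_mulVec]
  have h1 := hP.map (continuous_act _) (hX.act_injective g σ) (hX.act_mem g σ) hq
  rw [← hL, hinv] at h1
  intro H hH
  rw [← hq H hH]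
  exact hP.quadForm_eq h1 _ (hX.act_mem g σ H hH)

/-- The image measure has the same form as P, and a Gaussian probability measure is determined by
its form. -/
theorem map_act_eq {P : Measure (Matrix (MIdx n k) (MIdx n k) 𝕜)} [IsProbabilityMeasure P]
    {Δ : Matrix (MIdx n k × MIdx n k) (MIdx n k × MIdx n k) 𝕜} (hP : X.HasGaussianDensity P Δ)
    {g : X.group} {σ : Equiv.Perm (Fin k)} (hΔ : X.rep g σ * Δ = Δ * X.rep g σ) :
    P.map (X.act (tensorPow k ((g : Matrix.unitaryGroup n 𝕜) : Matrix n n 𝕜) * permOp σ)) = P := by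
  have hq : ∀ H ∈ X.space, quadForm Δ
      (X.act (tensorPow k ((g : Matrix.unitaryGroup n 𝕜) : Matrix n n 𝕜) * permOp σ) H) =
      quadForm Δ H := by
    intro H _
    rw [← quadForm_conjTranspose_mul_mul (rep_mulVec_vec g σ H), Matrix.mul_assoc, ← hΔ,
      ← Matrix.mul_assoc, hX.conjTranspose_rep_mul, Matrix.one_mul]
  have h1 := hP.map (continuous_act _) (hX.act_injective g σ) (hX.act_mem g σ) hq
  have : IsProbabilityMeasure (P.map (X.act (tensorPow k
      ((g : Matrix.unitaryGroup n 𝕜) : Matrix n n 𝕜) * permOp σ))) :=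
    Measure.isProbabilityMeasure_map (continuous_act _).measurable.aemeasurable
  exact h1.unique hP

/-- The precision matrix of an ensemble can be chosen to commute with the representation and to
preserve the space of random matrices. -/
theorem exists_invariant_precision {P : Measure (Matrix (MIdx n k) (MIdx n k) 𝕜)}
    (hP : X.IsKFoldGaussian P) :
    ∃ Δ : Matrix (MIdx n k × MIdx n k) (MIdx n k × MIdx n k) 𝕜, Δ.PosDef ∧
      (∀ g σ, X.rep g σ * Δ = Δ * X.rep g σ) ∧ X.swapMatrix * Δ = Δ * X.swapMatrix ∧
      (∀ H ∈ X.space, ∃ H' ∈ X.space, Δ *ᵥ H.vec = H'.vec) ∧ X.HasGaussianDensity P Δ := by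
  obtain ⟨Δ, hΔ, hPΔ⟩ := hP.gaussian
  obtain ⟨Δ', hΔ', hq, hS⟩ := hX.exists_posDef Δ hΔ
  have hPP := hX.signProj_mul_signProj
  set Δ₁ := X.signProj * Δ' * X.signProj + (1 - X.signProj) with hΔ₁
  have hpos : Δ₁.PosDef := posDef_compression hΔ' hX.signProj_conjTranspose hPP
  have hvec : ∀ H ∈ X.space, Δ₁ *ᵥ H.vec = X.signProj *ᵥ (Δ' *ᵥ H.vec) := by
    intro H hH
    rw [hΔ₁, Matrix.add_mulVec, Matrix.sub_mulVec, Matrix.one_mulVec, ← Matrix.mulVec_mulVec,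
      hX.signProj_mulVec_vec hH, sub_self, add_zero, Matrix.mulVec_mulVec]
  have hspace : ∀ H ∈ X.space, ∃ H' ∈ X.space, Δ₁ *ᵥ H.vec = H'.vec := by
    intro H hH
    rw [hvec H hH]
    exact hS H hH
  have hq₁ : ∀ H ∈ X.space, quadForm Δ₁ H = quadForm Δ H := by
    intro H hH
    rw [← hq H hH, quadForm, quadForm, hvec H hH, Matrix.dotProduct_mulVec]
    have : star H.vec ᵥ* X.signProj = star H.vec := by
      conv_rhs => rw [← hX.signProj_mulVec_vec hH, Matrix.star_mulVec, hX.signProj_conjTranspose]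
    rw [this]
  have hPΔ₁ := hPΔ.congr hq₁
  -- On the eigenspace, Rᴴ Δ₁ R and Δ₁ agree by `sub_mul_signProj`, as both preserve 𝓗 and have the
  -- same form there. On the complement Δ₁ is the identity and R preserves it.
  have hcomm : ∀ (g : X.group) (σ : Equiv.Perm (Fin k)),
      P.map (X.act (tensorPow k ((g : Matrix.unitaryGroup n 𝕜) : Matrix n n 𝕜) * permOp σ)) = P →
      X.rep g σ * Δ₁ = Δ₁ * X.rep g σ := by
    intro g σ hinv
    have hqa := hX.quadForm_act hPΔ₁ hinv
    have h1 : ((X.rep g σ)ᴴ * Δ₁ * X.rep g σ - Δ₁) * X.signProj = 0 := by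
      refine hX.sub_mul_signProj ?_ hpos.1 ?_ hspace ?_
      · rw [Matrix.conjTranspose_mul, Matrix.conjTranspose_mul, Matrix.conjTranspose_conjTranspose,
          hpos.1, Matrix.mul_assoc]
      · intro H hH
        obtain ⟨H', hH', e⟩ := hspace _ (hX.act_mem g σ H hH)
        refine ⟨_, hX.act_mem g⁻¹ σ⁻¹ H' hH', ?_⟩
        rw [← Matrix.mulVec_mulVec, rep_mulVec_vec, ← Matrix.mulVec_mulVec, e, hX.rep_conjTranspose,
          rep_mulVec_vec]
      · intro H hH
        rw [quadForm_conjTranspose_mul_mul (rep_mulVec_vec g σ H), hqa H hH]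
    have h2 : Δ₁ * (1 - X.signProj) = 1 - X.signProj := by
      rw [hΔ₁, Matrix.add_mul, Matrix.mul_sub, Matrix.mul_assoc _ X.signProj X.signProj, hPP,
        Matrix.mul_one, sub_self, zero_add, one_sub_mul_one_sub hPP]
    have h3 : ((X.rep g σ)ᴴ * Δ₁ * X.rep g σ - Δ₁) * (1 - X.signProj) = 0 := by
      have h4 : X.rep g σ * (1 - X.signProj) = (1 - X.signProj) * X.rep g σ := by
        rw [Matrix.mul_sub, Matrix.sub_mul, hX.signProj_mul_rep, Matrix.mul_one, Matrix.one_mul]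
      rw [Matrix.sub_mul, h2, Matrix.mul_assoc, h4, ← Matrix.mul_assoc, Matrix.mul_assoc _ Δ₁, h2,
        Matrix.mul_assoc, ← h4, ← Matrix.mul_assoc, hX.conjTranspose_rep_mul, Matrix.one_mul,
        sub_self]
    have h5 : (X.rep g σ)ᴴ * Δ₁ * X.rep g σ = Δ₁ := by
      rw [Matrix.mul_sub, h1, sub_zero, Matrix.mul_one, sub_eq_zero] at h3
      exact h3
    calc X.rep g σ * Δ₁ = X.rep g σ * ((X.rep g σ)ᴴ * Δ₁ * X.rep g σ) := by rw [h5]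
      _ = Δ₁ * X.rep g σ := by
        rw [← Matrix.mul_assoc, ← Matrix.mul_assoc, hX.rep_mul_conjTranspose, Matrix.one_mul]
  refine ⟨Δ₁, hpos, fun g σ => ?_, ?_, hspace, hPΔ₁⟩
  -- The two invariances in the definition concern (g, 1) and (1, σ) separately; their product is
  -- (g, σ).
  · have h1 := hcomm g 1 (by rw [permOp_one, mul_one]; exact hP.map_tensorPow g g.2)
    have h2 := hcomm 1 σ (by
      rw [Subgroup.coe_one, Matrix.UnitaryGroup.one_val, tensorPow_one, one_mul]
      exact hP.map_permOp σ)
    have h3 : X.rep g σ = X.rep g 1 * X.rep 1 σ := by rw [hX.rep_mul, mul_one, one_mul]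
    rw [h3, Matrix.mul_assoc, h2, ← Matrix.mul_assoc, h1, Matrix.mul_assoc]
  · have h1 : X.swapMatrix * (X.signProj * Δ' * X.signProj) =
        X.signProj * Δ' * X.signProj * X.swapMatrix := by
      rw [Matrix.mul_assoc _ X.signProj X.swapMatrix, signProj_mul_swap,
        hX.swapMatrix_mul_signProj, ← Matrix.mul_assoc, ← Matrix.mul_assoc,
        hX.swapMatrix_mul_signProj, Matrix.smul_mul, Matrix.smul_mul, Matrix.mul_smul]
    rw [hΔ₁, Matrix.mul_add, Matrix.add_mul, h1, Matrix.mul_sub, Matrix.sub_mul,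
      signProj_mul_swap, Matrix.mul_one, Matrix.one_mul]

theorem characterization : ∃ (_ : Fintype X.BlockIndex)
    (U : Matrix (MIdx n k × MIdx n k) X.BlockIndex 𝕜),
    U * Uᴴ = 1 ∧ Uᴴ * U = 1 ∧
    (∀ (g : X.group) (σ : Equiv.Perm (Fin k)),
      Uᴴ * X.rep g σ * U = Matrix.blockDiagonal' fun b : X.Label =>
        (1 : Matrix (Fin b.mult) (Fin b.mult) 𝕜) ⊗ₖ (b.mu.mat g ⊗ₖ SymDual.mat b.mu' σ)) ∧
    Uᴴ * X.swapMatrix * U = Matrix.blockDiagonal' (fun b : X.Label => ((b.s : ℤ) : 𝕜) • 1) ∧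
    (∀ P : Measure (Matrix (MIdx n k) (MIdx n k) 𝕜), X.IsKFoldGaussian P →
      ∃ M : (b : X.Label) → Matrix (Fin b.mult) (Fin b.mult) 𝕜,
        ((∀ b, (M b).PosDef) ∧
          (∀ H ∈ X.space, ∃ H' ∈ X.space, (U * X.blockMatrix M * Uᴴ) *ᵥ H.vec = H'.vec) ∧
          X.HasGaussianDensity P (U * X.blockMatrix M * Uᴴ)) ∧
        ∀ M' : (b : X.Label) → Matrix (Fin b.mult) (Fin b.mult) 𝕜,
          (∀ b, (M' b).PosDef) →
          (∀ H ∈ X.space, ∃ H' ∈ X.space, (U * X.blockMatrix M' * Uᴴ) *ᵥ H.vec = H'.vec) →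
          X.HasGaussianDensity P (U * X.blockMatrix M' * Uᴴ) →
          ∀ b, b.s = X.sign → M' b = M b) ∧
    (∀ M : (b : X.Label) → Matrix (Fin b.mult) (Fin b.mult) 𝕜, (∀ b, (M b).PosDef) →
      ∃ P : Measure (Matrix (MIdx n k) (MIdx n k) 𝕜),
        X.IsKFoldGaussian P ∧ X.HasGaussianDensity P (U * X.blockMatrix M * Uᴴ)) := by
  obtain ⟨inst, U, hUU', hUU, hrep, hswap, hcomm⟩ := hX.exists_decomposition
  have hherm : ∀ M : (b : X.Label) → Matrix (Fin b.mult) (Fin b.mult) 𝕜, (∀ b, (M b).PosDef) →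
      (U * X.blockMatrix M * Uᴴ)ᴴ = U * X.blockMatrix M * Uᴴ := by
    intro M hM
    rw [Matrix.conjTranspose_mul, Matrix.conjTranspose_mul, Matrix.conjTranspose_conjTranspose,
      (blockMatrix_posDef hM).1, Matrix.mul_assoc]
  refine ⟨inst, U, hUU', hUU, fun g σ => ?_, ?_, fun P hP => ?_, fun M hM => ?_⟩
  · rw [Matrix.mul_assoc, hrep, ← Matrix.mul_assoc, hUU, Matrix.one_mul]
  · rw [Matrix.mul_assoc, hswap, ← Matrix.mul_assoc, hUU, Matrix.one_mul]
  · obtain ⟨Δ, hΔ, hΔrep, hΔswap, hΔS, hPΔ⟩ := hX.exists_invariant_precision hP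
    obtain ⟨M, hM⟩ := hcomm Δ hΔrep hΔswap
    have hΔM : U * X.blockMatrix M * Uᴴ = Δ := by
      rw [← hM, Matrix.mul_assoc, hUU', Matrix.mul_one]
    have hMpos : ∀ b, (M b).PosDef := by
      apply posDef_of_blockMatrix
      have h1 : X.blockMatrix M = Uᴴ * Δ * U := by
        rw [Matrix.mul_assoc, hM, ← Matrix.mul_assoc, hUU, Matrix.one_mul]
      rw [h1]
      refine hΔ.conjTranspose_mul_mul_same fun v w hvw => ?_
      have := congrArg (Uᴴ *ᵥ ·) hvw
      simpa only [Matrix.mulVec_mulVec, hUU, Matrix.one_mulVec] using this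
    refine ⟨M, ⟨hMpos, ?_, ?_⟩, fun M' hM' hS' hP' b hb => ?_⟩
    · rwa [hΔM]
    · rwa [hΔM]
    · have h1 := hX.sub_mul_signProj (hherm M' hM') hΔ.1 hS' hΔS
        (hP'.quadForm_eq hPΔ)
      rw [← hΔM] at h1
      set B := X.blockMatrix M' - X.blockMatrix M with hB
      set S := Matrix.blockDiagonal' (fun b : X.Label => ((b.s : ℤ) : 𝕜) •
        (1 : Matrix (Fin b.mult × (Fin b.dim × Fin b.dim')) (Fin b.mult × (Fin b.dim × Fin b.dim')) 𝕜)) with hS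
      have h2 : U * X.blockMatrix M' * Uᴴ - U * X.blockMatrix M * Uᴴ = U * B * Uᴴ := by
        rw [hB, Matrix.mul_sub, Matrix.sub_mul]
      -- In the basis U, `signProj` is half of 1 + s₀ s. This factor equals 2 on the blocks with s =
      -- s₀, so there the difference of the block matrices vanishes.
      have h3 : B * (1 + ((X.sign : ℤ) : 𝕜) • S) = 0 := by
        rw [h2, signProj, Matrix.mul_smul, smul_eq_zero] at h1
        have h4 := h1.resolve_left (inv_ne_zero two_ne_zero)
        have h5 : Uᴴ * (U * B * Uᴴ * (1 + ((X.sign : ℤ) : 𝕜) • X.swapMatrix)) * U = 0 := by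
          rw [h4, Matrix.mul_zero, Matrix.zero_mul]
        have h6 : (1 + ((X.sign : ℤ) : 𝕜) • X.swapMatrix) * U =
            U * (1 + ((X.sign : ℤ) : 𝕜) • S) := by
          rw [Matrix.add_mul, Matrix.mul_add, Matrix.one_mul, Matrix.mul_one, Matrix.smul_mul,
            Matrix.mul_smul, hswap]
        calc B * (1 + ((X.sign : ℤ) : 𝕜) • S)
            = (Uᴴ * U) * B * ((Uᴴ * U) * (1 + ((X.sign : ℤ) : 𝕜) • S)) := by
              rw [hUU, Matrix.one_mul, Matrix.one_mul]
          _ = Uᴴ * (U * B * Uᴴ * (1 + ((X.sign : ℤ) : 𝕜) • X.swapMatrix)) * U := by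
              simp only [Matrix.mul_assoc]
              rw [h6]
          _ = 0 := h5
      let q : Fin b.dim × Fin b.dim' := (⟨0, b.mu.rep.dim_pos⟩, ⟨0, SymDual.dim_pos b.mu'⟩)
      ext c c'
      have h7 := congrFun (congrFun h3 ⟨b, c, q⟩) ⟨b, c', q⟩
      rw [Matrix.mul_add, Matrix.mul_one, Matrix.mul_smul, Matrix.add_apply, Matrix.smul_apply, hS,
        mul_blockDiagonal'_apply, Finset.sum_eq_single (c', q)] at h7
      · rw [Matrix.smul_apply, Matrix.one_apply_eq, hb, smul_eq_mul, smul_eq_mul, mul_one,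
          mul_left_comm, sign_mul_sign, mul_one, ← two_mul, Matrix.zero_apply] at h7
        have h8 := (mul_eq_zero.1 h7).resolve_left two_ne_zero
        rw [hB, Matrix.sub_apply, blockMatrix, blockMatrix, Matrix.blockDiagonal'_apply_eq,
          Matrix.blockDiagonal'_apply_eq, Matrix.one_kronecker_one] at h8
        simpa [sub_eq_zero] using h8
      · intro p _ hp
        rw [Matrix.smul_apply, Matrix.one_apply_ne hp, smul_zero, mul_zero]
      · intro h; exact absurd (Finset.mem_univ _) h
  · have hpos : (U * X.blockMatrix M * Uᴴ).PosDef := by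
      have := (blockMatrix_posDef hM).conjTranspose_mul_mul_same (B := Uᴴ) fun v w hvw => by
        have := congrArg (U *ᵥ ·) hvw
        simpa only [Matrix.mulVec_mulVec, hUU', Matrix.one_mulVec] using this
      rwa [Matrix.conjTranspose_conjTranspose] at this
    obtain ⟨P, hP, hPΔ⟩ := exists_hasGaussianDensity (X := X) hpos
    have hinv : ∀ (g : X.group) (σ : Equiv.Perm (Fin k)), P.map (X.act (tensorPow k
        ((g : Matrix.unitaryGroup n 𝕜) : Matrix n n 𝕜) * permOp σ)) = P := by
      intro g σ
      refine hX.map_act_eq hPΔ ?_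
      have hrep' : Uᴴ * X.rep g σ = (Matrix.blockDiagonal' fun b : X.Label =>
          (1 : Matrix (Fin b.mult) (Fin b.mult) 𝕜) ⊗ₖ (b.mu.mat g ⊗ₖ SymDual.mat b.mu' σ)) * Uᴴ := by
        calc Uᴴ * X.rep g σ = Uᴴ * (X.rep g σ * U) * Uᴴ := by
              rw [Matrix.mul_assoc, Matrix.mul_assoc, hUU', Matrix.mul_one]
          _ = _ := by rw [hrep, ← Matrix.mul_assoc, hUU, Matrix.one_mul]
      rw [Matrix.mul_assoc (U * _), hrep', ← Matrix.mul_assoc, ← Matrix.mul_assoc, hrep,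
        Matrix.mul_assoc U, ← blockMatrix_mul_comm]
      simp only [Matrix.mul_assoc]
    refine ⟨P, ⟨hP, fun g hg => ?_, ⟨_, hpos, hPΔ⟩, fun σ => ?_⟩, hPΔ⟩
    · have := hinv ⟨g, hg⟩ 1
      rwa [permOp_one, mul_one] at this
    · have := hinv 1 σ
      rwa [Subgroup.coe_one, Matrix.UnitaryGroup.one_val, tensorPow_one, one_mul] at this

end IsEnsembleModel

end MatrixModel

/-! ### Algebra of tensor powers and tensor permutations -/

section TensorPower

variable {𝕜 : Type} [RCLike 𝕜] {n : Type} [Fintype n] [DecidableEq n] {k : ℕ}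

omit [DecidableEq n] in
theorem tensorPow_mul (A B : Matrix n n 𝕜) :
    tensorPow k A * tensorPow k B = tensorPow k (A * B) := by
  classical
  ext i j
  simp only [tensorPow, Matrix.mul_apply, Matrix.of_apply]
  rw [Finset.prod_univ_sum, Fintype.piFinset_univ]
  exact Finset.sum_congr rfl fun l _ => Finset.prod_mul_distrib.symm

omit [Fintype n] [DecidableEq n] in
theorem tensorPow_transpose (A : Matrix n n 𝕜) : (tensorPow k A)ᵀ = tensorPow k Aᵀ := rfl

omit [Fintype n] [DecidableEq n] in
theorem tensorPow_map_star (A : Matrix n n 𝕜) :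
    (tensorPow k A).map star = tensorPow k (A.map star) := by
  ext i j
  exact map_prod (starRingEnd 𝕜) (fun a => A (i a) (j a)) Finset.univ

omit [Fintype n] [DecidableEq n] in
theorem tensorPow_conjTranspose (A : Matrix n n 𝕜) : (tensorPow k A)ᴴ = tensorPow k Aᴴ :=
  tensorPow_map_star Aᵀ

omit [Fintype n] [DecidableEq n] in
theorem tensorPow_neg (A : Matrix n n 𝕜) : tensorPow k (-A) = (-1 : 𝕜) ^ k • tensorPow k A := by
  ext i j
  simp only [tensorPow, Matrix.of_apply, Matrix.neg_apply, Matrix.smul_apply, Finset.prod_neg,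
    Finset.card_univ, Fintype.card_fin, smul_eq_mul]

theorem permOp_mul (σ τ : Equiv.Perm (Fin k)) :
    (permOp σ * permOp τ : Matrix (MIdx n k) (MIdx n k) 𝕜) = permOp (σ * τ) := by
  ext i j
  simp only [permOp, Matrix.mul_apply, Matrix.of_apply]
  rw [Finset.sum_eq_single (j ∘ τ.symm)]
  · rw [if_pos rfl, mul_one]
    rfl
  · intro l _ hl
    rw [if_neg hl, mul_zero]
  · intro h
    exact absurd (Finset.mem_univ _) h

omit [Fintype n] in
theorem permOp_transpose (σ : Equiv.Perm (Fin k)) :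
    (permOp σ : Matrix (MIdx n k) (MIdx n k) 𝕜)ᵀ = permOp σ⁻¹ := by
  ext i j
  simp only [permOp, Matrix.transpose_apply, Matrix.of_apply]
  congr 1
  rw [Equiv.eq_comp_symm, eq_comm (a := i)]
  rfl

omit [Fintype n] in
theorem permOp_map_star (σ : Equiv.Perm (Fin k)) :
    (permOp σ : Matrix (MIdx n k) (MIdx n k) 𝕜).map star = permOp σ := by
  ext i j
  simp only [permOp, Matrix.map_apply, Matrix.of_apply]
  split_ifs
  · exact star_one 𝕜
  · exact star_zero 𝕜

omit [Fintype n] in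
theorem permOp_conjTranspose (σ : Equiv.Perm (Fin k)) :
    (permOp σ : Matrix (MIdx n k) (MIdx n k) 𝕜)ᴴ = permOp σ⁻¹ := by
  rw [Matrix.conjTranspose, permOp_transpose, permOp_map_star]

/-- All tensor factors carry the same operator, so permuting them before or after makes no
difference. -/
theorem permOp_mul_tensorPow (A : Matrix n n 𝕜) (σ : Equiv.Perm (Fin k)) :
    permOp σ * tensorPow k A = tensorPow k A * permOp σ := by
  ext i j
  simp only [permOp, tensorPow, Matrix.mul_apply, Matrix.of_apply]
  rw [Finset.sum_eq_single (i ∘ σ), Finset.sum_eq_single (j ∘ σ.symm)]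
  · rw [if_pos rfl, if_pos (by rw [Function.comp_assoc, Equiv.self_comp_symm, Function.comp_id]),
      mul_one, one_mul]
    refine Fintype.prod_equiv σ _ _ fun a => ?_
    rw [Function.comp_apply, Function.comp_apply, Equiv.symm_apply_apply]
  · intro l _ hl
    rw [if_neg hl, mul_zero]
  · intro h
    exact absurd (Finset.mem_univ _) h
  · intro l _ hl
    rw [if_neg, zero_mul]
    rw [Equiv.eq_comp_symm]
    exact fun h => hl h.symm
  · intro h
    exact absurd (Finset.mem_univ _) h

theorem tensorPow_mul_permOp_mul (A B : Matrix n n 𝕜) (σ τ : Equiv.Perm (Fin k)) :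
    tensorPow k A * permOp σ * (tensorPow k B * permOp τ) =
      tensorPow k (A * B) * permOp (σ * τ) := by
  rw [Matrix.mul_assoc, ← Matrix.mul_assoc (permOp σ), permOp_mul_tensorPow, Matrix.mul_assoc,
    permOp_mul, ← Matrix.mul_assoc, tensorPow_mul]

theorem tensorPow_mul_permOp_conjTranspose (A : Matrix n n 𝕜) (σ : Equiv.Perm (Fin k)) :
    (tensorPow k A * permOp σ)ᴴ = tensorPow k Aᴴ * permOp σ⁻¹ := by
  rw [Matrix.conjTranspose_mul, tensorPow_conjTranspose, permOp_conjTranspose, permOp_mul_tensorPow]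

theorem tensorPow_mul_permOp_transpose (A : Matrix n n 𝕜) (σ : Equiv.Perm (Fin k)) :
    (tensorPow k A * permOp σ)ᵀ = tensorPow k Aᵀ * permOp σ⁻¹ := by
  rw [Matrix.transpose_mul, tensorPow_transpose, permOp_transpose, permOp_mul_tensorPow]

omit [Fintype n] [DecidableEq n] in
theorem continuous_tensorPow : Continuous (tensorPow k : Matrix n n 𝕜 → _) :=
  continuous_matrix fun i j => continuous_finsetProd (f := fun a (A : Matrix n n 𝕜) => A (i a) (j a))
    Finset.univ fun _ _ => continuous_id.matrix_elem _ _

end TensorPower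

/-! ### Matrices of superoperators -/

section SuperMatrix

variable {𝕜 : Type} [RCLike 𝕜] {ι : Type} [Fintype ι] [DecidableEq ι]

theorem matrix_eq_of_mulVec_vec {A B : Matrix (ι × ι) (ι × ι) 𝕜}
    (h : ∀ H : Matrix ι ι 𝕜, A *ᵥ H.vec = B *ᵥ H.vec) : A = B := by
  refine Matrix.ext_of_mulVec_single fun i => ?_
  obtain ⟨H, hH⟩ := exists_vec_eq (Pi.single i (1 : 𝕜))
  rw [← hH, h]

theorem superMatrix_mul (f g : Matrix ι ι 𝕜 →ₗ[𝕜] Matrix ι ι 𝕜) :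
    superMatrix f * superMatrix g = superMatrix (f ∘ₗ g) :=
  matrix_eq_of_mulVec_vec fun H => by
    rw [← Matrix.mulVec_mulVec, superMatrix_mulVec_vec, superMatrix_mulVec_vec,
      superMatrix_mulVec_vec, LinearMap.comp_apply]

theorem superMatrix_id : superMatrix (LinearMap.id : Matrix ι ι 𝕜 →ₗ[𝕜] Matrix ι ι 𝕜) = 1 :=
  matrix_eq_of_mulVec_vec fun H => by
    rw [superMatrix_mulVec_vec, Matrix.one_mulVec, LinearMap.id_apply]

omit [Fintype ι] in
theorem superMatrix_transposeMap_conjTranspose :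
    (superMatrix (transposeMap ι 𝕜))ᴴ = superMatrix (transposeMap ι 𝕜) := by
  ext p q
  simp only [superMatrix, transposeMap, Matrix.conjTranspose_apply, Matrix.of_apply, Matrix.vec,
    LinearMap.coe_mk, AddHom.coe_mk, Matrix.transpose_apply, Matrix.single_apply]
  rw [apply_ite star, star_one, star_zero]
  congr 1
  exact propext ⟨fun h => ⟨h.2.symm, h.1.symm⟩, fun h => ⟨h.2.symm, h.1.symm⟩⟩

end SuperMatrix

/-! ### Criteria for unitary and ensemble models -/

namespace MatrixModel

variable {𝕜 : Type} [RCLike 𝕜] {n : Type} [Fintype n] [DecidableEq n] {k : ℕ}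
  {X : MatrixModel 𝕜 n k}

/-- vec(A H B) = (Bᵀ ⊗ A) vec H. Through this, the properties of the representation reduce to
properties of `right`. -/
theorem superMatrix_act (A : Matrix (MIdx n k) (MIdx n k) 𝕜) :
    superMatrix (X.act A) = (X.right A)ᵀ ⊗ₖ A :=
  matrix_eq_of_mulVec_vec fun H => by
    rw [superMatrix_mulVec_vec, Matrix.kronecker_mulVec_vec, Matrix.transpose_transpose]
    rfl

theorem isUnitaryModel_of_right (hmul : ∀ A B, X.right (A * B) = X.right B * X.right A)
    (hone : X.right 1 = 1) (hstar : ∀ A, X.right Aᴴ = (X.right A)ᴴ) (hcont : Continuous X.right)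
    (hherm : X.swapMatrixᴴ = X.swapMatrix) (hinv : X.swap ∘ₗ X.swap = LinearMap.id)
    (hcomm : ∀ (g : X.group) (σ : Equiv.Perm (Fin k)) (H : Matrix (MIdx n k) (MIdx n k) 𝕜),
      X.swap (X.act (tensorPow k ((g : Matrix.unitaryGroup n 𝕜) : Matrix n n 𝕜) * permOp σ) H) =
      X.act (tensorPow k ((g : Matrix.unitaryGroup n 𝕜) : Matrix n n 𝕜) * permOp σ) (X.swap H))
    (hschur : SchurProperty 𝕜 X.group)
    (hperm : @SchurProperty 𝕜 _ (Equiv.Perm (Fin k)) _ ⊥) : X.IsUnitaryModel where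
  rep_mul g σ g' σ' := by
    rw [rep, rep, rep, superMatrix_act, superMatrix_act, superMatrix_act,
      ← Matrix.mul_kronecker_mul, ← Matrix.transpose_mul, ← hmul, tensorPow_mul_permOp_mul,
      Subgroup.coe_mul, Matrix.UnitaryGroup.mul_val]
  rep_one := by
    rw [rep, superMatrix_act, Subgroup.coe_one, Matrix.UnitaryGroup.one_val, tensorPow_one,
      permOp_one, Matrix.one_mul, hone, Matrix.transpose_one, Matrix.one_kronecker_one]
  rep_conjTranspose g σ := by
    rw [rep, rep, superMatrix_act, superMatrix_act, Matrix.conjTranspose_kronecker,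
      Subgroup.coe_inv, Matrix.UnitaryGroup.inv_val, Matrix.star_eq_conjTranspose,
      ← tensorPow_mul_permOp_conjTranspose, hstar]
    rfl
  continuous_rep := by
    have h1 : Continuous fun g : X.group => tensorPow k
        ((g : Matrix.unitaryGroup n 𝕜) : Matrix n n 𝕜) * permOp (1 : Equiv.Perm (Fin k)) :=
      (continuous_tensorPow.comp (continuous_subtype_val.comp continuous_subtype_val)).matrix_mul
        continuous_const
    simp only [rep, superMatrix_act]
    exact continuous_matrix fun p q =>
      ((hcont.comp h1).matrix_elem _ _).mul (h1.matrix_elem _ _)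
  swap_conjTranspose := hherm
  swap_mul_swap := by rw [swapMatrix, superMatrix_mul, hinv, superMatrix_id]
  swap_mul_rep g σ := by
    rw [swapMatrix, rep, superMatrix_mul, superMatrix_mul]
    exact congrArg superMatrix (LinearMap.ext (hcomm g σ))
  schur := hschur
  schur_perm := hperm

theorem IsUnitaryModel.swap_act (hX : X.IsUnitaryModel) (g : X.group) (σ : Equiv.Perm (Fin k))
    (H : Matrix (MIdx n k) (MIdx n k) 𝕜) :
    X.swap (X.act (tensorPow k ((g : Matrix.unitaryGroup n 𝕜) : Matrix n n 𝕜) * permOp σ) H) =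
    X.act (tensorPow k ((g : Matrix.unitaryGroup n 𝕜) : Matrix n n 𝕜) * permOp σ) (X.swap H) := by
  apply Matrix.vec_inj.1
  rw [← swapMatrix_mulVec_vec, ← rep_mulVec_vec, ← rep_mulVec_vec, ← swapMatrix_mulVec_vec,
    Matrix.mulVec_mulVec, Matrix.mulVec_mulVec, hX.swap_mul_rep]

/-- A symmetry type whose space of random matrices is an eigenspace of the exchange of factors. -/
theorem IsUnitaryModel.isEnsembleModel_of_eigenspace (hX : X.IsUnitaryModel)
    (hspace : ∀ H, H ∈ X.space ↔ X.swap H = ((X.sign : ℤ) : 𝕜) • H) : X.IsEnsembleModel where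
  toIsUnitaryModel := hX
  act_mem g σ H hH := by
    rw [hspace] at hH ⊢
    rw [hX.swap_act, hH, map_smul]
  swap_eq H hH := (hspace H).1 hH
  mem_span H hH := Submodule.subset_span ((hspace H).2 hH)
  exists_posDef Δ hΔ := by
    -- Here 𝓗 is the whole eigenspace, so the compression of Δ itself lands in 𝓗.
    refine ⟨Δ, hΔ, fun H _ => rfl, fun H _ => ?_⟩
    obtain ⟨H', hH'⟩ := exists_vec_eq (X.signProj *ᵥ (Δ *ᵥ H.vec))
    refine ⟨H', (hspace H').2 (Matrix.vec_inj.1 ?_), hH'.symm⟩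
    rw [← swapMatrix_mulVec_vec, Matrix.vec_smul, hH', Matrix.mulVec_mulVec,
      hX.swapMatrix_mul_signProj, Matrix.smul_mulVec]

end MatrixModel

/-- A positive definite form can be averaged over a real structure without changing its values on
the real points. -/
theorem exists_posDef_real {𝕜 ι : Type} [RCLike 𝕜] [Fintype ι] {e : Equiv.Perm ι}
    (he : ∀ i, e (e i) = i) {Δ : Matrix ι ι 𝕜} (hΔ : Δ.PosDef) :
    ∃ Δ' : Matrix ι ι 𝕜, Δ'.PosDef ∧ ∀ v : ι → 𝕜, v ∘ e = star v →
      star v ⬝ᵥ (Δ' *ᵥ v) = star v ⬝ᵥ (Δ *ᵥ v) ∧ (Δ' *ᵥ v) ∘ e = star (Δ' *ᵥ v) := by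
  have hee : e.symm = e := Equiv.ext fun i => by rw [Equiv.symm_apply_eq, he]
  have hpos : (Δᵀ.submatrix e e).PosDef := hΔ.transpose.submatrix e.injective
  -- Vectors with v ∘ e = star v are the real points. As Δ is Hermitian, Δᵀ is its entrywise
  -- conjugate, so the second summand is the conjugate of Δ under the real structure.
  refine ⟨(2 : 𝕜)⁻¹ • (Δ + Δᵀ.submatrix e e), (hΔ.add hpos).smul (by simp), fun v hv => ?_⟩
  have h1 : Δᵀ.submatrix e e *ᵥ v = star (Δ *ᵥ v) ∘ e := by
    rw [Matrix.submatrix_mulVec_equiv, hee, hv, Matrix.star_mulVec, hΔ.1, Matrix.mulVec_transpose]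
  have h2 : star v ⬝ᵥ (Δᵀ.submatrix e e *ᵥ v) = star v ⬝ᵥ (Δ *ᵥ v) := by
    rw [h1, ← hv, comp_equiv_dotProduct_comp_equiv, Matrix.star_mulVec, hΔ.1, hv, dotProduct_comm,
      ← Matrix.dotProduct_mulVec]
  rw [Matrix.smul_mulVec, Matrix.add_mulVec]
  refine ⟨?_, ?_⟩
  · rw [dotProduct_smul, dotProduct_add, h2, ← two_smul 𝕜, smul_smul, inv_mul_cancel₀ two_ne_zero,
      one_smul]
  · rw [h1]
    ext i
    simp only [Function.comp_apply, Pi.smul_apply, Pi.add_apply, Pi.star_apply, he, star_smul,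
      star_add, star_star]
    rw [add_comm]
    simp

namespace MatrixModel

/-- A complex symmetry type whose space of random matrices is the set of fixed points of an
antilinear involution `θ` in an eigenspace of the exchange of factors. -/
theorem IsUnitaryModel.isEnsembleModel_of_realStructure {n : Type} [Fintype n] [DecidableEq n]
    {k : ℕ} {X : MatrixModel ℂ n k} (hX : X.IsUnitaryModel)
    {e : Equiv.Perm (MIdx n k × MIdx n k)} (he : ∀ p, e (e p) = p)
    {θ : Matrix (MIdx n k) (MIdx n k) ℂ → Matrix (MIdx n k) (MIdx n k) ℂ}
    (hθ : ∀ H, (θ H).vec = star (H.vec ∘ e))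
    (hspace : ∀ H, H ∈ X.space ↔ X.swap H = ((X.sign : ℤ) : ℂ) • H ∧ θ H = H)
    (hswap : ∀ H, X.swap (θ H) = θ (X.swap H))
    (hact : ∀ (g : X.group) (σ : Equiv.Perm (Fin k)) (H : Matrix (MIdx n k) (MIdx n k) ℂ),
      X.act (tensorPow k ((g : Matrix.unitaryGroup n ℂ) : Matrix n n ℂ) * permOp σ) (θ H) =
      θ (X.act (tensorPow k ((g : Matrix.unitaryGroup n ℂ) : Matrix n n ℂ) * permOp σ) H)) :
    X.IsEnsembleModel := by
  have hadd : ∀ H H', θ (H + H') = θ H + θ H' := by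
    intro H H'
    apply Matrix.vec_inj.1
    rw [hθ, Matrix.vec_add, Matrix.vec_add, hθ, hθ]
    ext p
    exact star_add (H.vec (e p)) (H'.vec (e p))
  have hsmul : ∀ (c : ℂ) H, θ (c • H) = star c • θ H := by
    intro c H
    apply Matrix.vec_inj.1
    rw [hθ, Matrix.vec_smul, Matrix.vec_smul, hθ]
    ext p
    exact star_mul' c (H.vec (e p))
  have hinv : ∀ H, θ (θ H) = H := by
    intro H
    apply Matrix.vec_inj.1
    rw [hθ, hθ]
    ext p
    change star (star (H.vec (e (e p)))) = H.vec p
    rw [star_star, he]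
  have hsign : star ((X.sign : ℤ) : ℂ) = ((X.sign : ℤ) : ℂ) := star_intCast _
  have hfix : ∀ H, θ H = H ↔ H.vec ∘ e = star H.vec := by
    intro H
    rw [← Matrix.vec_inj, hθ]
    constructor
    · intro h
      rw [← h, star_star, h]
    · intro h
      rw [h, star_star]
  refine { hX with
    act_mem := fun g σ H hH => ?_
    swap_eq := fun H hH => ((hspace H).1 hH).1
    mem_span := fun H hH => ?_
    exists_posDef := fun Δ hΔ => ?_ }
  · rw [hspace] at hH ⊢
    rw [hX.swap_act, hH.1, map_smul, ← hact, hH.2]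
    exact ⟨rfl, rfl⟩
  · have h1 : X.swap (θ H) = ((X.sign : ℤ) : ℂ) • θ H := by rw [hswap, hH, hsmul, hsign]
    have h2 : H + θ H ∈ X.space := by
      rw [hspace, map_add, hH, h1, smul_add, hadd, hinv]
      exact ⟨rfl, add_comm _ _⟩
    have h3 : Complex.I • (H + (-1 : ℂ) • θ H) ∈ X.space := by
      rw [hspace, map_smul, map_add, map_smul, hH, h1, hsmul, hadd, hsmul, hinv]
      refine ⟨by module, ?_⟩
      rw [star_neg, star_one, Complex.star_def, Complex.conj_I]
      module
    -- Decomposition into real and imaginary parts for θ: both H + θ H and i (H - θ H) lie in 𝓗.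
    have h4 : H = (2 : ℂ)⁻¹ • (H + θ H) +
        (-(2 : ℂ)⁻¹ * Complex.I) • (Complex.I • (H + (-1 : ℂ) • θ H)) := by
      rw [smul_smul, mul_assoc, Complex.I_mul_I]
      module
    rw [h4]
    exact add_mem (Submodule.smul_mem _ _ (Submodule.subset_span h2))
      (Submodule.smul_mem _ _ (Submodule.subset_span h3))
  · obtain ⟨Δ', hΔ', h⟩ := exists_posDef_real he hΔ
    refine ⟨Δ', hΔ', fun H hH => ?_, fun H hH => ?_⟩
    · rw [quadForm, quadForm, (h _ ((hfix H).1 ((hspace H).1 hH).2)).1]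
    · obtain ⟨H₁, e₁⟩ := exists_vec_eq (Δ' *ᵥ H.vec)
      have h1 : θ H₁ = H₁ := by
        rw [hfix, e₁]
        exact (h _ ((hfix H).1 ((hspace H).1 hH).2)).2
      -- The compression of Δ' H to the eigenspace; it stays fixed by θ because θ commutes with the
      -- exchange.
      refine ⟨(2 : ℂ)⁻¹ • (H₁ + ((X.sign : ℤ) : ℂ) • X.swap H₁), ?_, ?_⟩
      · have h2 : X.swap (X.swap H₁) = H₁ := by
          apply Matrix.vec_inj.1
          rw [← swapMatrix_mulVec_vec, ← swapMatrix_mulVec_vec, Matrix.mulVec_mulVec,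
            hX.swap_mul_swap, Matrix.one_mulVec]
        rw [hspace, map_smul, map_add, map_smul, h2, hsmul, hadd, hsmul, hsign, ← hswap, h1,
          star_inv₀, star_ofNat]
        refine ⟨?_, rfl⟩
        rw [smul_comm ((X.sign : ℤ) : ℂ) (2 : ℂ)⁻¹, smul_add ((X.sign : ℤ) : ℂ),
          smul_smul ((X.sign : ℤ) : ℂ), sign_mul_sign, one_smul, add_comm]
      · rw [← e₁, signProj, Matrix.smul_mulVec, Matrix.add_mulVec, Matrix.one_mulVec,
          Matrix.smul_mulVec, swapMatrix_mulVec_vec, Matrix.vec_smul, Matrix.vec_add,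
          Matrix.vec_smul]

end MatrixModel

/-! ### The five symmetry types -/

section Models

open MatrixModel

theorem continuous_conjTranspose {𝕜 ι : Type} [RCLike 𝕜] :
    Continuous fun A : Matrix ι ι 𝕜 => Aᴴ :=
  continuous_id.matrix_conjTranspose

theorem conjTranspose_mul_mul_conjTranspose {𝕜 ι : Type} [RCLike 𝕜] [Fintype ι]
    (A H : Matrix ι ι 𝕜) : (A * H * Aᴴ)ᴴ = A * Hᴴ * Aᴴ := by
  rw [Matrix.conjTranspose_mul, Matrix.conjTranspose_mul, Matrix.conjTranspose_conjTranspose,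
    Matrix.mul_assoc]

theorem transpose_mul_mul_transpose {𝕜 ι : Type} [RCLike 𝕜] [Fintype ι]
    (A H : Matrix ι ι 𝕜) : (A * H * Aᵀ)ᵀ = A * Hᵀ * Aᵀ := by
  rw [Matrix.transpose_mul, Matrix.transpose_mul, Matrix.transpose_transpose, Matrix.mul_assoc]

theorem conjTranspose_eq_transpose_of_map_star {𝕜 ι : Type} [RCLike 𝕜] {A : Matrix ι ι 𝕜}
    (hA : A.map star = A) : Aᴴ = Aᵀ :=
  congrArg Matrix.transpose hA

/-- The exchange is the identity, so its eigenspace consists of all matrices, and 𝓗 is the real form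
fixed by the adjoint. -/
theorem isEnsembleModel_unitaryModel (d k : ℕ) : (unitaryModel d k).IsEnsembleModel := by
  have hX : (unitaryModel d k).IsUnitaryModel := isUnitaryModel_of_right
    (fun A B => Matrix.conjTranspose_mul A B) Matrix.conjTranspose_one (fun _ => rfl)
    continuous_conjTranspose
    (by rw [swapMatrix]; exact (congrArg _ superMatrix_id).trans
          (Matrix.conjTranspose_one.trans superMatrix_id.symm))
    rfl (fun _ _ _ => rfl) (schurProperty_complex _) (@schurProperty_complex _ _ ⊥)
  refine hX.isEnsembleModel_of_realStructure (e := Equiv.prodComm _ _) (θ := fun H => Hᴴ)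
    (fun p => rfl) (fun H => rfl) (fun H => ?_) (fun H => rfl) (fun g σ H => ?_)
  · change Hᴴ = H ↔ H = (((1 : ℤˣ) : ℤ) : ℂ) • H ∧ Hᴴ = H
    rw [Units.val_one, Int.cast_one, one_smul]
    exact ⟨fun h => ⟨rfl, h⟩, fun h => h.2⟩
  · exact (conjTranspose_mul_mul_conjTranspose _ H).symm

/-- 𝓗 is the full eigenspace of transposition. This is the one real type, where Schur's lemma comes
from the Gelfand chains. -/
theorem isEnsembleModel_orthogonalModel (d k : ℕ) : (orthogonalModel d k).IsEnsembleModel := by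
  have hX : (orthogonalModel d k).IsUnitaryModel := isUnitaryModel_of_right
    (fun A B => Matrix.conjTranspose_mul A B) Matrix.conjTranspose_one (fun _ => rfl)
    continuous_conjTranspose superMatrix_transposeMap_conjTranspose rfl
    (fun g σ H => by
      change (_ * H * _ᴴ)ᵀ = _ * Hᵀ * _ᴴ
      rw [Matrix.conjTranspose_eq_transpose_of_trivial, transpose_mul_mul_transpose])
    (schurProperty_orthogonal _) (@schurProperty_perm k ⊥)
  refine hX.isEnsembleModel_of_eigenspace fun H => ?_
  change Hᵀ = H ↔ Hᵀ = (((1 : ℤˣ) : ℤ) : ℝ) • H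
  rw [Units.val_one, Int.cast_one, one_smul]

theorem neg_one_smul_eq_neg {ι : Type} (H : Matrix ι ι ℂ) :
    (((-1 : ℤˣ) : ℤ) : ℂ) • H = -H := by
  rw [Units.val_neg, Units.val_one, Int.cast_neg, Int.cast_one, neg_one_smul]

/-- 𝓗 is a complex subspace, the full -1 eigenspace of transposition, so no real structure is
needed. -/
theorem isEnsembleModel_symplecticModel (m k : ℕ) : (symplecticModel m k).IsEnsembleModel := by
  have hX : (symplecticModel m k).IsUnitaryModel := isUnitaryModel_of_right
    (fun A B => Matrix.transpose_mul A B) Matrix.transpose_one (fun _ => rfl)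
    continuous_id.matrix_transpose superMatrix_transposeMap_conjTranspose rfl
    (fun g σ H => transpose_mul_mul_transpose _ H)
    (schurProperty_complex _) (@schurProperty_complex _ _ ⊥)
  refine hX.isEnsembleModel_of_eigenspace fun H => ?_
  change Hᵀ = -H ↔ Hᵀ = (((-1 : ℤˣ) : ℤ) : ℂ) • H
  rw [neg_one_smul_eq_neg]

/-- The real structure is entrywise conjugation. Reality of the group makes the action commute with
it, and also with transposition, since then Aᴴ = Aᵀ. -/
theorem isEnsembleModel_realSymplecticModel (m k : ℕ) :
    (realSymplecticModel m k).IsEnsembleModel := by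
  have hreal : ∀ (g : (realSymplecticModel m k).group) (σ : Equiv.Perm (Fin k)),
      (tensorPow k ((g : Matrix.unitaryGroup (Fin m ⊕ Fin m) ℂ) :
        Matrix (Fin m ⊕ Fin m) (Fin m ⊕ Fin m) ℂ) * permOp σ).map star =
      tensorPow k ((g : Matrix.unitaryGroup (Fin m ⊕ Fin m) ℂ) :
        Matrix (Fin m ⊕ Fin m) (Fin m ⊕ Fin m) ℂ) * permOp σ := by
    intro g σ
    refine (Matrix.map_mul (f := starRingEnd ℂ)).trans ?_
    change (tensorPow k _).map star * (permOp σ).map star = _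
    rw [tensorPow_map_star, permOp_map_star, g.2.2]
  have hX : (realSymplecticModel m k).IsUnitaryModel := isUnitaryModel_of_right
    (fun A B => Matrix.conjTranspose_mul A B) Matrix.conjTranspose_one (fun _ => rfl)
    continuous_conjTranspose superMatrix_transposeMap_conjTranspose rfl
    (fun g σ H => by
      have h := conjTranspose_eq_transpose_of_map_star (hreal g σ)
      change (_ * H * _ᴴ)ᵀ = _ * Hᵀ * _ᴴ
      rw [h, transpose_mul_mul_transpose])
    (schurProperty_complex _) (@schurProperty_complex _ _ ⊥)
  refine hX.isEnsembleModel_of_realStructure (e := Equiv.refl _) (θ := fun H => H.map star)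
    (fun p => rfl) (fun H => rfl) (fun H => ?_) (fun H => rfl) (fun g σ H => ?_)
  · change (H.map star = H ∧ Hᵀ = -H) ↔ Hᵀ = (((-1 : ℤˣ) : ℤ) : ℂ) • H ∧ H.map star = H
    rw [neg_one_smul_eq_neg, and_comm]
  · have h := hreal g σ
    set A := tensorPow k ((g : Matrix.unitaryGroup (Fin m ⊕ Fin m) ℂ) :
        Matrix (Fin m ⊕ Fin m) (Fin m ⊕ Fin m) ℂ) * permOp σ
    have h' : Aᴴ.map star = Aᴴ := congrArg Matrix.conjTranspose h
    change A * H.map star * Aᴴ = (A * H * Aᴴ).map (starRingEnd ℂ)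
    rw [Matrix.map_mul, Matrix.map_mul]
    change _ = A.map star * H.map star * Aᴴ.map star
    rw [h, h']

theorem tensorPow_J_mul_transpose (m k : ℕ) :
    tensorPow k (Matrix.J (Fin m) ℂ) * (tensorPow k (Matrix.J (Fin m) ℂ))ᵀ = 1 := by
  rw [tensorPow_transpose, tensorPow_mul, Matrix.J_transpose, Matrix.mul_neg, Matrix.J_squared,
    neg_neg, tensorPow_one]

theorem tensorPow_J_map_star (m k : ℕ) :
    (tensorPow k (Matrix.J (Fin m) ℂ)).map star = tensorPow k (Matrix.J (Fin m) ℂ) := by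
  rw [tensorPow_map_star]
  congr 1
  ext (i | i) (j | j) <;> simp [Matrix.J, Matrix.one_apply, apply_ite]

/-- Jᵀ = -J contributes the sign (-1)^k twice. -/
theorem tensorPow_J_transpose_mul_mul (m k : ℕ)
    (H : Matrix (MIdx (Fin m ⊕ Fin m) k) (MIdx (Fin m ⊕ Fin m) k) ℂ) :
    (tensorPow k (Matrix.J (Fin m) ℂ))ᵀ * H * (tensorPow k (Matrix.J (Fin m) ℂ))ᵀ =
      tensorPow k (Matrix.J (Fin m) ℂ) * H * tensorPow k (Matrix.J (Fin m) ℂ) := by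
  rw [tensorPow_transpose, Matrix.J_transpose, tensorPow_neg, Matrix.smul_mul, Matrix.smul_mul,
    Matrix.mul_smul, smul_smul, ← mul_pow, neg_one_mul, neg_neg, one_pow, one_smul]

/-- Unitarity turns invariance of the form into K Aᵀ = Aᴴ K. Transposing this, or conjugating it by
the orthogonal K, gives the rules for moving Kᵀ past A and Aᵀ in the twisted transposition. -/
theorem mul_transpose_of_mul_mul_transpose {ι : Type} [Fintype ι] [DecidableEq ι]
    {A K : Matrix ι ι ℂ} (hA : Aᴴ * A = 1) (hK : K * Kᵀ = 1) (h : A * K * Aᵀ = K) :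
    A * Kᵀ = Kᵀ * Aᴴᵀ ∧ Aᵀ * Kᵀ = Kᵀ * Aᴴ := by
  have h1 : K * Aᵀ = Aᴴ * K :=
    calc K * Aᵀ = Aᴴ * A * K * Aᵀ := by rw [hA, Matrix.one_mul]
      _ = Aᴴ * (A * K * Aᵀ) := by simp only [Matrix.mul_assoc]
      _ = Aᴴ * K := by rw [h]
  refine ⟨?_, ?_⟩
  · rw [← Matrix.transpose_mul, ← h1, Matrix.transpose_mul, Matrix.transpose_transpose]
  · calc Aᵀ * Kᵀ = Kᵀ * (K * Aᵀ) * Kᵀ := by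
          rw [← Matrix.mul_assoc Kᵀ, mul_eq_one_comm.1 hK, Matrix.one_mul]
      _ = Kᵀ * Aᴴ := by rw [h1, Matrix.mul_assoc, Matrix.mul_assoc, hK, Matrix.mul_one]

theorem isEnsembleModel_hermitianSymplecticModel (m k : ℕ) :
    (hermitianSymplecticModel m k).IsEnsembleModel := by
  set K : Matrix (MIdx (Fin m ⊕ Fin m) k) (MIdx (Fin m ⊕ Fin m) k) ℂ :=
    tensorPow k (Matrix.J (Fin m) ℂ) with hKdef
  have hK : K * Kᵀ = 1 := tensorPow_J_mul_transpose m k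
  have hK' : Kᵀ * K = 1 := mul_eq_one_comm.1 hK
  have hKstar : Kᴴ = Kᵀ := conjTranspose_eq_transpose_of_map_star (tensorPow_J_map_star m k)
  have hKstar' : Kᵀᴴ = K := tensorPow_J_map_star m k
  have hswap : ∀ H, (hermitianSymplecticModel m k).swap H = (H * K)ᵀ * Kᵀ := fun _ => rfl
  have hmul : ∀ A B : Matrix (Fin m ⊕ Fin m) (Fin m ⊕ Fin m) ℂ, ∀ σ τ : Equiv.Perm (Fin k),
      tensorPow k A * permOp σ * K * (tensorPow k B * permOp τ) =
      tensorPow k (A * Matrix.J (Fin m) ℂ * B) * permOp (σ * τ) := by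
    intro A B σ τ
    rw [hKdef, ← mul_one σ, ← tensorPow_mul_permOp_mul, ← tensorPow_mul_permOp_mul, permOp_one,
      Matrix.mul_one, mul_one]
  have hform : ∀ (g : (hermitianSymplecticModel m k).group) (σ : Equiv.Perm (Fin k)),
      tensorPow k ((g : Matrix.unitaryGroup (Fin m ⊕ Fin m) ℂ) :
        Matrix (Fin m ⊕ Fin m) (Fin m ⊕ Fin m) ℂ) * permOp σ * K *
      (tensorPow k ((g : Matrix.unitaryGroup (Fin m ⊕ Fin m) ℂ) :
        Matrix (Fin m ⊕ Fin m) (Fin m ⊕ Fin m) ℂ) * permOp σ)ᵀ = K := by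
    intro g σ
    rw [tensorPow_mul_permOp_transpose, hmul, SymplecticGroup.mem_iff.1 g.2, mul_inv_cancel,
      permOp_one, Matrix.mul_one]
  have hunit : ∀ (g : (hermitianSymplecticModel m k).group) (σ : Equiv.Perm (Fin k)),
      (tensorPow k ((g : Matrix.unitaryGroup (Fin m ⊕ Fin m) ℂ) :
        Matrix (Fin m ⊕ Fin m) (Fin m ⊕ Fin m) ℂ) * permOp σ)ᴴ *
      (tensorPow k ((g : Matrix.unitaryGroup (Fin m ⊕ Fin m) ℂ) :
        Matrix (Fin m ⊕ Fin m) (Fin m ⊕ Fin m) ℂ) * permOp σ) = 1 := by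
    intro g σ
    rw [tensorPow_mul_permOp_conjTranspose, tensorPow_mul_permOp_mul, inv_mul_cancel, permOp_one,
      Matrix.mul_one, ← Matrix.star_eq_conjTranspose, Matrix.UnitaryGroup.star_mul_self,
      tensorPow_one]
  have hX : (hermitianSymplecticModel m k).IsUnitaryModel := by
    refine isUnitaryModel_of_right
      (fun A B => Matrix.conjTranspose_mul A B) Matrix.conjTranspose_one (fun _ => rfl)
      continuous_conjTranspose ?_ ?_ (fun g σ H => ?_)
      (schurProperty_complex _) (@schurProperty_complex _ _ ⊥)
    -- The twisted transposition is written with the Kronecker factor on the left and on the right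
    -- of plain transposition; the two expressions are adjoint to each other.
    · have h1 : (hermitianSymplecticModel m k).swapMatrix =
          (K ⊗ₖ Kᵀ) * superMatrix (transposeMap _ ℂ) :=
        matrix_eq_of_mulVec_vec fun H => by
          rw [swapMatrix_mulVec_vec, hswap, ← Matrix.mulVec_mulVec, superMatrix_mulVec_vec,
            Matrix.kronecker_mulVec_vec, Matrix.transpose_mul]
          rfl
      have h2 : (hermitianSymplecticModel m k).swapMatrix =
          superMatrix (transposeMap _ ℂ) * (Kᵀ ⊗ₖ K) :=
        matrix_eq_of_mulVec_vec fun H => by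
          rw [swapMatrix_mulVec_vec, hswap, ← Matrix.mulVec_mulVec, Matrix.kronecker_mulVec_vec,
            superMatrix_mulVec_vec, Matrix.transpose_transpose, ← Matrix.transpose_mul,
            ← Matrix.mul_assoc]
          rfl
      conv_lhs => rw [h1]
      rw [h2, Matrix.conjTranspose_mul, superMatrix_transposeMap_conjTranspose,
        Matrix.conjTranspose_kronecker, hKstar, hKstar']
    · refine LinearMap.ext fun H => ?_
      rw [LinearMap.comp_apply, hswap, hswap, Matrix.mul_assoc, hK', Matrix.mul_one,
        Matrix.transpose_transpose, Matrix.mul_assoc, hK, Matrix.mul_one, LinearMap.id_apply]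
    · obtain ⟨h1, h2⟩ := mul_transpose_of_mul_mul_transpose (hunit g σ) hK (hform g σ)
      rw [hswap, hswap]
      set A := tensorPow k ((g : Matrix.unitaryGroup (Fin m ⊕ Fin m) ℂ) :
        Matrix (Fin m ⊕ Fin m) (Fin m ⊕ Fin m) ℂ) * permOp σ
      change (A * H * Aᴴ * K)ᵀ * Kᵀ = A * ((H * K)ᵀ * Kᵀ) * Aᴴ
      simp only [Matrix.transpose_mul, Matrix.mul_assoc]
      rw [h2, ← Matrix.mul_assoc Kᵀ Aᴴᵀ, ← h1, Matrix.mul_assoc]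
  refine hX.isEnsembleModel_of_realStructure (e := Equiv.prodComm _ _) (θ := fun H => Hᴴ)
    (fun p => rfl) (fun H => rfl) (fun H => ?_) (fun H => ?_) (fun g σ H => ?_)
  · change (Hᴴ = H ∧ (H * K)ᵀ = -(H * K)) ↔ (H * K)ᵀ * Kᵀ = (((-1 : ℤˣ) : ℤ) : ℂ) • H ∧ Hᴴ = H
    rw [neg_one_smul_eq_neg, and_comm]
    refine and_congr_left fun _ => ⟨fun h => ?_, fun h => ?_⟩
    · rw [h, Matrix.neg_mul, Matrix.mul_assoc, hK, Matrix.mul_one]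
    · rw [← Matrix.neg_mul, ← h, Matrix.mul_assoc, hK', Matrix.mul_one]
  · change (Hᴴ * K)ᵀ * Kᵀ = ((H * K)ᵀ * Kᵀ)ᴴ
    rw [Matrix.transpose_mul, Matrix.transpose_mul, Matrix.conjTranspose_mul,
      Matrix.conjTranspose_mul, hKstar', tensorPow_J_transpose_mul_mul, Matrix.mul_assoc]
    rfl
  · exact (conjTranspose_mul_mul_conjTranspose _ H).symm

theorem isEnsembleModel_of_isClassical {𝕜 : Type} [RCLike 𝕜] {n : Type} [Fintype n]
    [DecidableEq n] {k : ℕ} {X : MatrixModel 𝕜 n k} (hX : IsClassical X) : X.IsEnsembleModel := by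
  cases hX
  · exact isEnsembleModel_unitaryModel _ _
  · exact isEnsembleModel_orthogonalModel _ _
  · exact isEnsembleModel_symplecticModel _ _
  · exact isEnsembleModel_hermitianSymplecticModel _ _
  · exact isEnsembleModel_realSymplecticModel _ _

end Models

end KFold

theorem mainTheorem2 {𝕜 : Type} [RCLike 𝕜] {n : Type} [Fintype n] [DecidableEq n] {k : ℕ}
    (X : KFold.MatrixModel 𝕜 n k) (hX : KFold.IsClassical X) :
    ∃ (_ : Fintype X.BlockIndex)
      (U : Matrix (KFold.MIdx n k × KFold.MIdx n k) X.BlockIndex 𝕜),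
      -- `U` is unitary (orthogonal if `𝕜 = ℝ`)
      U * Uᴴ = 1 ∧ Uᴴ * U = 1 ∧
      -- `U` decomposes the representation of `G × S_k × ℤ/2` into irreducible ones
      (∀ (g : X.group) (σ : Equiv.Perm (Fin k)),
        Uᴴ * X.rep g σ * U = Matrix.blockDiagonal' fun b : X.Label =>
          (1 : Matrix (Fin b.mult) (Fin b.mult) 𝕜) ⊗ₖ
            (b.mu.mat g ⊗ₖ KFold.SymDual.mat b.mu' σ)) ∧
      Uᴴ * X.swapMatrix * U =
        Matrix.blockDiagonal' (fun b : X.Label => ((b.s : ℤ) : 𝕜) • 1) ∧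
      -- every ensemble has a precision matrix of the stated form, unique once it is required
      -- to map the space of random matrices to itself
      (∀ P : Measure (Matrix (KFold.MIdx n k) (KFold.MIdx n k) 𝕜), X.IsKFoldGaussian P →
        ∃ M : (b : X.Label) → Matrix (Fin b.mult) (Fin b.mult) 𝕜,
          ((∀ b, (M b).PosDef) ∧
            (∀ H ∈ X.space, ∃ H' ∈ X.space, (U * X.blockMatrix M * Uᴴ) *ᵥ H.vec = H'.vec) ∧
            X.HasGaussianDensity P (U * X.blockMatrix M * Uᴴ)) ∧
          ∀ M' : (b : X.Label) → Matrix (Fin b.mult) (Fin b.mult) 𝕜,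
            (∀ b, (M' b).PosDef) →
            (∀ H ∈ X.space, ∃ H' ∈ X.space, (U * X.blockMatrix M' * Uᴴ) *ᵥ H.vec = H'.vec) →
            X.HasGaussianDensity P (U * X.blockMatrix M' * Uᴴ) →
            ∀ b, b.s = X.sign → M' b = M b) ∧
      -- conversely, all positive definite blocks occur
      (∀ M : (b : X.Label) → Matrix (Fin b.mult) (Fin b.mult) 𝕜, (∀ b, (M b).PosDef) →
        ∃ P : Measure (Matrix (KFold.MIdx n k) (KFold.MIdx n k) 𝕜),
          X.IsKFoldGaussian P ∧ X.HasGaussianDensity P (U * X.blockMatrix M * Uᴴ)) :=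
  (KFold.isEnsembleModel_of_isClassical hX).characterization
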